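/- **Setting.** Let $N\ge 1$ be an integer, let $\chi$ be a Dirichlet character modulo $4N$, and let $\lambda,m\in\mathbb Z$, $k=2\lambda+1$. Write $e[x]=e^{2\pi i x}$, $z=u+iv$, $w=\xi+i\eta$ for points of the upper half-plane $\mathbb H$, $\sigma_z=\begin{pmatrix}v^{1/2}&uv^{-1/2}\\0&v^{-1/2}\end{pmatrix}$ and $\kappa(\phi)=\begin{pmatrix}\cos\phi&\sin\phi\\-\sin\phi&\cos\phi\end{pmatrix}$. Let $Q=\frac2N\begin{pmatrix}0&0&-2\\0&1&0\\-2&0&0\end{pmatrix}$, a form of signature $(2,1)$ with $\langle x,x\rangle={}^txQx=\frac2N(x_2^2-4x_1x_3)$, and let $SL_2(\mathbb R)$ act on $\mathbb R^3$ preserving $Q$ by $$\begin{pmatrix}a&b\\c&d\end{pmatrix}\mapsto\begin{pmatrix}a^2&ab&b^2\\2ac&ad+bc&2bd\\c^2&cd&d^2\end{pmatrix}.$$ For $g\in SL_2(\mathbb R)$ put $(p(g)f)(x)=f(g^{-1}x)$. Let $r(\gamma,Q)$ be the Weil representation; for $\gamma=\begin{pmatrix}a&b\\0&d\end{pmatrix}\in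 SL_2(\mathbb R)$ it is $(r(\gamma,Q)f)(x)=|a|^{3/2}\,e\!\left[\tfrac{ab}{2}\langle x,x\rangle\right]f(ax)$. Let $H_\nu(x)=(-1)^\nu e^{x^2/2}\frac{d^\nu}{dx^\nu}e^{-x^2/2}$. Let $f_{k,m}$ be any function of the form $$f_{k,m}(x)=L_m(x)\,H_\mu\!\left(\sqrt{8\pi/N}\,(x_1+x_3)\right)\exp\!\left(-\tfrac{2\pi}{N}(2x_1^2+x_2^2+2x_3^2)\right),$$ $$L_m(x)=\frac1{2\pi}\int_0^{2\pi}e^{2mi\phi}L(\kappa(\phi)^{-1}x)\,d\phi,\qquad L(x)=H_{\nu_1}\!\left(\sqrt{8\pi/N}\,(x_1-x_3)\right)H_{\nu_2}\!\left(\sqrt{8\pi/N}\,x_2\right),$$ where $\mu,\nu_1,\nu_2\ge0$ are integers with $\nu_1+\nu_2-\mu=\lambda$ and $|m|\le\lambda+\mu$; if $m=\lambda\ge0$ and $\mu=0$, then $(x_1-ix_2-x_3)^\lambda$ may also be taken in place of $L_m(x)$. Let $\chi_1=\chi\left(\frac{-1}{\cdot}\right)^\lambda$, $\check{\bar\chi}_1(l)=\sum_{h=1}^{4N}\bar\chi_1(h)e^{2\pi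 ihl/4N}$, $L_N^*=\frac14\mathbb Z\oplus\frac12\mathbb Z\oplus\frac14\mathbb Z$, and $$\theta(z,w;f_{k,m})=(32N^3)^{-1/2}\,i^\lambda\,v^{-k/4}(4\eta)^{-m}\sum_{x\in L_N^*}\check{\bar\chi}_1(4x_1)\,\{r(\sigma_{4Nz},Q)\,p(\sigma_{2Nw})f_{k,m}\}(x).$$ For $\gamma=\begin{pmatrix}a&b\\c&d\end{pmatrix}\in\Gamma_0(4)$ let $j(\gamma,z)=\epsilon_d^{-1}\left(\frac cd\right)(cz+d)^{1/2}$ with the principal square root, $\epsilon_d=1$ or $i$ according as $d\equiv1$ or $3\pmod 4$, and Shimura's quadratic residue symbol $\left(\frac cd\right)$. Let $G_{k/2}(\Gamma_0(4N),\chi)$ (recall that $k$ is odd) be the space of $C^\infty$ functions $f:\mathbb H\to\mathbb C$ with $j(\gamma,z)^{-k}f(\gamma z)=\chi(d)f(z)$ for all $\gamma\in\Gamma_0(4N)$, and let $G_{2m}(\Gamma_0(2N),\chi^2)$ be the space of $C^\infty$ functions $f:\mathbb H\to\mathbb C$ with $(cw+d)^{-2m}f(\gamma w)=\chi(d)^2f(w)$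 for all $\gamma\in\Gamma_0(2N)$. **Theorem.** The series defining $\theta(z,w;f_{k,m})$ converges absolutely for all $z,w\in\mathbb H$, and 1. for every $w\in\mathbb H$, $\theta(z,w;f_{k,m})\in G_{k/2}(\Gamma_0(4N),\chi)$ as a function of $z$; 2. for every $z\in\mathbb H$, $\overline{\theta(z,w;f_{k,m})}\in G_{2m}(\Gamma_0(2N),\chi^2)$ as a function of $w$. -/

import Mathlib

open scoped UpperHalfPlane MatrixGroups ModularForm ContDiff Matrix

noncomputable section

namespace IndefTheta

/-! ### Nonholomorphic modular forms -/

/-- Shimura's quadratic residue symbol `(c/d)` for odd `d` (and `(0/±1) = 1`). -/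
def quadSymbol (c d : ℤ) : ℤ :=
  (if c < 0 ∧ d < 0 then -1 else 1) * jacobiSym c d.natAbs

/-- `ε_d = 1` or `i` according as the odd number `d` is `1` or `3` modulo `4`. -/
def epsilon (d : ℤ) : ℂ := if d % 4 = 1 then 1 else Complex.I

/-- The theta multiplier `j(γ, z) = ε_d⁻¹ (c/d) (cz + d)^(1/2)`, principal square root. -/
def thetaMultiplier (γ : SL(2, ℤ)) (z : ℍ) : ℂ :=
  (epsilon (γ 1 1))⁻¹ * (quadSymbol (γ 1 0) (γ 1 1) : ℂ) *
    ((γ 1 0 : ℂ) * (z : ℂ) + (γ 1 1 : ℂ)) ^ (1 / 2 : ℂ)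

/-- The slash operator of weight `k/2`, for odd `k` and `γ ∈ Γ₀(4)`. -/
def slashHalf (k : ℤ) (γ : SL(2, ℤ)) (f : ℍ → ℂ) : ℍ → ℂ :=
  fun z => thetaMultiplier γ z ^ (-k) * f (γ • z)

/-- Real-smoothness of a function on the upper half-plane. -/
def SmoothOnH (f : ℍ → ℂ) : Prop :=
  ContDiffOn ℝ ∞ (fun z : ℂ => f (UpperHalfPlane.ofComplex z)) {z : ℂ | 0 < z.im}

/-- `G_{k/2}(Γ, ψ)` for odd `k`, where `Γ ⊆ Γ₀(4)`; the character is `γ ↦ ψ d`. -/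
def nonholFormsHalf (k : ℤ) (Γ : Subgroup SL(2, ℤ)) (ψ : ℤ → ℂ) : Set (ℍ → ℂ) :=
  {f | SmoothOnH f ∧ ∀ γ ∈ Γ, ∀ z : ℍ, slashHalf k γ f z = ψ (γ 1 1) * f z}

/-- `G_k(Γ, ψ)` for an integer `k`; the character is `γ ↦ ψ d`. -/
def nonholForms (k : ℤ) (Γ : Subgroup SL(2, ℤ)) (ψ : ℤ → ℂ) : Set (ℍ → ℂ) :=
  {f | SmoothOnH f ∧ ∀ γ ∈ Γ, ∀ z : ℍ, (f ∣[k] γ) z = ψ (γ 1 1) * f z}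

/-! ### The Weil representation and the action of the orthogonal group -/

/-- `e[x] = exp (2πix)`. -/
def expo (x : ℝ) : ℂ := Complex.exp (2 * Real.pi * Complex.I * x)

/-- The inner product `⟨x, y⟩ = ᵗx Q y`. -/
def innerQ {n : ℕ} (Q : Matrix (Fin n) (Fin n) ℝ) (x y : Fin n → ℝ) : ℝ := x ⬝ᵥ (Q *ᵥ y)

/-- The Weil representation `r(γ, Q)`. -/
def weil {n : ℕ} (γ : SL(2, ℝ)) (Q : Matrix (Fin n) (Fin n) ℝ) (f : (Fin n → ℝ) → ℂ) :
    (Fin n → ℝ) → ℂ := fun x =>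
  if γ 1 0 = 0 then
    ((|γ 0 0| ^ ((n : ℝ) / 2) : ℝ) : ℂ) * expo (γ 0 0 * γ 0 1 / 2 * innerQ Q x x) *
      f (γ 0 0 • x)
  else
    ((|Q.det| ^ (1 / 2 : ℝ) * |γ 1 0| ^ (-((n : ℝ) / 2)) : ℝ) : ℂ) *
      ∫ y : Fin n → ℝ,
        expo ((γ 0 0 * innerQ Q x x - 2 * innerQ Q x y + γ 1 1 * innerQ Q y y) / (2 * γ 1 0)) *
          f y

/-- The form `Q(x) = (2/N) (x₂² - 4 x₁ x₃)`, of signature `(2, 1)`. -/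
def formQ (N : ℕ) : Matrix (Fin 3) (Fin 3) ℝ :=
  (2 / (N : ℝ)) • !![0, 0, -2; 0, 1, 0; -2, 0, 0]

/-- The matrix through which `SL₂(ℝ)` acts on binary quadratic forms. -/
def symMatrix (g : SL(2, ℝ)) : Matrix (Fin 3) (Fin 3) ℝ :=
  !![g 0 0 ^ 2, g 0 0 * g 0 1, g 0 1 ^ 2;
     2 * g 0 0 * g 1 0, g 0 0 * g 1 1 + g 0 1 * g 1 0, 2 * g 0 1 * g 1 1;
     g 1 0 ^ 2, g 1 0 * g 1 1, g 1 1 ^ 2]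

theorem symMatrix_det (g : SL(2, ℝ)) : (symMatrix g).det = 1 := by
  have h : g 0 0 * g 1 1 - g 0 1 * g 1 0 = 1 := by
    have := g.det_coe
    rwa [Matrix.det_fin_two] at this
  have h3 : (symMatrix g).det = (g 0 0 * g 1 1 - g 0 1 * g 1 0) ^ 3 := by
    rw [Matrix.det_fin_three]
    simp [symMatrix]
    ring
  rw [h3, h, one_pow]

theorem symMatrix_mul (g h : SL(2, ℝ)) : symMatrix (g * h) = symMatrix g * symMatrix h := by
  ext i j
  fin_cases i <;> fin_cases j <;>
    simp [symMatrix, Matrix.mul_apply, Fin.sum_univ_succ] <;> ring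

/-- The homomorphism from `SL₂(ℝ)` to `SO(Q)`. -/
def toSO : SL(2, ℝ) →* SL(3, ℝ) :=
  MonoidHom.mk' (fun g => ⟨symMatrix g, symMatrix_det g⟩)
    (fun g h => Subtype.ext (symMatrix_mul g h))

theorem toSO_coe (g : SL(2, ℝ)) : (toSO g).1 = symMatrix g := rfl

theorem toSO_preserves (N : ℕ) (g : SL(2, ℝ)) :
    (toSO g).1ᵀ * formQ N * (toSO g).1 = formQ N := by
  have h : g 1 1 * g 0 0 = 1 + g 0 1 * g 1 0 := by
    have := g.det_coe
    rw [Matrix.det_fin_two] at this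
    linarith
  rw [toSO_coe]
  ext i j
  fin_cases i <;> fin_cases j <;>
    simp [symMatrix, formQ, Matrix.mul_apply, Fin.sum_univ_succ] <;>
    grind

/-- `(p(g) f)(x) = f(g⁻¹ x)`. -/
def orthAct (g : SL(3, ℝ)) (f : (Fin 3 → ℝ) → ℂ) : (Fin 3 → ℝ) → ℂ :=
  fun x => f ((g⁻¹ : SL(3, ℝ)).1 *ᵥ x)

/-- `σ_z`, the upper triangular matrix that sends `i` to `z = u + iv`. -/
def sigma (z : ℍ) : SL(2, ℝ) :=
  ⟨!![√z.im, z.re / √z.im; 0, 1 / √z.im], by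
    have : √z.im ≠ 0 := (Real.sqrt_pos.2 z.im_pos).ne'
    simp [Matrix.det_fin_two, this]⟩

/-- The rotation `κ(φ)`. -/
def kappa (φ : ℝ) : SL(2, ℝ) :=
  ⟨!![Real.cos φ, Real.sin φ; -Real.sin φ, Real.cos φ], by
    rw [Matrix.det_fin_two_of]
    nlinarith [Real.sin_sq_add_cos_sq φ]⟩

/-- The point `n z` of the upper half-plane, for a positive integer `n`. -/
def dilate (n : ℕ) [NeZero n] (z : ℍ) : ℍ :=
  (⟨(n : ℝ), Nat.cast_pos.2 (NeZero.pos n)⟩ : {x : ℝ // 0 < x}) • z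

/-! ### Cipra's Schwartz functions -/

/-- The Hermite polynomial `H_ν(x) = (-1)^ν exp(x²/2) (d/dx)^ν exp(-x²/2)`. -/
def hermiteH (ν : ℕ) (x : ℝ) : ℝ := Polynomial.aeval x (Polynomial.hermite ν)

/-- `exp (-(2π/N) (2x₁² + x₂² + 2x₃²))`. -/
def gauss (N : ℕ) (x : Fin 3 → ℝ) : ℝ :=
  Real.exp (-2 * Real.pi / N * (2 * x 0 ^ 2 + x 1 ^ 2 + 2 * x 2 ^ 2))

/-- `H_{ν₁}(√(8π/N) (x₁ - x₃)) H_{ν₂}(√(8π/N) x₂)`. -/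
def polyL (N ν₁ ν₂ : ℕ) (x : Fin 3 → ℝ) : ℝ :=
  hermiteH ν₁ (√(8 * Real.pi / N) * (x 0 - x 2)) * hermiteH ν₂ (√(8 * Real.pi / N) * x 1)

/-- The component of `polyL` on which rotations act with weight `2m`. -/
def polyLm (N : ℕ) (m : ℤ) (ν₁ ν₂ : ℕ) (x : Fin 3 → ℝ) : ℂ :=
  1 / (2 * Real.pi) * ∫ φ in (0 : ℝ)..(2 * Real.pi),
    Complex.exp (2 * m * Complex.I * φ) *
      (polyL N ν₁ ν₂ (((toSO (kappa φ))⁻¹ : SL(3, ℝ)).1 *ᵥ x) : ℂ)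

/-- The function `f_{m,λ,μ}` with `λ = ν₁ + ν₂ - μ`. -/
def schwartzFn (N : ℕ) (m : ℤ) (ν₁ ν₂ μ : ℕ) (x : Fin 3 → ℝ) : ℂ :=
  polyLm N m ν₁ ν₂ x * (hermiteH μ (√(8 * Real.pi / N) * (x 0 + x 2)) : ℂ) * (gauss N x : ℂ)

/-- `f` is an admissible choice of `f_{k,m}`, where `k/2 = l + 1/2`: either `f_{m,l,μ}` for some
`μ` with `|m| ≤ l + μ` and some `ν₁, ν₂` with `ν₁ + ν₂ - μ = l`, or, when `m = l` (and `μ = 0`),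
the function `(x₁ - i x₂ - x₃)^l` times the Gaussian. -/
def IsThetaKernelFn (N : ℕ) (l m : ℤ) (f : (Fin 3 → ℝ) → ℂ) : Prop :=
  (∃ μ ν₁ ν₂ : ℕ, (ν₁ : ℤ) + ν₂ - μ = l ∧ |m| ≤ l + μ ∧ f = schwartzFn N m ν₁ ν₂ μ) ∨
  (∃ n : ℕ, l = n ∧ m = n ∧
    f = fun x => ((x 0 : ℂ) - Complex.I * x 1 - x 2) ^ n * (gauss N x : ℂ))

/-! ### The theta function -/

/-- `χ₁ = χ (-1/·)^l`. -/
def chiOne {N : ℕ} (χ : DirichletCharacter ℂ (4 * N)) (l : ℤ) (h : ℤ) : ℂ :=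
  χ (h : ZMod (4 * N)) * ((ZMod.χ₄ (h : ZMod 4) : ℤ) : ℂ) ^ l

/-- The finite Fourier transform `∑_{h=1}^{4N} χ̄₁(h) e^{2πiht/4N}` of `χ̄₁`. -/
def chiCheck {N : ℕ} (χ : DirichletCharacter ℂ (4 * N)) (l : ℤ) (t : ℝ) : ℂ :=
  ∑ h ∈ Finset.Icc (1 : ℕ) (4 * N), starRingEnd ℂ (chiOne χ l (h : ℤ)) *
    expo ((h : ℝ) * t / (4 * (N : ℝ)))

/-- The points of the lattice `L_N^* = ℤ/4 ⊕ ℤ/2 ⊕ ℤ/4`. -/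
def dualPoint (n : Fin 3 → ℤ) : Fin 3 → ℝ := ![(n 0 : ℝ) / 4, (n 1 : ℝ) / 2, (n 2 : ℝ) / 4]

/-- The summand of the theta series at `x`. -/
def thetaTerm {N : ℕ} [NeZero N] (χ : DirichletCharacter ℂ (4 * N)) (l : ℤ)
    (f : (Fin 3 → ℝ) → ℂ) (z w : ℍ) (x : Fin 3 → ℝ) : ℂ :=
  chiCheck χ l (4 * x 0) *
    weil (sigma (dilate (4 * N) z)) (formQ N)
      (orthAct (toSO (sigma (dilate (2 * N) w))) f) x

/-- The theta function `θ(z, w; f)`, with `k = 2l + 1`. -/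
def theta {N : ℕ} [NeZero N] (χ : DirichletCharacter ℂ (4 * N)) (l m : ℤ)
    (f : (Fin 3 → ℝ) → ℂ) (z w : ℍ) : ℂ :=
  ((32 * (N : ℝ) ^ 3) ^ (-(1 / 2) : ℝ) : ℝ) * Complex.I ^ l *
    ((z.im ^ (-((2 * l + 1 : ℤ) : ℝ) / 4) : ℝ) : ℂ) * (((4 * w.im) ^ (-m) : ℝ) : ℂ) *
    ∑' n : Fin 3 → ℤ, thetaTerm χ l f z w (dualPoint n)

end IndefTheta

end

/-! Once the elementary factors are pulled out (`theta_eq`), both laws concern one series over ℤ³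
whose phase is e[u(n₁² - n₀n₂)]. They come from two unrelated symmetries of it.

Law in z. The general Weil representation is avoided. The products of Hermite functions are replaced
by their generating function `genFn`, a Gaussian with a complex parameter b ∈ ℂ³. The form n₁² -
n₀n₂ is a line plus a hyperbolic plane in (n₀, n₂). Poisson summation in n₀ alone
(`tsum_genTerm_eq`) turns the series into a sum over pairs (s, j), with 4N dividing s, of the
conjugate of χ₁(-j) times `modKernel`. This kernel is essentially a Gaussian in j + sz times a
Jacobi theta function, which is the remaining sum over n₁. For γ in Γ₀(4N), replacing z by γz
amounts to replacing the row (s, j) by (s, j)γ (`modKernel_smul`). The rows are permuted, the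
character gives χ₁(d), the Jacobi theta function gives j(γ, z), and b is rotated by the phase of cz
+ d: in one sense in the two positive directions of Q, in the opposite sense in the negative one. By
Cauchy's formula f is an average of functions `genFn` and is multiplied by ε^λ when the parameters
are rotated by ε (`IsGenAverage`). Integrating the law of the generating series therefore gives the
law of θ, the weights being matched by j(γ, z)² = (-1/d)(cz + d).

The transformation of the Jacobi theta function under all of Γ₀(4), with Shimura's multiplier, is
`thetaLaw_of_four_dvd`. It is a Euclidean descent on the bottom row, whose steps are translations,
the matrices with rows (1, 0), (±4, 1), and -I. Reciprocity shows that the residue symbol does not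
change when d becomes d - |c|.

Law in w. Conjugating Γ₀(2N) by diag(2N, 1) gives integral matrices that preserve the dual lattice
and the form and multiply n₀ by a² modulo 4N. By `sigma_smul`, σ at γw differs from the translate of
σ at w by a rotation through arg(cw + d), under which f has weight 2m
(`IsThetaKernelFn.kappa_apply`).

Smoothness. f is a polynomial times a Gaussian, so θ is a smooth combination of sums ∑ c(n)
exp(A(n)), where c grows polynomially and A is a quadratic form with negative definite real part.
Differentiating in A only multiplies c by n_i n_j. -/

noncomputable section

namespace IndefTheta

open Complex Real

/-! ### Reciprocity for Shimura's residue symbol and multiplicativity of the principal square root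
-/

section

-- For positive a the symbol (a/·) is even and periodic modulo 4a. Factors 2 are split off because
-- (2/·) is even modulo 8. For odd a, reciprocity is used: χ₄(b) = -χ₄(d) and b ≡ -d mod a each
-- contribute χ₄(a), and the two cancel.
open NumberTheorySymbols in
theorem jacobiSym_eq_of_four_mul_dvd_add {a b d : ℕ} (ha : a ≠ 0) (hb : Odd b) (hd : Odd d)
    (h : 4 * a ∣ b + d) : jacobiSym a b = jacobiSym a d := by
  induction a using Nat.strong_induction_on generalizing b d with
  | _ a ih =>
    rcases Nat.even_or_odd' a with ⟨a', rfl | rfl⟩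
    · have h1 := ih a' (by lia) (by lia) hb hd (Dvd.dvd.trans ⟨2, by ring⟩ h)
      push_cast
      rw [jacobiSym.mul_left, jacobiSym.mul_left, h1, jacobiSym.at_two hb, jacobiSym.at_two hd]
      congr 1
      have h8 : (8 : ℕ) ∣ b + d := Dvd.dvd.trans ⟨a', by ring⟩ h
      have hbd : (b : ZMod 8) = -(d : ZMod 8) := by
        rw [eq_neg_iff_add_eq_zero]
        exact_mod_cast (ZMod.natCast_eq_zero_iff (b + d) 8).2 h8
      rw [hbd]
      generalize (d : ZMod 8) = t
      revert t
      decide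
    · set A := 2 * a' + 1 with hA
      have hAo : Odd A := ⟨a', rfl⟩
      rw [jacobiSym.quadratic_reciprocity' hAo hb, jacobiSym.quadratic_reciprocity' hAo hd]
      have h4 : (4 : ℕ) ∣ b + d := Dvd.dvd.trans ⟨A, by ring⟩ h
      have hbd : (b : ZMod 4) = -(d : ZMod 4) := by
        rw [eq_neg_iff_add_eq_zero]
        exact_mod_cast (ZMod.natCast_eq_zero_iff (b + d) 4).2 h4
      have hχ : ZMod.χ₄ (b : ZMod 4) = -ZMod.χ₄ (d : ZMod 4) := by
        rw [hbd]
        generalize (d : ZMod 4) = t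
        revert t
        decide
      have hJ : jacobiSym b A = jacobiSym (-(d : ℤ)) A := by
        apply jacobiSym.mod_left'
        apply Int.ModEq.symm
        rw [Int.modEq_iff_dvd]
        obtain ⟨k, hk⟩ := h
        have hk' : (b : ℤ) + d = 4 * A * k := by exact_mod_cast hk
        exact ⟨4 * k, by linear_combination hk'⟩
      have hsq : (ZMod.χ₄ (A : ZMod 4)) * ZMod.χ₄ (A : ZMod 4) = 1 := by
        rcases Nat.odd_mod_four_iff.1 (Nat.odd_iff.1 hAo) with h | h
        · rw [ZMod.χ₄_nat_one_mod_four h]; norm_num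
        · rw [ZMod.χ₄_nat_three_mod_four h]; norm_num
      rw [qrSign, qrSign, hχ, hJ, jacobiSym.neg _ hAo, jacobiSym.neg _ hAo]
      linear_combination (jacobiSym (ZMod.χ₄ d) A * jacobiSym d A) * hsq

/-- With c = 4a the square factor 4 drops out and |c| = 4|a| is a period. If d > |c|, periodicity
suffices. If d < |c|, the previous lemma applies to d and |c| - d, whose sum is 4|a|; for c < 0 the
sign built into Shimura's symbol cancels the change of (-1/·). -/
theorem quadSymbol_sub_natAbs {c d : ℤ} (hc : 4 ∣ c) (hc0 : c ≠ 0) (hd : Odd d) (hd0 : 0 < d) :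
    quadSymbol c (d - |c|) = quadSymbol c d := by
  obtain ⟨a, rfl⟩ := hc
  have ha : a ≠ 0 := by rintro rfl; simp at hc0
  lift d to ℕ using hd0.le
  have hdo : Odd d := by exact_mod_cast hd
  have key (b : ℕ) (hb : Odd b) : jacobiSym (4 * a) b = jacobiSym a b := by
    rw [← jacobiSym.div_four_left (a := 4 * a) (by omega) (Nat.odd_iff.1 hb)]
    congr 1
    omega
  have habs : |4 * a| = ((4 * a.natAbs : ℕ) : ℤ) := by push_cast; rw [abs_mul]; rfl
  rw [habs]
  have hne : d ≠ 4 * a.natAbs := by rintro rfl; revert hdo; rw [← Nat.not_even_iff_odd]; grind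
  rcases lt_or_gt_of_ne hne with hlt | hlt
  · have hodd : Odd (4 * a.natAbs - d) := by
      rw [Nat.odd_iff] at hdo ⊢; omega
    have hna : ((d : ℤ) - ((4 * a.natAbs : ℕ) : ℤ)).natAbs = 4 * a.natAbs - d := by omega
    have hneg : (d : ℤ) - ((4 * a.natAbs : ℕ) : ℤ) < 0 := by omega
    have h1 := jacobiSym_eq_of_four_mul_dvd_add (a := a.natAbs) (by omega) hodd hdo (by
      rw [Nat.sub_add_cancel hlt.le])
    have hd' : ¬ ((d : ℤ) < 0) := by omega
    simp only [quadSymbol, hna, hneg, hd', and_true, and_false, if_false, one_mul,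
      Int.natAbs_natCast]
    rw [key _ hodd, key _ hdo]
    rcases lt_or_gt_of_ne ha with h | h
    · have h4 : 4 * a < 0 := by omega
      have haa : a = -(a.natAbs : ℤ) := by omega
      rw [if_pos h4]
      have hJ (b : ℕ) : jacobiSym a b = jacobiSym (-(a.natAbs : ℤ)) b := by rw [← haa]
      rw [hJ, hJ, jacobiSym.neg _ hodd, jacobiSym.neg _ hdo, h1]
      have hχ : ZMod.χ₄ ((4 * a.natAbs - d : ℕ) : ZMod 4) = -ZMod.χ₄ (d : ZMod 4) := by
        rw [Nat.cast_sub hlt.le]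
        push_cast
        rw [show (4 : ZMod 4) = 0 from rfl, zero_mul, zero_sub]
        generalize (d : ZMod 4) = t
        revert t
        decide
      rw [hχ]
      ring
    · have h4 : ¬ (4 * a < 0) := by omega
      have haa : a = (a.natAbs : ℤ) := by omega
      have hJ (b : ℕ) : jacobiSym a b = jacobiSym (a.natAbs : ℤ) b := by rw [← haa]
      rw [if_neg h4, one_mul, hJ, hJ, h1]
  · have hodd : Odd (d - 4 * a.natAbs) := by
      rw [Nat.odd_iff] at hdo ⊢; omega
    have hna : ((d : ℤ) - ((4 * a.natAbs : ℕ) : ℤ)).natAbs = d - 4 * a.natAbs := by omega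
    have hneg : ¬ ((d : ℤ) - ((4 * a.natAbs : ℕ) : ℤ) < 0) := by omega
    have hd' : ¬ ((d : ℤ) < 0) := by omega
    simp only [quadSymbol, hna, hneg, hd', and_false, if_false, one_mul,
      Int.natAbs_natCast]
    rw [key _ hodd, key _ hdo, jacobiSym.mod_right _ hodd, jacobiSym.mod_right _ hdo]
    congr 1
    rw [← Nat.mod_eq_sub_mod hlt.le]

/-- The principal root is the exponential of half the logarithm, so it is multiplicative as soon as
the arguments add without wrapping around. -/
theorem sqrt_mul_of_arg {x y : ℂ} (hx : x ≠ 0) (hy : y ≠ 0)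
    (h : arg x + arg y ∈ Set.Ioc (-π) π) :
    (x * y) ^ (1 / 2 : ℂ) = x ^ (1 / 2 : ℂ) * y ^ (1 / 2 : ℂ) := by
  rw [cpow_def_of_ne_zero (mul_ne_zero hx hy), cpow_def_of_ne_zero hx, cpow_def_of_ne_zero hy,
    Complex.log_mul hx hy h, add_mul, Complex.exp_add]

end

theorem norm_mul_sin_add_arg (x y : ℂ) :
    ‖x‖ * ‖y‖ * Real.sin (arg x + arg y) = (x * y).im := by
  rw [Real.sin_add, mul_im]
  rw [← norm_mul_cos_arg x]
  rw [← norm_mul_sin_arg x]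
  rw [← norm_mul_cos_arg y]
  rw [← norm_mul_sin_arg y]
  ring

theorem norm_mul_cos_add_arg (x y : ℂ) :
    ‖x‖ * ‖y‖ * Real.cos (arg x + arg y) = (x * y).re := by
  rw [Real.cos_add, mul_re]
  rw [← norm_mul_cos_arg x]
  rw [← norm_mul_sin_arg x]
  rw [← norm_mul_cos_arg y]
  rw [← norm_mul_sin_arg y]
  ring

/-- In opposite half-planes the arguments have opposite signs and cannot wrap. In the same
half-plane a wrap would put the product on the other side, or on the real axis, which the sign of
sin(arg x + arg y) excludes. -/
theorem sqrt_mul_of_im {x y : ℂ} (hx : x.im = 0 → 0 < x.re) (hy : y.im ≠ 0)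
    (hpos : 0 < x.im → 0 < y.im → 0 < (x * y).im)
    (hneg : x.im < 0 → y.im < 0 → (x * y).im < 0) :
    (x * y) ^ (1 / 2 : ℂ) = x ^ (1 / 2 : ℂ) * y ^ (1 / 2 : ℂ) := by
  have hx0 : x ≠ 0 := by rintro rfl; simp at hx
  have hy0 : y ≠ 0 := by rintro rfl; simp at hy
  apply sqrt_mul_of_arg hx0 hy0
  have hnx := norm_pos_iff.2 hx0
  have hny := norm_pos_iff.2 hy0
  have hs := norm_mul_sin_add_arg x y
  have hxI := arg_mem_Ioc x
  have hyI := arg_mem_Ioc y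
  have hpi := Real.pi_pos
  rcases lt_trichotomy x.im 0 with h | h | h
  · have hxa := arg_neg_iff.2 h
    rcases lt_or_gt_of_ne hy with h' | h'
    · have hya := arg_neg_iff.2 h'
      have := hneg h h'
      refine ⟨?_, by linarith⟩
      by_contra hcon
      push Not at hcon
      have h1 : 0 ≤ Real.sin (arg x + arg y) := by
        rw [← Real.sin_add_two_pi]
        exact Real.sin_nonneg_of_nonneg_of_le_pi (by linarith [hxI.1, hyI.1]) (by linarith)
      nlinarith [mul_nonneg (mul_nonneg hnx.le hny.le) h1]
    · have hya := arg_nonneg_iff.2 h'.le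
      exact ⟨by linarith [hxI.1], by linarith [hyI.2]⟩
  · have : arg x = 0 := arg_eq_zero_iff.2 ⟨(hx h).le, h⟩
    rw [this, zero_add]
    exact hyI
  · have hxa := arg_nonneg_iff.2 h.le
    rcases lt_or_gt_of_ne hy with h' | h'
    · have hya := arg_neg_iff.2 h'
      exact ⟨by linarith [hyI.1], by linarith [hxI.2]⟩
    · have hya := arg_nonneg_iff.2 h'.le
      have := hpos h h'
      refine ⟨by linarith, ?_⟩
      by_contra hcon
      push Not at hcon
      have h1 : Real.sin (arg x + arg y) ≤ 0 := by
        rw [← Real.sin_sub_two_pi]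
        exact Real.sin_nonpos_of_nonpos_of_neg_pi_le (by linarith [hxI.2, hyI.2]) (by linarith)
      nlinarith [mul_nonneg (mul_nonneg hnx.le hny.le) (neg_nonneg.2 h1)]

/-- The sum of the arguments exceeds -π/2 and stays below 3π/2. Past π its cosine would be
nonpositive, against 0 < Re(xy). -/
theorem sqrt_mul_of_re {x y : ℂ} (hx : 0 < x.re) (hy : 0 < y.im) (hxy : 0 < (x * y).re) :
    (x * y) ^ (1 / 2 : ℂ) = x ^ (1 / 2 : ℂ) * y ^ (1 / 2 : ℂ) := by
  have hx0 : x ≠ 0 := by rintro rfl; simp at hx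
  have hy0 : y ≠ 0 := by rintro rfl; simp at hy
  apply sqrt_mul_of_arg hx0 hy0
  have hnx := norm_pos_iff.2 hx0
  have hny := norm_pos_iff.2 hy0
  have hs := norm_mul_cos_add_arg x y
  have hxI := abs_lt.1 (abs_arg_lt_pi_div_two_iff.2 (Or.inl hx))
  have hyI := arg_mem_Ioc y
  have hya := arg_nonneg_iff.2 hy.le
  have hpi := Real.pi_pos
  refine ⟨by linarith [hxI.1], ?_⟩
  by_contra hcon
  push Not at hcon
  have h1 : Real.cos (arg x + arg y) ≤ 0 :=
    Real.cos_nonpos_of_pi_div_two_le_of_le (by linarith) (by linarith [hxI.2, hyI.2])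
  nlinarith [mul_nonneg (mul_nonneg hnx.le hny.le) (neg_nonneg.2 h1)]

/-! ### The Jacobi theta function under Γ₀(4) -/

/-- The theta multiplier as a function of the bottom row. -/
def thetaMult (c d : ℤ) (z : ℂ) : ℂ :=
  (epsilon d)⁻¹ * (quadSymbol c d : ℂ) * ((c : ℂ) * z + d) ^ (1 / 2 : ℂ)

/-- The transformation law of the Jacobi form `∑ e[n² z + n y]` of weight `1/2` and index `1/4`. -/
def ThetaLaw (a b c d : ℤ) : Prop := ∀ z y : ℂ, 0 < z.im →
  jacobiTheta₂ (y / (c * z + d)) (2 * ((a * z + b) / (c * z + d))) =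
    thetaMult c d z * cexp (π * I * (c * y ^ 2 / (2 * (c * z + d)))) * jacobiTheta₂ y (2 * z)

theorem jacobiTheta₂_add_two_mul_int (y τ : ℂ) (k : ℤ) :
    jacobiTheta₂ y (τ + 2 * k) = jacobiTheta₂ y τ := by
  induction k using Int.induction_on with
  | zero => simp
  | succ n ih =>
    rw [← ih, ← jacobiTheta₂_add_right y (τ + 2 * ((n : ℤ) : ℂ))]
    congr 1
    push_cast
    ring
  | pred n ih =>
    rw [← ih, ← jacobiTheta₂_add_right y (τ + 2 * ((-n - 1 : ℤ) : ℂ))]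
    congr 1
    push_cast
    ring

theorem linear_ne_zero_of_im_pos {c d : ℤ} (h : c ≠ 0 ∨ d ≠ 0) {z : ℂ} (hz : 0 < z.im) :
    (c : ℂ) * z + d ≠ 0 := by
  intro h0
  have him := congrArg Complex.im h0
  have hre := congrArg Complex.re h0
  simp at him hre
  rcases him with h1 | h1
  · subst h1
    simp at hre h
    exact h hre
  · exact hz.ne' h1

theorem im_linear (c d : ℤ) (z : ℂ) : ((c : ℂ) * z + d).im = c * z.im := by simp

theorem row_ne_zero {a b c d : ℤ} (h : a * d - b * c = 1) : c ≠ 0 ∨ d ≠ 0 := by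
  by_contra hcon
  push Not at hcon
  rw [hcon.1, hcon.2] at h
  simp at h

theorem im_moebius {a b c d : ℤ} (h : a * d - b * c = 1) {z : ℂ} (hz : 0 < z.im) :
    0 < (((a : ℂ) * z + b) / (c * z + d)).im := by
  have hne : (c : ℂ) * z + d ≠ 0 := linear_ne_zero_of_im_pos (row_ne_zero h) hz
  have hn := normSq_pos.2 hne
  rw [div_im]
  have hdet : (a : ℝ) * d - b * c = 1 := by exact_mod_cast h
  have : (((a : ℂ) * z + b).im * ((c : ℂ) * z + d).re - ((a : ℂ) * z + b).re * ((c : ℂ) * z + d).im)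
      = z.im := by
    simp
    linear_combination z.im * hdet
  rw [← sub_div, this]
  positivity

/-- Replace z by z + k: the right side keeps its theta value because 2z moves by a multiple of the
period 2. Only the symbol and ε_d have to be compared. -/
theorem ThetaLaw.translate {a b c d : ℤ} (k : ℤ) (h : ThetaLaw a b c d)
    (hs : quadSymbol c (d + k * c) = quadSymbol c d) (he : epsilon (d + k * c) = epsilon d) :
    ThetaLaw a (b + k * a) c (d + k * c) := by
  intro z y hz
  have h1 := h (z + k) y (by simpa using hz)
  have e1 : (c : ℂ) * (z + k) + d = c * z + (d + k * c : ℤ) := by push_cast; ring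
  have e2 : (a : ℂ) * (z + k) + b = a * z + (b + k * a : ℤ) := by push_cast; ring
  rw [e1, e2, mul_add 2 z, jacobiTheta₂_add_two_mul_int] at h1
  rw [h1, thetaMult, thetaMult, e1, hs, he]

theorem cpow_half_mul_self {x : ℂ} (hx : x ≠ 0) : x ^ (1 / 2 : ℂ) * x ^ (1 / 2 : ℂ) = x := by
  rw [← cpow_add _ _ hx]
  norm_num

/-- Since -1/(2z/(4z+1)) = -1/(2z) - 2, the map is a translation by one period conjugated by the
inversion, and the functional equation is used on both sides. -/
theorem thetaLaw_four : ThetaLaw 1 0 4 1 := by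
  intro z y hz
  have hz0 : z ≠ 0 := by rintro rfl; simp at hz
  have h4 : 4 * z + 1 ≠ 0 := by
    have := linear_ne_zero_of_im_pos (c := 4) (d := 1) (by simp) hz
    simpa using this
  have hV : 0 < (z / (4 * z + 1)).im := by
    have := im_moebius (a := 1) (b := 0) (c := 4) (d := 1) (by norm_num) hz
    simpa using this
  have hm : thetaMult 4 1 z = (4 * z + 1) ^ (1 / 2 : ℂ) := by
    simp [thetaMult, epsilon, quadSymbol]
  rw [hm]
  push_cast
  have hIm : 0 < (4 * z + 1).im := by simpa using hz
  obtain ⟨D, hD⟩ : ∃ D, D = 4 * z + 1 := ⟨_, rfl⟩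
  rw [← hD] at h4 hV hIm ⊢
  rw [one_mul, add_zero, jacobiTheta₂_functional_equation,
    jacobiTheta₂_functional_equation y (2 * z)]
  have e0 : -I * (2 * (z / D)) * D = -I * (2 * z) := by field_simp
  have hs : (-I * (2 * z)) ^ (1 / 2 : ℂ) =
      (-I * (2 * (z / D))) ^ (1 / 2 : ℂ) * D ^ (1 / 2 : ℂ) := by
    rw [← sqrt_mul_of_re, e0]
    · simpa using hV
    · exact hIm
    · rw [e0]
      simpa using hz
  have e1 : y / D / (2 * (z / D)) = y / (2 * z) := by field_simp
  have e2 : (-1 : ℂ) / (2 * (z / D)) = -1 / (2 * z) + 2 * ((-1 : ℤ) : ℂ) := by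
    field_simp
    push_cast
    linear_combination -hD
  have e3 : cexp (-π * I * (y / D) ^ 2 / (2 * (z / D))) =
      cexp (π * I * (4 * y ^ 2 / (2 * D))) * cexp (-π * I * y ^ 2 / (2 * z)) := by
    rw [← Complex.exp_add]
    congr 1
    field_simp
    linear_combination y ^ 2 * hD
  have hne1 : (-I * (2 * (z / D))) ^ (1 / 2 : ℂ) ≠ 0 := by
    simp [cpow_eq_zero_iff, hz0, h4]
  have hne2 : D ^ (1 / 2 : ℂ) ≠ 0 := by
    simp [cpow_eq_zero_iff, h4]
  rw [e1, e2, e3, jacobiTheta₂_add_two_mul_int, hs]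
  generalize (-I * (2 * (z / D))) ^ (1 / 2 : ℂ) = S at *
  field_simp

/-- This is the inverse of the previous map: apply its law at z/D and y/D with D = 1 - 4z, where
4(z/D) + 1 = 1/D. -/
theorem thetaLaw_neg_four : ThetaLaw 1 0 (-4) 1 := by
  intro z y hz
  have h4 : -4 * z + 1 ≠ 0 := by
    have := linear_ne_zero_of_im_pos (c := -4) (d := 1) (by simp) hz
    simpa using this
  have hV : 0 < (z / (-4 * z + 1)).im := by
    have := im_moebius (a := 1) (b := 0) (c := -4) (d := 1) (by norm_num) hz
    simpa using this
  have hm' : thetaMult (-4) 1 z = (-4 * z + 1) ^ (1 / 2 : ℂ) := by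
    simp [thetaMult, epsilon, quadSymbol]
  have hIm : (-4 * z + 1).im ≠ 0 := by simpa using hz.ne'
  have h := thetaLaw_four (z / (-4 * z + 1)) (y / (-4 * z + 1)) hV
  rw [hm']
  push_cast at h ⊢
  obtain ⟨D, hD⟩ : ∃ D, D = -4 * z + 1 := ⟨_, rfl⟩
  rw [← hD] at h4 hV hIm h ⊢
  have e0 : 4 * (z / D) + 1 = 1 / D := by
    field_simp
    linear_combination hD
  have hm : thetaMult 4 1 (z / D) = (D ^ (1 / 2 : ℂ))⁻¹ := by
    have h1 : thetaMult 4 1 (z / D) = (4 * (z / D) + 1) ^ (1 / 2 : ℂ) := by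
      simp [thetaMult, epsilon, quadSymbol]
    rw [h1, e0, one_div D, inv_cpow]
    intro harg
    rw [arg_eq_pi_iff] at harg
    exact hIm harg.2
  rw [hm] at h
  have e1 : y / D / (1 / D) = y := by field_simp
  have e2 : (1 * (z / D) + 0) / (1 / D) = z := by field_simp; ring
  have e3 : π * I * (4 * (y / D) ^ 2 / (2 * (1 / D))) = -(π * I * (-4 * y ^ 2 / (2 * D))) := by
    field_simp
  rw [e0, e1, e2, e3, Complex.exp_neg] at h
  rw [h, one_mul, add_zero]
  have hne2 : D ^ (1 / 2 : ℂ) ≠ 0 := by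
    simp [cpow_eq_zero_iff, h4]
  have hne3 := Complex.exp_ne_zero (π * I * (-4 * y ^ 2 / (2 * D)))
  generalize cexp (π * I * (-4 * y ^ 2 / (2 * D))) = E at *
  field_simp

theorem epsilon_congr {d d' : ℤ} (h : 4 ∣ d' - d) : epsilon d' = epsilon d := by
  have : d' % 4 = d % 4 := by omega
  simp [epsilon, this]

theorem quadSymbol_of_pos (c : ℤ) {d : ℤ} (hd : 0 < d) :
    quadSymbol c d = jacobiSym c d.natAbs := by
  simp [quadSymbol, hd.not_gt]

theorem quadSymbol_add_mul (c k : ℤ) {d : ℤ} (hd : 0 < d) :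
    quadSymbol (c + k * d) d = quadSymbol c d := by
  rw [quadSymbol_of_pos _ hd, quadSymbol_of_pos _ hd]
  apply jacobiSym.mod_left'
  have : ((d.natAbs : ℕ) : ℤ) = d := by omega
  rw [this, Int.add_mul_emod_self_right]

/-- Composition on the right with `z ↦ z / (4 e z + 1)`, `e = ±1`. -/
theorem ThetaLaw.shear {a b c d e : ℤ} (he : e ≠ 0) (hV : ThetaLaw 1 0 (4 * e) 1)
    (h : ThetaLaw a b c d) (hdet : a * d - b * c = 1) (hd : 0 < d)
    (hpos : 0 < c → 0 < e → 0 < c + 4 * e * d) (hneg : c < 0 → e < 0 → c + 4 * e * d < 0) :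
    ThetaLaw (a + 4 * e * b) b (c + 4 * e * d) d := by
  intro z y hz
  have h4 : 4 * e * z + 1 ≠ 0 := by
    have := linear_ne_zero_of_im_pos (c := 4 * e) (d := 1) (by simp) hz
    simpa using this
  have hVim : 0 < (z / (4 * e * z + 1)).im := by
    have := im_moebius (a := 1) (b := 0) (c := 4 * e) (d := 1) (by norm_num) hz
    simpa using this
  have hDim : (4 * e * z + 1 : ℂ).im = 4 * e * z.im := by
    simp
  have hne : (c : ℂ) * (z / (4 * e * z + 1)) + d ≠ 0 :=
    linear_ne_zero_of_im_pos (row_ne_zero hdet) hVim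
  have h1 := hV z y hz
  have h2 := h (z / (4 * e * z + 1)) (y / (4 * e * z + 1)) hVim
  have hm : thetaMult (4 * e) 1 z = (4 * e * z + 1) ^ (1 / 2 : ℂ) := by
    simp [thetaMult, epsilon, quadSymbol]
  rw [hm] at h1
  have himc : ((c : ℂ) * (z / (4 * e * z + 1)) + d).im = c * (z / (4 * e * z + 1)).im :=
    im_linear c d _
  push_cast at h1 h2 ⊢
  rw [one_mul, add_zero] at h1
  rw [h1] at h2
  obtain ⟨D, hD⟩ : ∃ D : ℂ, D = 4 * e * z + 1 := ⟨_, rfl⟩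
  rw [← hD] at h4 hVim hDim hne h1 h2 himc
  have e0 : ((c : ℂ) * (z / D) + d) * D = (c + 4 * e * d) * z + d := by
    field_simp
    linear_combination d * hD
  have hfull : ((c : ℂ) + 4 * e * d) * z + d ≠ 0 := by rw [← e0]; exact mul_ne_zero hne h4
  have himf : (((c : ℂ) + 4 * e * d) * z + d).im = (c + 4 * e * d : ℤ) * z.im := by
    rw [← im_linear _ d z]
    push_cast
    rfl
  -- The cocycle relation for cz + d passes to principal roots because, when the two factors lie on
  -- the same side of the real axis, the sign conditions keep their product there.
  have eroot : (((c : ℂ) + 4 * e * d) * z + d) ^ (1 / 2 : ℂ) =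
      ((c : ℂ) * (z / D) + d) ^ (1 / 2 : ℂ) * D ^ (1 / 2 : ℂ) := by
    rw [← sqrt_mul_of_im, e0]
    · rw [himc]
      intro h0
      have hc0 : c = 0 := by
        rcases mul_eq_zero.1 h0 with h0 | h0
        · exact_mod_cast h0
        · exact absurd h0 hVim.ne'
      simp [hc0, hd]
    · rw [hDim]
      have : (e : ℝ) ≠ 0 := by exact_mod_cast he
      positivity
    · rw [himc, hDim, e0, himf]
      intro h5 h6
      have hc : 0 < c := by exact_mod_cast (pos_of_mul_pos_left h5 hVim.le)
      have he : 0 < e := by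
        have := pos_of_mul_pos_left h6 hz.le
        have : (0 : ℝ) < e := by linarith
        exact_mod_cast this
      have : (0 : ℝ) < ((c + 4 * e * d : ℤ) : ℝ) := by exact_mod_cast hpos hc he
      positivity
    · rw [himc, hDim, e0, himf]
      intro h5 h6
      have hc : c < 0 := by exact_mod_cast (neg_of_mul_neg_left h5 hVim.le)
      have he : e < 0 := by
        have := neg_of_mul_neg_left h6 hz.le
        have : (e : ℝ) < 0 := by linarith
        exact_mod_cast this
      have : ((c + 4 * e * d : ℤ) : ℝ) < 0 := by exact_mod_cast hneg hc he
      nlinarith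
  have hmult : thetaMult (c + 4 * e * d) d z = thetaMult c d (z / D) * D ^ (1 / 2 : ℂ) := by
    rw [thetaMult, thetaMult, quadSymbol_add_mul _ _ hd]
    push_cast
    rw [eroot]
    ring
  have e1 : y / D / ((c : ℂ) * (z / D) + d) = y / ((c + 4 * e * d) * z + d) := by
    rw [← e0, div_div, mul_comm D]
  have e2 : ((a : ℂ) * (z / D) + b) / (c * (z / D) + d) =
      ((a + 4 * e * b) * z + b) / ((c + 4 * e * d) * z + d) := by
    have : ((a : ℂ) * (z / D) + b) * D = (a + 4 * e * b) * z + b := by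
      field_simp
      linear_combination b * hD
    rw [← this, ← e0, mul_div_mul_right _ _ h4]
  have e3 : cexp (π * I * (c * (y / D) ^ 2 / (2 * (c * (z / D) + d)))) *
      cexp (π * I * (4 * e * y ^ 2 / (2 * D))) =
      cexp (π * I * ((c + 4 * e * d) * y ^ 2 / (2 * ((c + 4 * e * d) * z + d)))) := by
    rw [← Complex.exp_add]
    congr 1
    have e4 : (c : ℂ) * (z / D) + d = ((c + 4 * e * d) * z + d) / D := by
      rw [← e0]; field_simp
    rw [e4]
    generalize hF : ((c : ℂ) + 4 * e * d) * z + d = F at *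
    field_simp
    rw [← hF, hD]
    ring
  rw [e1, e2] at h2
  rw [h2, hmult, ← e3]
  ring

/-- -I fixes z and replaces y by -y, and theta is even in y, so only the invariance of j is at
stake. The root contributes ±i, with the sign supplied by Shimura's convention; then ε₋d⁻¹ = -iε_d
and (-1/d) = ε_d⁻² restore ε_d⁻¹. -/
theorem ThetaLaw.neg {a b c d : ℤ} (h : ThetaLaw a b c d) (hd : Odd d)
    (hcd : c = 0 → d = 1) (hdpos : 0 < d) : ThetaLaw (-a) (-b) (-c) (-d) := by
  intro z y hz
  have h1 := h z (-y) hz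
  have hne : (c : ℂ) * z + d ≠ 0 :=
    linear_ne_zero_of_im_pos (Or.inr hdpos.ne') hz
  have e0 : ((-c : ℤ) : ℂ) * z + ((-d : ℤ) : ℂ) = -(c * z + d) := by push_cast; ring
  have e1 : ((-a : ℤ) : ℂ) * z + ((-b : ℤ) : ℂ) = -(a * z + b) := by push_cast; ring
  have e2 : ((-c : ℤ) : ℂ) * y ^ 2 / (2 * -(c * z + d)) = c * (-y) ^ 2 / (2 * (c * z + d)) := by
    push_cast
    field_simp
  rw [e0, e1, neg_div_neg_eq, e2, ← jacobiTheta₂_neg_left y, div_neg, ← neg_div, h1]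
  congr 2
  rw [thetaMult, thetaMult, e0]
  have hnd : (-d).natAbs = d.natAbs := Int.natAbs_neg d
  have hodd : Odd d.natAbs := Int.natAbs_odd.2 hd
  have hχ : ((ZMod.χ₄ (d.natAbs : ZMod 4) : ℤ) : ℂ) = (epsilon d)⁻¹ ^ 2 := by
    have hdd : ((d.natAbs : ℕ) : ℤ) = d := by omega
    rcases Nat.odd_mod_four_iff.1 (Nat.odd_iff.1 hodd) with h | h
    · rw [ZMod.χ₄_nat_one_mod_four h]
      have : d % 4 = 1 := by omega
      simp [epsilon, this]
    · rw [ZMod.χ₄_nat_three_mod_four h]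
      have : d % 4 = 3 := by omega
      simp [epsilon, this]
  have hε : (epsilon (-d))⁻¹ = -I * epsilon d := by
    have : d % 4 = 1 ∧ (-d) % 4 = 3 ∨ d % 4 = 3 ∧ (-d) % 4 = 1 := by
      obtain ⟨k, rfl⟩ := hd
      omega
    rcases this with ⟨h1, h2⟩ | ⟨h1, h2⟩ <;> simp [epsilon, h1, h2]
  have hεne : epsilon d ≠ 0 := by
    unfold epsilon
    split_ifs <;> simp
  have hI : (-1 : ℂ) ^ (1 / 2 : ℂ) = I := by
    rw [cpow_def_of_ne_zero (by simp), log_neg_one,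
      show (π : ℂ) * I * (1 / 2) = π / 2 * I by ring, exp_pi_div_two_mul_I]
  rcases eq_or_ne c 0 with rfl | hc0
  · have := hcd rfl
    subst this
    simp [epsilon, quadSymbol]
    rw [show (-1 : ℂ) ^ (2⁻¹ : ℂ) = I by simpa using hI]
    simp
  · have key : (quadSymbol (-c) (-d) : ℂ) * (-(c * z + d : ℂ)) ^ (1 / 2 : ℂ) =
        (ZMod.χ₄ (d.natAbs : ZMod 4) : ℤ) * (quadSymbol c d : ℂ) *
          (I * ((c : ℂ) * z + d) ^ (1 / 2 : ℂ)) := by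
      have him := im_linear c d z
      rw [quadSymbol_of_pos _ hdpos, quadSymbol, hnd, jacobiSym.neg _ hodd]
      have hdn : -d < 0 := by omega
      rcases lt_or_gt_of_ne hc0 with hc | hc
      · have himn : ((c : ℂ) * z + d).im < 0 := by
          rw [him]
          exact mul_neg_of_neg_of_pos (by exact_mod_cast hc) hz
        have hroot : (-(c * z + d : ℂ)) ^ (1 / 2 : ℂ) = I * ((c : ℂ) * z + d) ^ (1 / 2 : ℂ) := by
          rw [← hI, ← sqrt_mul_of_arg (by simp) hne, neg_one_mul]
          rw [arg_neg_one]
          have := arg_neg_iff.2 himn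
          have h3 := neg_pi_lt_arg ((c : ℂ) * z + d)
          exact ⟨by linarith [Real.pi_pos], by linarith⟩
        rw [if_neg (by omega), hroot]
        push_cast
        ring
      · have himp : 0 < ((c : ℂ) * z + d).im := by
          rw [him]
          exact mul_pos (by exact_mod_cast hc) hz
        have hroot : (-(c * z + d : ℂ)) ^ (1 / 2 : ℂ) =
            -(I * ((c : ℂ) * z + d) ^ (1 / 2 : ℂ)) := by
          have h5 : ((c : ℂ) * z + d) ^ (1 / 2 : ℂ) =
              I * (-(c * z + d : ℂ)) ^ (1 / 2 : ℂ) := by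
            rw [← hI, ← sqrt_mul_of_arg (by simp) (neg_ne_zero.2 hne)]
            · simp
            · rw [arg_neg_one]
              have h3 := arg_neg_iff.2 (show (-((c : ℂ) * z + d)).im < 0 by
                rw [neg_im]; linarith)
              have h4 := neg_pi_lt_arg (-((c : ℂ) * z + d))
              exact ⟨by linarith [Real.pi_pos], by linarith⟩
          rw [h5, ← mul_assoc, I_mul_I]
          ring
        rw [if_pos (by omega), hroot]
        push_cast
        ring
    rw [hε, mul_assoc (-I * epsilon d), key, hχ]
    have hI2 := I_mul_I
    field_simp
    linear_combination (((quadSymbol c d : ℂ) * ((c : ℂ) * z + d) ^ (1 / 2 : ℂ))) * hI2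

/-- Euclidean descent on |c| + |d|. If |c| > 2d, a shear replaces c by c ± 4d, which is smaller in
absolute value. Otherwise a translation replaces d by d - |c|, and `ThetaLaw.neg` handles a negative
result; here |d - |c|| < d, because |c| = 2d is impossible for odd d and 4 ∣ c. The base c = 0 is
periodicity. -/
theorem thetaLaw_of_pos (n : ℕ) : ∀ a b c d : ℤ, c.natAbs + d.natAbs ≤ n → a * d - b * c = 1 →
    4 ∣ c → 0 < d → ThetaLaw a b c d := by
  induction n with
  | zero => intro a b c d h _ _ hd; omega
  | succ n ih =>
    intro a b c d hn hdet hc hd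
    obtain ⟨c', rfl⟩ := hc
    have hodd : Odd d := by
      rw [← Int.not_even_iff_odd]
      rintro ⟨k, rfl⟩
      have : 2 * (a * k - b * (2 * c')) = 1 := by linear_combination hdet
      omega
    obtain ⟨k, hk⟩ := hodd
    rcases eq_or_ne c' 0 with rfl | hc0
    · have had : a * d = 1 := by linear_combination hdet
      have hd1 : d = 1 := Int.eq_one_of_mul_eq_one_left hd.le had
      subst hd1
      have ha : a = 1 := by linarith
      subst ha
      intro z y hz
      have := jacobiTheta₂_add_two_mul_int y (2 * z) b
      rw [← mul_add] at this
      simp [thetaMult, epsilon, quadSymbol, this]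
    by_cases hbig : 2 * d < |4 * c'|
    · rcases lt_or_gt_of_ne hc0 with hneg | hpos
      · rw [abs_of_neg (by omega)] at hbig
        have h1 := ih (a + 4 * b) b (4 * c' + 4 * d) d (by omega) (by linear_combination hdet)
          ⟨c' + d, by ring⟩ hd
        have := ThetaLaw.shear (e := -1) (by simp) (by norm_num; exact thetaLaw_neg_four) h1
          (by linear_combination hdet) hd (by omega) (by omega)
        convert this using 1 <;> ring
      · rw [abs_of_pos (by omega)] at hbig
        have h1 := ih (a - 4 * b) b (4 * c' - 4 * d) d (by omega) (by linear_combination hdet)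
          ⟨c' - d, by ring⟩ hd
        have := ThetaLaw.shear (e := 1) (by simp) (by rw [mul_one]; exact thetaLaw_four) h1
          (by linear_combination hdet) hd (by omega) (by omega)
        convert this using 1 <;> ring
    · have hsym := quadSymbol_sub_natAbs (c := 4 * c') (d := d) ⟨c', rfl⟩ (by omega) ⟨k, hk⟩ hd
      -- C is |c|/4 and s is the sign of c, so that d - sc = d - |c|.
      obtain ⟨C, s, hC, hs, hCpos, hCn⟩ : ∃ C s : ℤ, |4 * c'| = 4 * C ∧ 4 * C = s * (4 * c') ∧
          0 < C ∧ (4 * c').natAbs = (4 * C).natAbs := by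
        rcases lt_or_gt_of_ne hc0 with hneg | hpos
        · exact ⟨-c', -1, by rw [abs_of_neg (by omega)]; ring, by ring, by omega, by omega⟩
        · exact ⟨c', 1, by rw [abs_of_pos (by omega)], by ring, hpos, rfl⟩
      rw [hC] at hbig hsym
      rw [hs] at hsym
      have h1 : ThetaLaw a (b - s * a) (4 * c') (d - s * (4 * c')) := by
        have hdet' : a * (d - s * (4 * c')) - (b - s * a) * (4 * c') = 1 := by
          linear_combination hdet
        rw [← hs] at hdet' ⊢
        clear hsym hdet hC hs
        rcases lt_trichotomy (d - 4 * C) 0 with h | h | h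
        · have h2 := ih (-a) (-(b - s * a)) (-(4 * c')) (-(d - 4 * C))
            (by rw [Int.natAbs_neg, hCn]; omega) (by linear_combination hdet') ⟨-c', by ring⟩
            (by omega)
          have h3 := h2.neg ⟨2 * C - k - 1, by rw [hk]; ring⟩
            (by intro h0; omega) (by omega)
          simpa only [neg_neg] using h3
        · omega
        · exact ih _ _ _ _ (by rw [hCn]; omega) hdet' ⟨c', rfl⟩ h
      have hback : d - s * (4 * c') + s * (4 * c') = d := by ring
      have hbackb : b - s * a + s * a = b := by ring
      have := h1.translate s (by rw [hback, hsym]) (by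
        rw [hback]; exact epsilon_congr ⟨s * c', by ring⟩)
      rwa [hback, hbackb] at this

theorem thetaLaw_of_four_dvd {a b c d : ℤ} (hdet : a * d - b * c = 1) (hc : 4 ∣ c) :
    ThetaLaw a b c d := by
  rcases lt_trichotomy d 0 with h | h | h
  · have h1 := thetaLaw_of_pos _ (-a) (-b) (-c) (-d) le_rfl (by linear_combination hdet)
      ((dvd_neg).2 hc) (by omega)
    obtain ⟨c', rfl⟩ := hc
    have h2 := h1.neg (by
        rw [← Int.not_even_iff_odd]
        rintro ⟨k, hk⟩
        have : 2 * (-a * k - b * (2 * c')) = 1 := by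
          have : d = -(k + k) := by omega
          subst this
          linear_combination hdet
        omega)
      (by
        intro h0
        have hc0 : c' = 0 := by omega
        subst hc0
        have : a * d = 1 := by linear_combination hdet
        exact Int.eq_one_of_mul_eq_one_left (by omega)
          (show (-a) * (-d) = 1 by linear_combination this)) (by omega)
    simpa only [neg_neg] using h2
  · subst h
    obtain ⟨c', rfl⟩ := hc
    have : 4 * (b * c') = -1 := by linear_combination -hdet
    omega
  · exact thetaLaw_of_pos _ a b c d le_rfl hdet hc h

theorem quadSymbol_sq {c d : ℤ} (h : IsCoprime c d) : quadSymbol c d ^ 2 = 1 := by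
  rw [quadSymbol, mul_pow, jacobiSym.sq_one]
  · split_ifs <;> simp
  · have := Int.isCoprime_iff_gcd_eq_one.1 h
    rwa [Int.gcd_eq_natAbs_gcd_natAbs, Int.natAbs_natCast]

/-- `j(γ, z)² = (-1/d) (cz + d)`. -/
theorem thetaMult_sq {a b c d : ℤ} (hdet : a * d - b * c = 1) (hc : 4 ∣ c) {z : ℂ}
    (hz : 0 < z.im) :
    thetaMult c d z ^ 2 = ((ZMod.χ₄ (d : ZMod 4) : ℤ) : ℂ) * (c * z + d) := by
  have hne : (c : ℂ) * z + d ≠ 0 := linear_ne_zero_of_im_pos (row_ne_zero hdet) hz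
  have hq : (quadSymbol c d : ℂ) ^ 2 = 1 := by
    exact_mod_cast quadSymbol_sq (c := c) (d := d) ⟨-b, a, by linear_combination hdet⟩
  have hε : (epsilon d)⁻¹ ^ 2 = ((ZMod.χ₄ (d : ZMod 4) : ℤ) : ℂ) := by
    have : d % 4 = 1 ∨ d % 4 = 3 := by
      obtain ⟨c', rfl⟩ := hc
      have : ¬ Even d := by
        rintro ⟨k, rfl⟩
        have : 2 * (a * k - b * (2 * c')) = 1 := by linear_combination hdet
        omega
      rw [Int.even_iff] at this
      omega
    rcases this with h | h
    · rw [ZMod.χ₄_int_one_mod_four h]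
      simp [epsilon, h]
    · rw [ZMod.χ₄_int_three_mod_four h]
      simp [epsilon, h]
  rw [thetaMult, mul_pow, mul_pow, hq, hε, sq (_ ^ (1 / 2 : ℂ)), cpow_half_mul_self hne, mul_one]

/-! ### Gaussian sums over `ℤ³` -/

/-- Integer triples as a product. -/
def tripleEquiv : (Fin 3 → ℤ) ≃ ℤ × ℤ × ℤ where
  toFun n := (n 0, n 1, n 2)
  invFun p := ![p.1, p.2.1, p.2.2]
  left_inv n := by
    ext i
    fin_cases i <;> rfl
  right_inv p := rfl

theorem summable_exp_neg_abs : Summable fun n : ℤ => Real.exp (-|(n : ℝ)|) := by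
  have h : Summable fun n : ℕ => Real.exp (-(n : ℝ)) := by
    simpa using Real.summable_exp_nat_mul_iff.2 (show (-1 : ℝ) < 0 by norm_num)
  apply Summable.of_nat_of_neg <;> simpa using h

/-- For the sup norm, 3‖n‖ dominates |n₀| + |n₁| + |n₂|, which leaves a product of three
one-dimensional series. -/
theorem summable_exp_neg_norm : Summable fun n : Fin 3 → ℤ => Real.exp (-(3 * ‖n‖)) := by
  have h := (summable_exp_neg_abs.mul_of_nonneg
    (summable_exp_neg_abs.mul_of_nonneg summable_exp_neg_abs (fun _ => (Real.exp_pos _).le)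
      (fun _ => (Real.exp_pos _).le)) (fun _ => (Real.exp_pos _).le) (fun p => by
        dsimp; positivity))
  refine ((tripleEquiv.summable_iff).2 h).of_nonneg_of_le (fun _ => (Real.exp_pos _).le) ?_
  intro n
  simp only [Function.comp, ← Real.exp_add]
  apply Real.exp_le_exp.2
  change -(3 * ‖n‖) ≤ -|(n 0 : ℝ)| + (-|(n 1 : ℝ)| + -|(n 2 : ℝ)|)
  have h (i : Fin 3) : |(n i : ℝ)| ≤ ‖n‖ := by
    have := norm_le_pi_norm n i
    rwa [Int.norm_eq_abs] at this
  linarith [h 0, h 1, h 2]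

theorem summable_gaussian (k : ℕ) {ε : ℝ} (hε : 0 < ε) (B : ℝ) :
    Summable fun n : Fin 3 → ℤ => (1 + ‖n‖) ^ k * Real.exp (-ε * ‖n‖ ^ 2 + B * ‖n‖) := by
  refine ((summable_exp_neg_norm.mul_left
    ((k.factorial : ℝ) * Real.exp (1 + (B + 4) ^ 2 / (4 * ε))))).of_nonneg_of_le
    (fun n => by positivity) ?_
  intro n
  have h1 : (1 + ‖n‖) ^ k ≤ k.factorial * Real.exp (1 + ‖n‖) := by
    have := Real.pow_div_factorial_le_exp (x := 1 + ‖n‖) (by positivity) k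
    rw [div_le_iff₀ (by positivity)] at this
    linarith
  calc (1 + ‖n‖) ^ k * Real.exp (-ε * ‖n‖ ^ 2 + B * ‖n‖)
      ≤ (k.factorial * Real.exp (1 + ‖n‖)) * Real.exp (-ε * ‖n‖ ^ 2 + B * ‖n‖) := by gcongr
    _ = k.factorial * Real.exp (1 + ‖n‖ + (-ε * ‖n‖ ^ 2 + B * ‖n‖)) := by
      rw [mul_assoc, ← Real.exp_add]
    _ ≤ k.factorial * Real.exp (1 + (B + 4) ^ 2 / (4 * ε) + -(3 * ‖n‖)) := by
      refine mul_le_mul_of_nonneg_left (Real.exp_le_exp.2 ?_) (by positivity)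
      -- Here 4 = 1 + 3: one ‖n‖ comes from the bound on the power, three are set aside for the
      -- comparison series. The rest is completing the square.
      have : (B + 4) * ‖n‖ - ε * ‖n‖ ^ 2 ≤ (B + 4) ^ 2 / (4 * ε) := by
        rw [le_div_iff₀ (by positivity)]
        nlinarith [sq_nonneg (B + 4 - 2 * ε * ‖n‖)]
      linarith
    _ = _ := by rw [Real.exp_add, mul_assoc]

/-- The value at `n` of the complex quadratic form with matrix `A`. -/
def quadVal (A : Fin 3 → Fin 3 → ℂ) (n : Fin 3 → ℤ) : ℂ :=
  ∑ i, ∑ j, A i j * (n i * n j)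

/-- The quadratic forms with negative definite real part. -/
def negForms : Set (Fin 3 → Fin 3 → ℂ) :=
  {A | ∃ ε > 0, ∀ n : Fin 3 → ℤ, (quadVal A n).re ≤ -ε * ‖n‖ ^ 2}

/-- Polynomial growth of coefficients on `ℤ³`. -/
def PolyGrowth (c : (Fin 3 → ℤ) → ℂ) : Prop :=
  ∃ C : ℝ, ∃ k : ℕ, ∀ n, ‖c n‖ ≤ C * (1 + ‖n‖) ^ k

/-- The Gaussian sum with coefficients `c` and exponent `A`. -/
def gaussSum (c : (Fin 3 → ℤ) → ℂ) (A : Fin 3 → Fin 3 → ℂ) : ℂ :=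
  ∑' n, c n * cexp (quadVal A n)

theorem norm_apply_le (n : Fin 3 → ℤ) (i : Fin 3) : ‖(n i : ℂ)‖ ≤ ‖n‖ := by
  have := norm_le_pi_norm n i
  simpa [Int.norm_eq_abs] using this

theorem PolyGrowth.mul_coord {c : (Fin 3 → ℤ) → ℂ} (h : PolyGrowth c) (i : Fin 3) :
    PolyGrowth fun n => c n * n i := by
  obtain ⟨C, k, hC⟩ := h
  refine ⟨C, k + 1, fun n => ?_⟩
  have h0 := (norm_nonneg (c n)).trans (hC n)
  rw [norm_mul, pow_succ, ← mul_assoc]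
  gcongr
  · exact hC n
  · linarith [norm_apply_le n i]

theorem PolyGrowth.mul_bounded {c d : (Fin 3 → ℤ) → ℂ} (h : PolyGrowth c) {B : ℝ}
    (hd : ∀ n, ‖d n‖ ≤ B) : PolyGrowth fun n => d n * c n := by
  obtain ⟨C, k, hC⟩ := h
  refine ⟨B * C, k, fun n => ?_⟩
  rw [norm_mul, mul_assoc]
  exact mul_le_mul (hd n) (hC n) (norm_nonneg _) ((norm_nonneg _).trans (hd n))

theorem norm_quadVal_le (A : Fin 3 → Fin 3 → ℂ) (n : Fin 3 → ℤ) :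
    ‖quadVal A n‖ ≤ 9 * ‖A‖ * ‖n‖ ^ 2 := by
  calc ‖quadVal A n‖ ≤ ∑ i : Fin 3, ∑ j : Fin 3, ‖A‖ * (‖n‖ * ‖n‖) := by
        refine (norm_sum_le _ _).trans (Finset.sum_le_sum fun i _ => (norm_sum_le _ _).trans
          (Finset.sum_le_sum fun j _ => ?_))
        rw [norm_mul, norm_mul]
        gcongr
        · exact (norm_le_pi_norm (A i) j).trans (norm_le_pi_norm A i)
        · exact norm_apply_le n i
        · exact norm_apply_le n j
    _ = _ := by simp; ring

theorem quadVal_sub (A B : Fin 3 → Fin 3 → ℂ) (n : Fin 3 → ℤ) :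
    quadVal (A - B) n = quadVal A n - quadVal B n := by
  simp [quadVal, sub_mul, Finset.sum_sub_distrib]

theorem exists_ball_negForms {A : Fin 3 → Fin 3 → ℂ} (hA : A ∈ negForms) :
    ∃ δ > 0, ∃ ε > 0, ∀ B ∈ Metric.ball A δ, ∀ n : Fin 3 → ℤ,
      (quadVal B n).re ≤ -ε * ‖n‖ ^ 2 := by
  obtain ⟨ε, hε, h⟩ := hA
  -- A perturbation of norm δ changes the form by at most 9δ‖n‖², so δ = ε/18 costs half of the
  -- margin.
  refine ⟨ε / 18, by positivity, ε / 2, by positivity, fun B hB n => ?_⟩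
  have h1 : ‖quadVal (B - A) n‖ ≤ 9 * (ε / 18) * ‖n‖ ^ 2 := by
    refine (norm_quadVal_le _ _).trans ?_
    gcongr
    exact (mem_ball_iff_norm.1 hB).le
  have h2 : (quadVal (B - A) n).re ≤ ‖quadVal (B - A) n‖ := re_le_norm _
  rw [quadVal_sub, sub_re] at h2
  have := h n
  nlinarith [quadVal_sub B A n ▸ h1]

theorem isOpen_negForms : IsOpen negForms := by
  rw [Metric.isOpen_iff]
  intro A hA
  obtain ⟨δ, hδ, ε, hε, h⟩ := exists_ball_negForms hA
  exact ⟨δ, hδ, fun B hB => ⟨ε, hε, h B hB⟩⟩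

theorem summable_gaussSum_norm {c : (Fin 3 → ℤ) → ℂ} (hc : PolyGrowth c)
    {A : Fin 3 → Fin 3 → ℂ} (hA : A ∈ negForms) :
    Summable fun n => ‖c n * cexp (quadVal A n)‖ := by
  obtain ⟨C, k, hC⟩ := hc
  obtain ⟨ε, hε, h⟩ := hA
  refine ((summable_gaussian k hε 0).mul_left C).of_nonneg_of_le (fun _ => norm_nonneg _) ?_
  intro n
  rw [norm_mul, Complex.norm_exp, ← mul_assoc]
  refine mul_le_mul (hC n) (Real.exp_le_exp.2 ?_) (Real.exp_pos _).le
    ((norm_nonneg _).trans (hC n))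
  linarith [h n]

theorem summable_gaussSum {c : (Fin 3 → ℤ) → ℂ} (hc : PolyGrowth c)
    {A : Fin 3 → Fin 3 → ℂ} (hA : A ∈ negForms) :
    Summable fun n => c n * cexp (quadVal A n) :=
  (summable_gaussSum_norm hc hA).of_norm

/-- The coordinate functional `A ↦ A i j`. -/
def entryCLM (i j : Fin 3) : (Fin 3 → Fin 3 → ℂ) →L[ℝ] ℂ :=
  (ContinuousLinearMap.proj (R := ℝ) (φ := fun _ : Fin 3 => ℂ) j).comp
    (ContinuousLinearMap.proj (R := ℝ) (φ := fun _ : Fin 3 => Fin 3 → ℂ) i)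

/-- `quadVal · n` as a continuous linear map. -/
def quadCLM (n : Fin 3 → ℤ) : (Fin 3 → Fin 3 → ℂ) →L[ℝ] ℂ :=
  ∑ i, ∑ j, (n i * n j : ℂ) • entryCLM i j

theorem quadCLM_apply (n : Fin 3 → ℤ) (A : Fin 3 → Fin 3 → ℂ) : quadCLM n A = quadVal A n := by
  simp [quadCLM, quadVal, entryCLM, mul_comm]

theorem norm_quadCLM_le (n : Fin 3 → ℤ) : ‖quadCLM n‖ ≤ 9 * ‖n‖ ^ 2 := by
  refine ContinuousLinearMap.opNorm_le_bound _ (by positivity) fun A => ?_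
  rw [quadCLM_apply]
  linarith [norm_quadVal_le A n]

theorem hasFDerivAt_gaussSum_term (a : ℂ) (n : Fin 3 → ℤ) (B : Fin 3 → Fin 3 → ℂ) :
    HasFDerivAt (fun B => a * cexp (quadVal B n)) ((a * cexp (quadVal B n)) • quadCLM n) B := by
  have h1 : HasFDerivAt (fun B => quadVal B n) (quadCLM n) B := by
    have := (quadCLM n).hasFDerivAt (x := B)
    rwa [show ⇑(quadCLM n) = fun B => quadVal B n from funext (quadCLM_apply n)] at this
  have h2 := (h1.cexp).const_smul a
  rw [smul_smul] at h2
  exact h2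

/-- The derivative is again built from Gaussian sums, with coefficients c(n)n_i n_j of polynomial
growth. This closure is what lets the order of differentiability be raised by induction. -/
theorem hasFDerivAt_gaussSum {c : (Fin 3 → ℤ) → ℂ} (hc : PolyGrowth c)
    {A : Fin 3 → Fin 3 → ℂ} (hA : A ∈ negForms) :
    HasFDerivAt (gaussSum c)
      (∑ i, ∑ j, gaussSum (fun n => c n * n i * n j) A • entryCLM i j) A := by
  have hA0 := hA
  obtain ⟨δ, hδ, ε, hε, h⟩ := exists_ball_negForms hA
  have hc' := hc
  obtain ⟨C, k, hC⟩ := hc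
  have key : HasFDerivAt (fun B => ∑' n, c n * cexp (quadVal B n))
      (∑' n, (c n * cexp (quadVal A n)) • quadCLM n) A := by
    refine hasFDerivAt_tsum_of_isPreconnected (s := Metric.ball A δ) (x₀ := A) (x := A)
      (f := fun n B => c n * cexp (quadVal B n))
      (f' := fun n B => (c n * cexp (quadVal B n)) • quadCLM n)
      (u := fun n => 9 * C * ((1 + ‖n‖) ^ (k + 2) * Real.exp (-ε * ‖n‖ ^ 2 + 0 * ‖n‖)))
      ((summable_gaussian (k + 2) hε 0).mul_left _) Metric.isOpen_ball
      (convex_ball A δ).isPreconnected ?_ ?_ (Metric.mem_ball_self hδ)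
      (summable_gaussSum hc' hA0) (Metric.mem_ball_self hδ)
    · intro n B _
      exact hasFDerivAt_gaussSum_term (c n) n B
    · intro n B hB
      have h0 := (norm_nonneg _).trans (hC n)
      rw [norm_smul, norm_mul, Complex.norm_exp]
      calc ‖c n‖ * Real.exp (quadVal B n).re * ‖quadCLM n‖
          ≤ (C * (1 + ‖n‖) ^ k) * Real.exp (-ε * ‖n‖ ^ 2) * (9 * (1 + ‖n‖) ^ 2) := by
            gcongr
            · exact hC n
            · exact h B hB n
            · refine (norm_quadCLM_le n).trans ?_
              gcongr
              linarith
        _ = _ := by rw [pow_add]; ring_nf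
  have hs (i j : Fin 3) := summable_gaussSum ((hc'.mul_coord i).mul_coord j) hA0
  have hsum : HasSum (fun n => (c n * cexp (quadVal A n)) • quadCLM n)
      (∑ i, ∑ j, gaussSum (fun n => c n * n i * n j) A • entryCLM i j) := by
    have : (fun n => (c n * cexp (quadVal A n)) • quadCLM n) =
        fun n => ∑ i, ∑ j, (c n * n i * n j * cexp (quadVal A n)) • entryCLM i j := by
      funext n
      simp only [quadCLM, Finset.smul_sum, smul_smul]
      refine Finset.sum_congr rfl fun i _ => Finset.sum_congr rfl fun j _ => ?_
      congr 1
      ring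
    rw [this]
    exact hasSum_sum fun i _ => hasSum_sum fun j _ => (hs i j).hasSum.smul_const _
  rw [hsum.tsum_eq] at key
  exact key

theorem contDiffOn_gaussSum_nat (k : ℕ) : ∀ {c : (Fin 3 → ℤ) → ℂ}, PolyGrowth c →
    ContDiffOn ℝ k (gaussSum c) negForms := by
  induction k with
  | zero =>
    intro c hc
    rw [Nat.cast_zero, contDiffOn_zero]
    exact fun A hA => (hasFDerivAt_gaussSum hc hA).continuousAt.continuousWithinAt
  | succ k ih =>
    intro c hc
    rw [Nat.cast_succ, contDiffOn_succ_iff_fderiv_of_isOpen isOpen_negForms]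
    refine ⟨fun A hA => (hasFDerivAt_gaussSum hc hA).differentiableAt.differentiableWithinAt,
      fun h => by simp at h, ?_⟩
    refine ContDiffOn.congr (f := fun A =>
      ∑ i, ∑ j, gaussSum (fun n => c n * n i * n j) A • entryCLM i j) ?_
      fun A hA => (hasFDerivAt_gaussSum hc hA).fderiv
    exact ContDiffOn.sum fun i _ => ContDiffOn.sum fun j _ =>
      (ih ((hc.mul_coord i).mul_coord j)).smul contDiffOn_const

theorem contDiffOn_gaussSum {c : (Fin 3 → ℤ) → ℂ} (hc : PolyGrowth c) :
    ContDiffOn ℝ ∞ (gaussSum c) negForms :=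
  contDiffOn_infty.2 fun k => contDiffOn_gaussSum_nat k hc

/-! ### Poisson summation for Gaussians with a periodic weight -/

/-- This is the inversion formula of the Jacobi theta function at τ = ia, with the exponential
factor absorbed into the square. -/
theorem hasSum_poisson_gaussian {a : ℝ} (ha : 0 < a) (ζ : ℂ) :
    HasSum (fun n : ℤ => cexp (-π * (ζ - n) ^ 2 / a))
      ((a : ℂ) ^ (1 / 2 : ℂ) * ∑' n : ℤ, cexp (-π * a * n ^ 2 + 2 * π * I * n * ζ)) := by
  have hac : (a : ℂ) ≠ 0 := by exact_mod_cast ha.ne'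
  have h := jacobiTheta₂_functional_equation ζ (I * a)
  have e1 : -I * (I * a) = a := by linear_combination (-(a : ℂ)) * I_mul_I
  have e2 : (-1 : ℂ) / (I * a) = I * (1 / a : ℝ) := by
    push_cast
    field_simp
    linear_combination -I_sq
  have hs := hasSum_jacobiTheta₂_term (ζ / (I * a)) (τ := -1 / (I * a)) (by
    rw [e2]
    simpa using ha)
  have hpow : (a : ℂ) ^ (1 / 2 : ℂ) ≠ 0 := by simp [cpow_eq_zero_iff, hac]
  have hs2 := hs.mul_left (cexp (-π * I * ζ ^ 2 / (I * a)))
  rw [e1] at h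
  have hval : cexp (-π * I * ζ ^ 2 / (I * a)) * jacobiTheta₂ (ζ / (I * a)) (-1 / (I * a)) =
      (a : ℂ) ^ (1 / 2 : ℂ) * ∑' n : ℤ, cexp (-π * a * n ^ 2 + 2 * π * I * n * ζ) := by
    have h3 : ∑' n : ℤ, cexp (-π * a * n ^ 2 + 2 * π * I * n * ζ) = jacobiTheta₂ ζ (I * a) := by
      rw [jacobiTheta₂]
      refine tsum_congr fun n => ?_
      rw [jacobiTheta₂_term]
      congr 1
      linear_combination (-π * a * n ^ 2 : ℂ) * I_mul_I
    rw [h3, h]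
    field_simp
  rw [hval] at hs2
  convert! hs2 using 2 with n
  rw [jacobiTheta₂_term, ← Complex.exp_add]
  congr 1
  field_simp
  ring

theorem sum_Icc_periodic {M : ℕ} (g : ℤ → ℂ) (hg : ∀ n, g (n + M) = g n) :
    ∑ h ∈ Finset.Icc 1 M, g (h : ℕ) = ∑ h : Fin M, g (h : ℕ) := by
  rw [Finset.sum_fin_eq_sum_range]
  have h1 : ∑ h ∈ Finset.Icc 1 M, g (h : ℕ) = ∑ h ∈ Finset.range M, g ((h + 1 : ℕ) : ℤ) := by
    rw [← Finset.Ico_succ_right_eq_Icc, Finset.sum_Ico_eq_sum_range]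
    refine Finset.sum_congr (by simp) fun i _ => by rw [add_comm]
  have h2 := Finset.sum_range_succ (fun h : ℕ => g h) M
  have h3 := Finset.sum_range_succ' (fun h : ℕ => g h) M
  have h4 := hg 0
  rw [h1]
  have h5 : ∑ i ∈ Finset.range M, (if h : i < M then g ((⟨i, h⟩ : Fin M) : ℕ) else 0) =
      ∑ i ∈ Finset.range M, g (i : ℕ) := by
    refine Finset.sum_congr rfl fun i hi => ?_
    rw [dif_pos (Finset.mem_range.1 hi)]
  rw [h5]
  simp only [zero_add] at h4
  simp only [Nat.cast_zero] at h3
  rw [h2, h4] at h3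
  exact (add_right_cancel h3).symm

/-- Split j = qM + r. On a residue class ψ is constant and the Gaussian formula applies with ζ
shifted by r/M; the phases e(rn/M) assemble into the finite Fourier transform of ψ. The sign in
ψ(-j) comes from a final reflection of j. -/
theorem hasSum_poisson_periodic {M : ℕ} [NeZero M] (ψ : ℤ → ℂ) (hψ : ∀ n, ψ (n + M) = ψ n)
    {a : ℝ} (ha : 0 < a) (ζ : ℂ) :
    HasSum (fun j : ℤ => ψ (-j) * cexp (-π * (ζ - j / M) ^ 2 / a))
      ((a : ℂ) ^ (1 / 2 : ℂ) * ∑' n : ℤ,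
        (∑ h ∈ Finset.Icc 1 M, ψ (h : ℕ) * cexp (2 * π * I * (h * n / M))) *
          cexp (-π * a * n ^ 2 + 2 * π * I * n * ζ)) := by
  have hM : (M : ℂ) ≠ 0 := by exact_mod_cast NeZero.ne M
  have hψ' (q n : ℤ) : ψ (q * M + n) = ψ n := by
    induction q using Int.induction_on with
    | zero => simp
    | succ i ih => rw [← ih, ← hψ (i * M + n)]; congr 1; ring
    | pred i ih => rw [← ih, ← hψ ((-i - 1) * M + n)]; congr 1; ring
  have hfib (r : Fin M) : HasSum (fun q : ℤ => ψ ((r : ℕ) : ℤ) *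
      cexp (-π * (ζ + (q * M + (r : ℕ) : ℤ) / M) ^ 2 / a))
      (ψ ((r : ℕ) : ℤ) * ((a : ℂ) ^ (1 / 2 : ℂ) * ∑' n : ℤ, cexp (2 * π * I * ((r : ℕ) * n / M)) *
          cexp (-π * a * n ^ 2 + 2 * π * I * n * ζ))) := by
    have h1 := (hasSum_poisson_gaussian ha (ζ + (r : ℕ) / M)).mul_left (ψ ((r : ℕ) : ℤ))
    rw [← (Equiv.neg ℤ).hasSum_iff] at h1
    convert! h1 using 1
    · funext q
      simp only [Function.comp, Equiv.neg_apply]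
      congr 3
      push_cast
      field_simp
      ring
    · congr 2
      refine tsum_congr fun n => ?_
      rw [← Complex.exp_add]
      congr 1
      field_simp
      ring
  have hsummand (r : ℕ) : Summable fun n : ℤ => cexp (2 * π * I * (r * n / M)) *
          cexp (-π * a * n ^ 2 + 2 * π * I * n * ζ) := by
    have := (summable_jacobiTheta₂_term_iff (ζ + r / M) (I * a)).2 (by simpa using ha)
    convert this using 2 with n
    rw [jacobiTheta₂_term, ← Complex.exp_add]
    congr 1
    field_simp
    linear_combination (-a * n ^ 2 * M : ℂ) * I_sq
  have hprod : HasSum (fun j : ℤ => ψ j * cexp (-π * (ζ + j / M) ^ 2 / a))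
      (∑ r : Fin M, ψ ((r : ℕ) : ℤ) * ((a : ℂ) ^ (1 / 2 : ℂ) *
        ∑' n : ℤ, cexp (2 * π * I * ((r : ℕ) * n / M)) *
          cexp (-π * a * n ^ 2 + 2 * π * I * n * ζ))) := by
    rw [← (Int.divModEquiv M).symm.hasSum_iff, ← (Equiv.prodComm _ _).hasSum_iff]
    have key : HasSum (fun p : (Σ _ : Fin M, ℤ) => ψ ((p.1 : ℕ) : ℤ) *
      cexp (-π * (ζ + (p.2 * M + (p.1 : ℕ) : ℤ) / M) ^ 2 / a)) _ :=
      HasSum.sigma_of_hasSum (hasSum_fintype _) hfib ?_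
    · rw [← (Equiv.sigmaEquivProd (Fin M) ℤ).hasSum_iff]
      convert! key using 1
      funext p
      simp only [Function.comp, Equiv.sigmaEquivProd_apply, Equiv.prodComm_apply, Prod.swap,
        Int.divModEquiv_symm_apply]
      rw [hψ']
    · apply Summable.of_norm
      rw [summable_sigma_of_nonneg (fun _ => norm_nonneg _)]
      exact ⟨fun r => (hfib r).summable.norm, (hasSum_fintype _).summable⟩
  rw [← (Equiv.neg ℤ).hasSum_iff]
  convert! hprod using 1
  · funext j
    simp [Function.comp, Equiv.neg_apply, sub_neg_eq_add, neg_div]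
  · rw [show (∑ r : Fin M, ψ ((r : ℕ) : ℤ) * ((a : ℂ) ^ (1 / 2 : ℂ) *
        ∑' n : ℤ, cexp (2 * π * I * ((r : ℕ) * n / M)) *
          cexp (-π * a * n ^ 2 + 2 * π * I * n * ζ))) = (a : ℂ) ^ (1 / 2 : ℂ) *
        ∑ r : Fin M, ψ ((r : ℕ) : ℤ) * ∑' n : ℤ, cexp (2 * π * I * ((r : ℕ) * n / M)) *
          cexp (-π * a * n ^ 2 + 2 * π * I * n * ζ) by
      rw [Finset.mul_sum]; exact Finset.sum_congr rfl fun _ _ => by ring]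
    congr 1
    simp_rw [← tsum_mul_left]
    rw [← Summable.tsum_finsetSum (s := Finset.univ) fun (r : Fin M) _ =>
      (hsummand r).mul_left (ψ ((r : ℕ) : ℤ))]
    refine tsum_congr fun n => ?_
    have hper := sum_Icc_periodic (M := M)
      (fun h => ψ h * cexp (2 * π * I * (h * n / M))) (fun h => by
        rw [hψ]
        congr 1
        rw [show (2 * π * I * (((h + M : ℤ) : ℂ) * n / M)) =
          2 * π * I * (h * n / M) + n * (2 * π * I) by push_cast; field_simp,
          Complex.exp_add, Complex.exp_int_mul_two_pi_mul_I, mul_one])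
    simp only [Int.cast_natCast] at hper
    rw [hper, Finset.sum_mul]
    exact Finset.sum_congr rfl fun _ _ => by ring

/-! ### The generating function of the theta kernels -/

/-- The point of `ℝ³` at which the kernel function is evaluated in the theta series. -/
def thetaPoint (N : ℕ) (v ξ y : ℝ) (n : Fin 3 → ℤ) : Fin 3 → ℝ :=
  ![√(4 * N * v) * ((n 0 / 4 - N * ξ * n 1 + N ^ 2 * ξ ^ 2 * n 2) / (2 * N * y)),
    √(4 * N * v) * (n 1 / 2 - N * ξ * n 2),
    √(4 * N * v) * (N * y * n 2 / 2)]

/-- The quadratic form in the exponent of `gauss`. -/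
def gaussForm (x : Fin 3 → ℝ) : ℝ := 2 * x 0 ^ 2 + x 1 ^ 2 + 2 * x 2 ^ 2

/-- The generating function of the products of Hermite functions. -/
def genFn (N : ℕ) (b : Fin 3 → ℂ) (x : Fin 3 → ℝ) : ℂ :=
  cexp (b 0 * (√(8 * π / N) * (x 0 - x 2) : ℝ) + b 1 * (√(8 * π / N) * x 1 : ℝ) +
    b 2 * (√(8 * π / N) * (x 0 + x 2) : ℝ) - (b 0 ^ 2 + b 1 ^ 2 + b 2 ^ 2) / 2) * gauss N x

/-- The summand of the theta series of `genFn`, without its coefficient. -/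
def genTerm (N : ℕ) (z : ℂ) (ξ y : ℝ) (b : Fin 3 → ℂ) (n : Fin 3 → ℤ) : ℂ :=
  expo (z.re * (n 1 ^ 2 - n 0 * n 2)) * genFn N b (thetaPoint N z.im ξ y n)

theorem sqrt_mul_sqrt_eq (N : ℕ) [NeZero N] {v : ℝ} (hv : 0 < v) :
    √(8 * π / N) * √(4 * N * v) = 2 * √(8 * π * v) := by
  have hN : (0 : ℝ) < N := Nat.cast_pos.2 (NeZero.pos N)
  have hpi := Real.pi_pos
  rw [← Real.sqrt_mul (by positivity), show (2 : ℝ) = √4 by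
    rw [show (4 : ℝ) = 2 ^ 2 by norm_num, Real.sqrt_sq (by norm_num)],
    ← Real.sqrt_mul (by norm_num)]
  congr 1
  field_simp

/-- The part of the exponent of `genTerm` that does not depend on `n 0`. -/
def genRest (N : ℕ) (z : ℂ) (ξ y : ℝ) (b : Fin 3 → ℂ) (k l : ℤ) : ℂ :=
  -4 * π * z.im * ((4 * N * ξ * k - 4 * N ^ 2 * ξ ^ 2 * l) / (4 * N * y)) ^ 2
    - 4 * π * z.im * (N * y * l) ^ 2 - 2 * π * z.im * (k - 2 * N * ξ * l) ^ 2
    - √(8 * π * z.im) * (b 0 + b 2) * ((4 * N * ξ * k - 4 * N ^ 2 * ξ ^ 2 * l) / (4 * N * y))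
    + √(8 * π * z.im) * (b 2 - b 0) * (N * y * l) + √(8 * π * z.im) * b 1 * (k - 2 * N * ξ * l)
    - (b 0 ^ 2 + b 1 ^ 2 + b 2 ^ 2) / 2 + 2 * π * I * z.re * k ^ 2

/-- The linear coefficient of `n 0` in the exponent of `genTerm`. -/
def genShift (N : ℕ) (z : ℂ) (ξ y : ℝ) (b : Fin 3 → ℂ) (k l : ℤ) : ℂ :=
  -z.re * l + (8 * π * z.im * (4 * N * ξ * k - 4 * N ^ 2 * ξ ^ 2 * l) / (4 * N * y) ^ 2 +
    √(8 * π * z.im) * (b 0 + b 2) / (4 * N * y)) / (2 * π * I)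

/-- Isolates n₀ in the shape required by `hasSum_poisson_periodic`, with a = v/(2Ny)². -/
theorem genTerm_eq (N : ℕ) [NeZero N] {z : ℂ} (hz : 0 < z.im) (ξ : ℝ) {y : ℝ} (hy : 0 < y)
    (b : Fin 3 → ℂ) (n : Fin 3 → ℤ) :
    genTerm N z ξ y b n = cexp (genRest N z ξ y b (n 1) (n 2)) *
      cexp (-π * ((z.im / (2 * N * y) ^ 2 : ℝ) : ℂ) * n 0 ^ 2 +
        2 * π * I * n 0 * genShift N z ξ y b (n 1) (n 2)) := by
  have hN : (N : ℂ) ≠ 0 := by exact_mod_cast NeZero.ne N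
  have hyc : (y : ℂ) ≠ 0 := by exact_mod_cast hy.ne'
  have hpi : (π : ℂ) ≠ 0 := by exact_mod_cast Real.pi_ne_zero
  have hρ := sqrt_mul_sqrt_eq N hz
  have hNr : (0 : ℝ) < N := Nat.cast_pos.2 (NeZero.pos N)
  have hsq : √(4 * N * z.im) ^ 2 = 4 * N * z.im := Real.sq_sqrt (by positivity)
  have e0 : √(8 * π / N) * (thetaPoint N z.im ξ y n 0 - thetaPoint N z.im ξ y n 2) =
      2 * √(8 * π * z.im) * ((n 0 / 4 - N * ξ * n 1 + N ^ 2 * ξ ^ 2 * n 2) / (2 * N * y) -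
        N * y * n 2 / 2) := by
    rw [← hρ]; simp [thetaPoint]; ring
  have e1 : √(8 * π / N) * thetaPoint N z.im ξ y n 1 =
      2 * √(8 * π * z.im) * (n 1 / 2 - N * ξ * n 2) := by
    rw [← hρ]; simp [thetaPoint]; ring
  have e2 : √(8 * π / N) * (thetaPoint N z.im ξ y n 0 + thetaPoint N z.im ξ y n 2) =
      2 * √(8 * π * z.im) * ((n 0 / 4 - N * ξ * n 1 + N ^ 2 * ξ ^ 2 * n 2) / (2 * N * y) +
        N * y * n 2 / 2) := by
    rw [← hρ]; simp [thetaPoint]; ring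
  have e3 : gauss N (thetaPoint N z.im ξ y n) = Real.exp (-2 * π / N * (4 * N * z.im) *
      (2 * ((n 0 / 4 - N * ξ * n 1 + N ^ 2 * ξ ^ 2 * n 2) / (2 * N * y)) ^ 2 +
        (n 1 / 2 - N * ξ * n 2) ^ 2 + 2 * (N * y * n 2 / 2) ^ 2)) := by
    rw [gauss, ← hsq]
    congr 1
    simp [thetaPoint]
    ring
  rw [genTerm, genFn, e0, e1, e2, e3, expo, ofReal_exp, ← Complex.exp_add, ← Complex.exp_add,
    ← Complex.exp_add, genRest, genShift]
  congr 1
  push_cast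
  field_simp
  ring

/-- The exponential factor of `modKernel`. -/
def modExp (ξ y : ℝ) (b : Fin 3 → ℂ) (s j : ℤ) (z : ℂ) : ℂ :=
  -π * y ^ 2 / (4 * z.im) * ((j + s * z) * (j + s * starRingEnd ℂ z))
    - I * √(8 * π * z.im) * y / (4 * z.im) *
      (b 0 * (j + s * starRingEnd ℂ z) + b 2 * (j + s * z))
    + b 0 * b 2 - b 1 ^ 2 / 2 + π * I * ξ ^ 2 * s * (j + s * z) / 2
    - √(8 * π * z.im) * b 1 * ξ * s / 2

/-- The elliptic variable of the Jacobi theta function in `modKernel`. -/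
def modArg (ξ : ℝ) (b : Fin 3 → ℂ) (s j : ℤ) (z : ℂ) : ℂ :=
  -ξ * (j + s * z) + √(8 * π * z.im) * b 1 / (2 * π * I)

/-- The kernel obtained from the theta series by partial Poisson summation; it depends on
`(s, j)` essentially through `j + s z`. -/
def modKernel (ξ y : ℝ) (b : Fin 3 → ℂ) (s j : ℤ) (z : ℂ) : ℂ :=
  cexp (modExp ξ y b s j z) * jacobiTheta₂ (modArg ξ b s j z) (2 * z)

/-- On the hyperbolic plane the partial Fourier transform replaces n₀ by its dual j and makes the
Gaussian definite in j + sz with s = 4Nl. What is left in k is quadratic with parameter 2z plus a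
linear term, that is, a term of the Jacobi theta series. -/
theorem gen_exponent_eq (N : ℕ) [NeZero N] {z : ℂ} (hz : 0 < z.im) (ξ : ℝ) {y : ℝ} (hy : 0 < y)
    (b : Fin 3 → ℂ) (j k l : ℤ) :
    cexp (genRest N z ξ y b k l) * cexp (-π * (genShift N z ξ y b k l - j / (4 * N : ℕ)) ^ 2 /
      ((z.im / (2 * N * y) ^ 2 : ℝ) : ℂ)) =
    cexp (modExp ξ y b (4 * N * l) j z) *
      jacobiTheta₂_term k (modArg ξ b (4 * N * l) j z) (2 * z) := by
  have hN : (N : ℂ) ≠ 0 := by exact_mod_cast NeZero.ne N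
  have hyc : (y : ℂ) ≠ 0 := by exact_mod_cast hy.ne'
  have hvc : (z.im : ℂ) ≠ 0 := by exact_mod_cast hz.ne'
  have hpi : (π : ℂ) ≠ 0 := by exact_mod_cast Real.pi_ne_zero
  have hpip := Real.pi_pos
  have hρ : ((√(8 * π * z.im) : ℝ) : ℂ) ^ 2 = 8 * π * z.im := by
    rw [← ofReal_pow, Real.sq_sqrt (by positivity)]
    push_cast
    rfl
  have hz' : z = z.re + z.im * I := (re_add_im z).symm
  have hzc : starRingEnd ℂ z = z.re - z.im * I := by
    apply Complex.ext <;> simp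
  rw [jacobiTheta₂_term, ← Complex.exp_add, ← Complex.exp_add, genRest, genShift, modExp, modArg,
    hzc]
  congr 1
  generalize hre : (z.re : ℂ) = u at *
  generalize him : (z.im : ℂ) = v at *
  subst hz'
  push_cast
  rw [him]
  generalize ((√(8 * π * (u + v * I : ℂ).im) : ℝ) : ℂ) = ρ at *
  have hI := I_sq
  have hI3 : I ^ 3 = -I := by rw [pow_succ, I_sq]; ring
  have hI4 : I ^ 4 = 1 := I_pow_four
  field_simp
  ring_nf
  simp only [hI, hI3, hI4, hρ]
  ring

/-- Back substitution in a triangular sum of squares: first t, then y, then x, using (a+b)² ≤ 2a² +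
2b² and its analogue for three terms. -/
theorem sq_le_of_triangular {α β γ : ℝ} (hα : 0 < α) (hβ : 0 < β) (hγ : 0 < γ) (p q r x y t : ℝ) :
    t ^ 2 ≤ 1 / α * (α * t ^ 2 + β * (y - q * t) ^ 2 + γ * (x - p * y - r * t) ^ 2) ∧
    y ^ 2 ≤ (2 / β + 2 * q ^ 2 * (1 / α)) *
      (α * t ^ 2 + β * (y - q * t) ^ 2 + γ * (x - p * y - r * t) ^ 2) ∧
    x ^ 2 ≤ (3 / γ + 3 * p ^ 2 * (2 / β + 2 * q ^ 2 * (1 / α)) + 3 * r ^ 2 * (1 / α)) *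
      (α * t ^ 2 + β * (y - q * t) ^ 2 + γ * (x - p * y - r * t) ^ 2) := by
  obtain ⟨S, hS⟩ : ∃ S, S = α * t ^ 2 + β * (y - q * t) ^ 2 + γ * (x - p * y - r * t) ^ 2 :=
    ⟨_, rfl⟩
  rw [← hS]
  have p2 : 0 ≤ α * t ^ 2 := by positivity
  have p1 : 0 ≤ β * (y - q * t) ^ 2 := by positivity
  have p0 : 0 ≤ γ * (x - p * y - r * t) ^ 2 := by positivity
  have h2 : t ^ 2 ≤ 1 / α * S := by
    rw [one_div_mul_eq_div, le_div_iff₀ hα]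
    linarith
  have h1' : (y - q * t) ^ 2 ≤ S / β := by
    rw [le_div_iff₀ hβ]
    linarith
  have h0' : (x - p * y - r * t) ^ 2 ≤ S / γ := by
    rw [le_div_iff₀ hγ]
    linarith
  have h1 : y ^ 2 ≤ (2 / β + 2 * q ^ 2 * (1 / α)) * S := by
    have e : (2 / β + 2 * q ^ 2 * (1 / α)) * S = 2 * (S / β) + 2 * (q ^ 2 * (1 / α * S)) := by ring
    rw [e]
    have := mul_le_mul_of_nonneg_left h2 (sq_nonneg q)
    have h3 : y ^ 2 ≤ 2 * (y - q * t) ^ 2 + 2 * (q ^ 2 * t ^ 2) := by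
      nlinarith [sq_nonneg (y - 2 * q * t)]
    linarith
  refine ⟨h2, h1, ?_⟩
  have e : (3 / γ + 3 * p ^ 2 * (2 / β + 2 * q ^ 2 * (1 / α)) + 3 * r ^ 2 * (1 / α)) * S =
      3 * (S / γ) + 3 * (p ^ 2 * ((2 / β + 2 * q ^ 2 * (1 / α)) * S)) +
        3 * (r ^ 2 * (1 / α * S)) := by ring
  rw [e]
  have h3 (a b c : ℝ) : (a + b + c) ^ 2 ≤ 3 * a ^ 2 + 3 * b ^ 2 + 3 * c ^ 2 := by
    nlinarith [sq_nonneg (a - b), sq_nonneg (b - c), sq_nonneg (a - c)]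
  have h4 := h3 (x - p * y - r * t) (p * y) (r * t)
  have e2 : (x - p * y - r * t) + p * y + r * t = x := by ring
  rw [e2, mul_pow, mul_pow] at h4
  have m1 := mul_le_mul_of_nonneg_left h1 (sq_nonneg p)
  have m2 := mul_le_mul_of_nonneg_left h2 (sq_nonneg r)
  linarith

theorem exists_triangular_bound {α β γ : ℝ} (hα : 0 < α) (hβ : 0 < β) (hγ : 0 < γ) (p q r : ℝ) :
    ∃ ε > 0, ∀ n : Fin 3 → ℤ, ε * ‖n‖ ^ 2 ≤
      α * n 2 ^ 2 + β * (n 1 - q * n 2) ^ 2 + γ * (n 0 - p * n 1 - r * n 2) ^ 2 := by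
  have key := sq_le_of_triangular hα hβ hγ p q r
  obtain ⟨K2, hK2⟩ : ∃ K, K = 1 / α := ⟨_, rfl⟩
  obtain ⟨K1, hK1⟩ : ∃ K, K = 2 / β + 2 * q ^ 2 * (1 / α) := ⟨_, rfl⟩
  obtain ⟨K0, hK0⟩ : ∃ K, K = 3 / γ + 3 * p ^ 2 * (2 / β + 2 * q ^ 2 * (1 / α)) +
    3 * r ^ 2 * (1 / α) := ⟨_, rfl⟩
  rw [← hK0, ← hK1, ← hK2] at key
  have hK2p : 0 < K2 := by rw [hK2]; positivity
  have hK1p : 0 < K1 := by rw [hK1]; positivity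
  have hK0p : 0 < K0 := by rw [hK0]; positivity
  clear hK0 hK1 hK2
  refine ⟨1 / (K0 + K1 + K2), by positivity, fun n => ?_⟩
  obtain ⟨k2, k1, k0⟩ := key (n 0) (n 1) (n 2)
  have hS' : 0 ≤ α * (n 2 : ℝ) ^ 2 + β * (n 1 - q * n 2) ^ 2 +
    γ * (n 0 - p * n 1 - r * n 2) ^ 2 := by positivity
  generalize α * (n 2 : ℝ) ^ 2 + β * (n 1 - q * n 2) ^ 2 + γ * (n 0 - p * n 1 - r * n 2) ^ 2 = S
    at *
  have m0 := mul_nonneg hK0p.le hS'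
  have m1 := mul_nonneg hK1p.le hS'
  have m2 := mul_nonneg hK2p.le hS'
  have hK (i : Fin 3) : ((n i : ℝ)) ^ 2 ≤ (K0 + K1 + K2) * S := by
    rw [add_mul, add_mul]
    fin_cases i
    · exact k0.trans (by linarith)
    · exact k1.trans (by linarith)
    · exact k2.trans (by linarith)
  have hn : ‖n‖ ≤ √((K0 + K1 + K2) * S) := by
    refine (pi_norm_le_iff_of_nonneg (Real.sqrt_nonneg _)).2 fun i => ?_
    rw [Int.norm_eq_abs]
    exact Real.abs_le_sqrt (hK i)
  have hn2 : ‖n‖ ^ 2 ≤ (K0 + K1 + K2) * S := by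
    calc ‖n‖ ^ 2 ≤ √((K0 + K1 + K2) * S) ^ 2 := by gcongr
      _ = _ := Real.sq_sqrt (by positivity)
  rw [div_mul_eq_mul_div, one_mul, div_le_iff₀ (by positivity)]
  linarith

theorem exists_gaussForm_bound (N : ℕ) [NeZero N] {v y : ℝ} (hv : 0 < v) (ξ : ℝ) (hy : 0 < y) :
    ∃ ε > 0, ∀ n : Fin 3 → ℤ, ε * ‖n‖ ^ 2 ≤ gaussForm (thetaPoint N v ξ y n) := by
  have hN : (0 : ℝ) < N := Nat.cast_pos.2 (NeZero.pos N)
  -- The coefficients are read off `gaussForm` at `thetaPoint`, whose coordinates are triangular in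
  -- n₂, n₁, n₀.
  obtain ⟨ε, hε, h⟩ := exists_triangular_bound (α := 2 * N * v * (N * y) ^ 2)
    (β := N * v) (γ := v / (8 * N * y ^ 2)) (by positivity) (by positivity) (by positivity)
    (4 * N * ξ) (2 * N * ξ) (-(4 * N ^ 2 * ξ ^ 2))
  refine ⟨ε, hε, fun n => (h n).trans (le_of_eq ?_)⟩
  have hsq : √(4 * N * v) ^ 2 = 4 * N * v := Real.sq_sqrt (by positivity)
  have : gaussForm (thetaPoint N v ξ y n) = √(4 * N * v) ^ 2 *
      (2 * ((n 0 / 4 - N * ξ * n 1 + N ^ 2 * ξ ^ 2 * n 2) / (2 * N * y)) ^ 2 +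
        (n 1 / 2 - N * ξ * n 2) ^ 2 + 2 * (N * y * n 2 / 2) ^ 2) := by
    simp [gaussForm, thetaPoint]
    ring
  rw [this, hsq]
  field_simp
  ring

/-- Half of the Gaussian absorbs the linear terms: R|t| ≤ t²/8 + 2R² for each of the three, where
the t²/8 add up to (π/N)·`gaussForm`. The constant is 3·2R² + 3R²/2 = 15R²/2. -/
theorem norm_genFn_le (N : ℕ) {R : ℝ} {b : Fin 3 → ℂ} (hb : ∀ i, ‖b i‖ ≤ R)
    (x : Fin 3 → ℝ) :
    ‖genFn N b x‖ ≤ Real.exp (15 * R ^ 2 / 2) * Real.exp (-(π / N) * gaussForm x) := by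
  have hsq : √(8 * π / N) ^ 2 = 8 * π / N := Real.sq_sqrt (by positivity)
  rw [genFn, gauss, norm_mul, Complex.norm_exp, norm_real, Real.norm_of_nonneg (Real.exp_pos _).le,
    ← Real.exp_add, ← Real.exp_add]
  apply Real.exp_le_exp.2
  have hR : 0 ≤ R := (norm_nonneg _).trans (hb 0)
  have hlin (i : Fin 3) (t : ℝ) : (b i * (t : ℂ)).re ≤ t ^ 2 / 8 + 2 * R ^ 2 := by
    calc (b i * (t : ℂ)).re ≤ ‖b i * (t : ℂ)‖ := re_le_norm _
      _ ≤ R * |t| := by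
        rw [norm_mul, norm_real, Real.norm_eq_abs]
        exact mul_le_mul_of_nonneg_right (hb i) (abs_nonneg _)
      _ ≤ t ^ 2 / 8 + 2 * R ^ 2 := by
        nlinarith [sq_nonneg (|t| - 4 * R), sq_abs t]
  have hq : -((b 0 ^ 2 + b 1 ^ 2 + b 2 ^ 2) / 2).re ≤ 3 * R ^ 2 / 2 := by
    have h (i : Fin 3) : ‖b i ^ 2‖ ≤ R ^ 2 := by
      rw [norm_pow]
      exact pow_le_pow_left₀ (norm_nonneg _) (hb i) 2
    calc -((b 0 ^ 2 + b 1 ^ 2 + b 2 ^ 2) / 2).re ≤ ‖(b 0 ^ 2 + b 1 ^ 2 + b 2 ^ 2) / 2‖ := by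
          have := abs_re_le_norm ((b 0 ^ 2 + b 1 ^ 2 + b 2 ^ 2) / 2)
          linarith [neg_abs_le ((b 0 ^ 2 + b 1 ^ 2 + b 2 ^ 2) / 2).re]
      _ ≤ (‖b 0 ^ 2‖ + ‖b 1 ^ 2‖ + ‖b 2 ^ 2‖) / 2 := by
          rw [norm_div, Complex.norm_ofNat]
          gcongr
          exact norm_add₃_le
      _ ≤ _ := by linarith [h 0, h 1, h 2]
  rw [sub_re, add_re, add_re]
  have h0 := hlin 0 (√(8 * π / N) * (x 0 - x 2))
  have h1 := hlin 1 (√(8 * π / N) * x 1)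
  have h2 := hlin 2 (√(8 * π / N) * (x 0 + x 2))
  rw [mul_pow, hsq] at h0 h1 h2
  have e : 8 * π / N * (x 0 - x 2) ^ 2 / 8 + 8 * π / N * x 1 ^ 2 / 8 +
      8 * π / N * (x 0 + x 2) ^ 2 / 8 = π / N * gaussForm x := by
    rw [gaussForm]; ring
  have e2 : -2 * π / N * (2 * x 0 ^ 2 + x 1 ^ 2 + 2 * x 2 ^ 2) = -2 * (π / N * gaussForm x) := by
    rw [gaussForm]; ring
  rw [e2]
  linarith

theorem norm_expo (x : ℝ) : ‖expo x‖ = 1 := by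
  rw [expo, show 2 * (π : ℂ) * I * x = (2 * π * x : ℝ) * I by push_cast; ring, norm_exp_ofReal_mul_I]

theorem summable_of_gaussian_bound {T : (Fin 3 → ℤ) → ℂ} (C : ℝ) {ε : ℝ} (hε : 0 < ε) (B : ℝ)
    (h : ∀ n, ‖T n‖ ≤ C * Real.exp (-ε * ‖n‖ ^ 2 + B * ‖n‖)) : Summable T := by
  apply Summable.of_norm_bounded ((summable_gaussian 0 hε B).mul_left C)
  simpa using h

/-! ### The character -/

section Character

variable {N : ℕ} (χ : DirichletCharacter ℂ (4 * N)) (l : ℤ)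

theorem chiOne_mul (a b : ℤ) : chiOne χ l (a * b) = chiOne χ l a * chiOne χ l b := by
  simp only [chiOne, Int.cast_mul, map_mul, mul_zpow]
  ring

theorem chiOne_add_mul (a k : ℤ) : chiOne χ l (a + 4 * N * k) = chiOne χ l a := by
  have h1 : ((a + 4 * N * k : ℤ) : ZMod (4 * N)) = a := by
    have : ((4 * N : ℕ) : ZMod (4 * N)) = 0 := ZMod.natCast_self _
    push_cast at this ⊢
    rw [this, zero_mul, add_zero]
  have h2 : ((a + 4 * N * k : ℤ) : ZMod 4) = a := by
    have : (4 : ZMod 4) = 0 := rfl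
    push_cast
    rw [this, zero_mul, zero_mul, add_zero]
  rw [chiOne, chiOne, h1, h2]

theorem norm_chiFour_zpow_le (a : ZMod 4) : ‖((ZMod.χ₄ a : ℤ) : ℂ) ^ l‖ ≤ 1 := by
  have : ZMod.χ₄ a = 0 ∨ ZMod.χ₄ a = 1 ∨ ZMod.χ₄ a = -1 := by
    revert a
    decide
  rcases this with h | h | h
  · rw [h, Int.cast_zero, norm_zpow, norm_zero]
    -- The base is 0 here: the power is 1 for l = 0 and 0 for every other l, negative ones included.
    rcases eq_or_ne l 0 with rfl | hl
    · simp
    · rw [zero_zpow _ hl]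
      exact zero_le_one
  · simp [h]
  · simp [h, norm_zpow]

theorem norm_chiOne_le (a : ℤ) : ‖chiOne χ l a‖ ≤ 1 := by
  rw [chiOne, norm_mul]
  exact mul_le_one₀ (DirichletCharacter.norm_le_one χ _) (norm_nonneg _) (norm_chiFour_zpow_le l _)

theorem norm_chiCheck_le (t : ℝ) : ‖chiCheck χ l t‖ ≤ 4 * N := by
  rw [chiCheck]
  refine (norm_sum_le _ _).trans ?_
  refine (Finset.sum_le_card_nsmul _ _ 1 fun h _ => ?_).trans (by simp)
  rw [norm_mul, norm_expo, mul_one, RCLike.norm_conj]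
  exact norm_chiOne_le χ l _

theorem isUnit_of_isCoprime {a : ℤ} (h : IsCoprime a (4 * N)) : IsUnit (a : ZMod (4 * N)) := by
  obtain ⟨x, y, hxy⟩ := h
  have := congrArg (Int.cast : ℤ → ZMod (4 * N)) hxy
  have h0 : ((4 * N : ℕ) : ZMod (4 * N)) = 0 := ZMod.natCast_self _
  push_cast at this h0
  rw [h0, mul_zero, add_zero] at this
  exact IsUnit.of_mul_eq_one (x : ZMod (4 * N)) ((mul_comm _ _).trans this)

theorem chiFour_sq_of_odd {a : ℤ} (h : Odd a) : ((ZMod.χ₄ (a : ZMod 4) : ℤ) : ℂ) ^ 2 = 1 := by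
  have : a % 4 = 1 ∨ a % 4 = 3 := by
    rw [Int.odd_iff] at h
    omega
  rcases this with h | h
  · rw [ZMod.χ₄_int_one_mod_four h]; simp
  · rw [ZMod.χ₄_int_three_mod_four h]; simp

theorem odd_of_isCoprime {a : ℤ} (h : IsCoprime a (4 * N)) : Odd a := by
  rw [← Int.not_even_iff_odd]
  rintro ⟨k, rfl⟩
  obtain ⟨x, y, hxy⟩ := h
  have : 2 * (x * k + y * (2 * N)) = 1 := by linear_combination hxy
  omega

theorem norm_chiOne_of_isCoprime {a : ℤ} (h : IsCoprime a (4 * N)) : ‖chiOne χ l a‖ = 1 := by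
  have hodd := odd_of_isCoprime h
  obtain ⟨u, hu⟩ := isUnit_of_isCoprime h
  have h4 : ‖((ZMod.χ₄ (a : ZMod 4) : ℤ) : ℂ)‖ = 1 := by
    have := congrArg norm (chiFour_sq_of_odd hodd)
    rw [norm_pow, norm_one] at this
    exact (pow_eq_one_iff_of_nonneg (norm_nonneg _) two_ne_zero).1 this
  rw [chiOne, norm_mul, norm_zpow, h4, one_zpow, mul_one, ← hu, DirichletCharacter.unit_norm_eq_one]

end Character

/-! ### Gaussian bounds and partial Poisson summation -/

section

/-- The bound is uniform over bounded parameters b; this is what allows integrating the series over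
b term by term. -/
theorem norm_genTerm_le (N : ℕ) [NeZero N] {z : ℂ} (hz : 0 < z.im) (ξ : ℝ) {y : ℝ} (hy : 0 < y)
    (R : ℝ) : ∃ C : ℝ, ∃ ε > 0, ∀ b : Fin 3 → ℂ, (∀ i, ‖b i‖ ≤ R) → ∀ n,
      ‖genTerm N z ξ y b n‖ ≤ C * Real.exp (-ε * ‖n‖ ^ 2) := by
  have hN : (0 : ℝ) < N := Nat.cast_pos.2 (NeZero.pos N)
  obtain ⟨ε, hε, h⟩ := exists_gaussForm_bound N hz ξ hy
  refine ⟨Real.exp (15 * R ^ 2 / 2), π / N * ε, by positivity, fun b hb n => ?_⟩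
  rw [genTerm, norm_mul]
  have h1 := norm_genFn_le N hb (thetaPoint N z.im ξ y n)
  have h2 : ‖expo (z.re * (n 1 ^ 2 - n 0 * n 2))‖ = 1 := norm_expo _
  rw [h2, one_mul]
  refine h1.trans (mul_le_mul_of_nonneg_left (Real.exp_le_exp.2 ?_) (Real.exp_pos _).le)
  have := mul_le_mul_of_nonneg_left (h n) (show 0 ≤ π / N by positivity)
  linarith

variable {N : ℕ} [NeZero N] (χ : DirichletCharacter ℂ (4 * N)) (l : ℤ)

theorem summable_coeff_genTerm {z : ℂ} (hz : 0 < z.im) (ξ : ℝ) {y : ℝ} (hy : 0 < y)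
    (b : Fin 3 → ℂ) : Summable fun n : Fin 3 → ℤ => chiCheck χ l (n 0) * genTerm N z ξ y b n := by
  obtain ⟨C, ε, hε, h⟩ := norm_genTerm_le N hz ξ hy ‖b‖
  refine summable_of_gaussian_bound (4 * N * C) hε 0 fun n => ?_
  rw [norm_mul, mul_assoc]
  refine mul_le_mul (norm_chiCheck_le χ l _) ?_ (norm_nonneg _) (by positivity)
  simpa using h b (norm_le_pi_norm b) n

/-- The summand after partial Poisson summation. -/
def dualTerm (z : ℂ) (ξ y : ℝ) (b : Fin 3 → ℂ) (n : Fin 3 → ℤ) : ℂ :=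
  starRingEnd ℂ (chiOne χ l (-n 0)) * (cexp (modExp ξ y b (4 * N * n 2) (n 0) z) *
    jacobiTheta₂_term (n 1) (modArg ξ b (4 * N * n 2) (n 0) z) (2 * z))

/-- The exponent is sorted into a negative definite triangular form, a purely imaginary part, and
terms of degree at most one in n. This yields the absolute convergence of the dual series, hence the
freedom to reorder it. -/
theorem dual_exponent_eq {N : ℕ} {z : ℂ} (hz : 0 < z.im) (ξ : ℝ) {y : ℝ} (b : Fin 3 → ℂ)
    (n : Fin 3 → ℤ) :
    cexp (modExp ξ y b (4 * N * n 2) (n 0) z) *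
      jacobiTheta₂_term (n 1) (modArg ξ b (4 * N * n 2) (n 0) z) (2 * z) =
    cexp (((-(4 * π * N ^ 2 * y ^ 2 * z.im * n 2 ^ 2 +
          2 * π * z.im * (n 1 - 2 * N * ξ * n 2) ^ 2 +
          π * y ^ 2 / (4 * z.im) * (n 0 - 0 * n 1 - (-(4 * N * z.re)) * n 2) ^ 2) : ℝ) : ℂ) +
      ((π * ξ ^ 2 * (4 * N * n 2) * (n 0 + 4 * N * n 2 * z.re) / 2 -
        2 * π * n 1 * ξ * (n 0 + 4 * N * n 2 * z.re) + 2 * π * n 1 ^ 2 * z.re : ℝ) : ℂ) * I +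
      ((b 0 * b 2 - b 1 ^ 2 / 2) +
      (-I * √(8 * π * z.im) * y / (4 * z.im) * (b 0 + b 2)) * n 0 +
      √(8 * π * z.im) * b 1 * n 1 +
      (-I * √(8 * π * z.im) * y / (4 * z.im) * (4 * N * (b 0 * starRingEnd ℂ z + b 2 * z)) -
        √(8 * π * z.im) * b 1 * ξ * (4 * N) / 2) * n 2)) := by
  have hvc : (z.im : ℂ) ≠ 0 := by exact_mod_cast hz.ne'
  have hpi : (π : ℂ) ≠ 0 := by exact_mod_cast Real.pi_ne_zero
  have hz' : z = z.re + z.im * I := (re_add_im z).symm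
  have hzc : starRingEnd ℂ z = z.re - z.im * I := by
    apply Complex.ext <;> simp
  rw [jacobiTheta₂_term, ← Complex.exp_add, modExp, modArg, hzc]
  congr 1
  generalize hre : (z.re : ℂ) = u at *
  generalize him : (z.im : ℂ) = v at *
  subst hz'
  push_cast
  rw [him, hre]
  generalize ((√(8 * π * (u + v * I : ℂ).im) : ℝ) : ℂ) = ρ at *
  have hI := I_sq
  field_simp
  ring_nf
  simp only [hI]
  ring

theorem summable_dualTerm {z : ℂ} (hz : 0 < z.im) (ξ : ℝ) {y : ℝ} (hy : 0 < y)
    (b : Fin 3 → ℂ) : Summable (dualTerm χ l z ξ y b) := by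
  have hN : (0 : ℝ) < N := Nat.cast_pos.2 (NeZero.pos N)
  have hpi := Real.pi_pos
  obtain ⟨ε, hε, h⟩ := exists_triangular_bound (α := 4 * π * N ^ 2 * y ^ 2 * z.im)
    (β := 2 * π * z.im) (γ := π * y ^ 2 / (4 * z.im)) (by positivity) (by positivity)
    (by positivity) 0 (2 * N * ξ) (-(4 * N * z.re))
  have hlin (c0 c1 c2 c3 : ℂ) (n : Fin 3 → ℤ) : (c0 + c1 * n 0 + c2 * n 1 + c3 * n 2).re ≤
      ‖c0‖ + (‖c1‖ + ‖c2‖ + ‖c3‖) * ‖n‖ := by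
    have hc (c : ℂ) (i : Fin 3) : ‖c * n i‖ ≤ ‖c‖ * ‖n‖ := by
      rw [norm_mul]
      exact mul_le_mul_of_nonneg_left (norm_apply_le n i) (norm_nonneg _)
    refine (re_le_norm _).trans ((norm_add_le _ _).trans ?_)
    have := norm_add₃_le (a := c0) (b := c1 * n 0) (c := c2 * n 1)
    linarith [hc c1 0, hc c2 1, hc c3 2]
  obtain ⟨K, hK⟩ : ∃ K : Fin 4 → ℂ, K = ![b 0 * b 2 - b 1 ^ 2 / 2,
    -I * √(8 * π * z.im) * y / (4 * z.im) * (b 0 + b 2), √(8 * π * z.im) * b 1,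
    -I * √(8 * π * z.im) * y / (4 * z.im) * (4 * N * (b 0 * starRingEnd ℂ z + b 2 * z)) -
        √(8 * π * z.im) * b 1 * ξ * (4 * N) / 2] := ⟨_, rfl⟩
  refine summable_of_gaussian_bound (Real.exp ‖K 0‖) hε (‖K 1‖ + ‖K 2‖ + ‖K 3‖) fun n => ?_
  rw [dualTerm, norm_mul, RCLike.norm_conj, dual_exponent_eq hz]
  refine (mul_le_of_le_one_left (norm_nonneg _) (norm_chiOne_le χ l _)).trans ?_
  rw [Complex.norm_exp, ← Real.exp_add]
  apply Real.exp_le_exp.2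
  have h1 := hlin (K 0) (K 1) (K 2) (K 3) n
  have h2 := h n
  have e0 : b 0 * b 2 - b 1 ^ 2 / 2 = K 0 := by rw [hK]; rfl
  have e1 : -I * √(8 * π * z.im) * y / (4 * z.im) * (b 0 + b 2) = K 1 := by rw [hK]; rfl
  have e2 : √(8 * π * z.im) * b 1 = K 2 := by rw [hK]; rfl
  have e3 : -I * √(8 * π * z.im) * y / (4 * z.im) * (4 * N * (b 0 * starRingEnd ℂ z + b 2 * z)) -
        √(8 * π * z.im) * b 1 * ξ * (4 * N) / 2 = K 3 := by rw [hK]; rfl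
  rw [e0, e1, e3, e2, add_re, add_re, ofReal_re, re_ofReal_mul, I_re, mul_zero, add_zero]
  linarith

theorem tsum_fiber_eq {z : ℂ} (hz : 0 < z.im) (ξ : ℝ) {y : ℝ} (hy : 0 < y)
    (b : Fin 3 → ℂ) (k m : ℤ) :
    ∑' i : ℤ, chiCheck χ l (i : ℤ) * genTerm N z ξ y b ![i, k, m] =
      ((√(z.im / (2 * N * y) ^ 2) : ℝ) : ℂ)⁻¹ * ∑' j : ℤ, dualTerm χ l z ξ y b ![j, k, m] := by
  have hN : (0 : ℝ) < N := Nat.cast_pos.2 (NeZero.pos N)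
  have ha : 0 < z.im / (2 * N * y) ^ 2 := by positivity
  have hψ (n : ℤ) : starRingEnd ℂ (chiOne χ l (n + (4 * N : ℕ))) =
      starRingEnd ℂ (chiOne χ l n) := by
    have := chiOne_add_mul χ l n 1
    push_cast
    rw [← this, mul_one]
  have h := (hasSum_poisson_periodic (fun n => starRingEnd ℂ (chiOne χ l n)) hψ ha
    (genShift N z ξ y b k m)).mul_left (cexp (genRest N z ξ y b k m))
  have hd : (fun j : ℤ => dualTerm χ l z ξ y b ![j, k, m]) = fun j : ℤ =>
      cexp (genRest N z ξ y b k m) * (starRingEnd ℂ (chiOne χ l (-j)) *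
        cexp (-π * (genShift N z ξ y b k m - j / (4 * N : ℕ)) ^ 2 /
          ((z.im / (2 * N * y) ^ 2 : ℝ) : ℂ))) := by
    funext j
    have := gen_exponent_eq N hz ξ hy b j k m
    simp only [dualTerm, Matrix.cons_val_zero, Matrix.cons_val_one, Matrix.cons_val]
    rw [← this]
    ring
  have hroot : ((z.im / (2 * N * y) ^ 2 : ℝ) : ℂ) ^ (1 / 2 : ℂ) =
      ((√(z.im / (2 * N * y) ^ 2) : ℝ) : ℂ) := by
    rw [Real.sqrt_eq_rpow, ofReal_cpow ha.le]
    norm_num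
  have hrne : ((√(z.im / (2 * N * y) ^ 2) : ℝ) : ℂ) ≠ 0 := by
    exact_mod_cast (Real.sqrt_pos.2 ha).ne'
  rw [hd, h.tsum_eq, hroot, mul_left_comm, inv_mul_cancel_left₀ hrne, ← tsum_mul_left]
  refine tsum_congr fun i => ?_
  rw [genTerm_eq N hz ξ hy]
  simp only [Matrix.cons_val_zero, Matrix.cons_val_one, Matrix.cons_val]
  have : chiCheck χ l (i : ℤ) = ∑ h ∈ Finset.Icc 1 (4 * N),
      starRingEnd ℂ (chiOne χ l (h : ℕ)) * cexp (2 * π * I * (h * i / (4 * N : ℕ))) := by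
    rw [chiCheck]
    refine Finset.sum_congr rfl fun h _ => ?_
    rw [expo]
    push_cast
    rfl
  rw [this]
  ring

/-- Partial Poisson summation for the theta series of `genFn`. -/
theorem tsum_genTerm_eq {z : ℂ} (hz : 0 < z.im) (ξ : ℝ) {y : ℝ} (hy : 0 < y)
    (b : Fin 3 → ℂ) :
    ∑' n : Fin 3 → ℤ, chiCheck χ l (n 0) * genTerm N z ξ y b n =
      ((√(z.im / (2 * N * y) ^ 2) : ℝ) : ℂ)⁻¹ * ∑' p : ℤ × ℤ,
        starRingEnd ℂ (chiOne χ l (-p.2)) * modKernel ξ y b (4 * N * p.1) p.2 z := by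
  set F : ℤ × ℤ × ℤ → ℂ := fun p => chiCheck χ l (p.1 : ℤ) * genTerm N z ξ y b ![p.1, p.2.1, p.2.2]
  set G : ℤ × ℤ × ℤ → ℂ := fun p => dualTerm χ l z ξ y b ![p.1, p.2.1, p.2.2]
  have hF : Summable F := (tripleEquiv.symm.summable_iff).2 (summable_coeff_genTerm χ l hz ξ hy b)
  have hG : Summable G := (tripleEquiv.symm.summable_iff).2 (summable_dualTerm χ l hz ξ hy b)
  have h1 : ∑' n : Fin 3 → ℤ, chiCheck χ l (n 0) * genTerm N z ξ y b n = ∑' p, F p :=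
    (tripleEquiv.symm.tsum_eq fun n : Fin 3 → ℤ => chiCheck χ l (n 0) * genTerm N z ξ y b n).symm
  have h2 : ∑' p, F p = ∑' q : ℤ × ℤ, ∑' i : ℤ, F (i, q) := by
    rw [← (Equiv.prodComm (ℤ × ℤ) ℤ).tsum_eq F]
    exact (((Equiv.prodComm (ℤ × ℤ) ℤ).summable_iff).2 hF).tsum_prod
  have h3 : ∑' p, G p = ∑' q : ℤ × ℤ, ∑' i : ℤ, G (i, q) := by
    rw [← (Equiv.prodComm (ℤ × ℤ) ℤ).tsum_eq G]
    exact (((Equiv.prodComm (ℤ × ℤ) ℤ).summable_iff).2 hG).tsum_prod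
  -- The dual series is summed over k innermost, for fixed (n₂, j), so that the inner sum is a
  -- Jacobi theta function.
  set e : (ℤ × ℤ) × ℤ ≃ ℤ × ℤ × ℤ :=
    { toFun := fun p => (p.1.2, p.2, p.1.1)
      invFun := fun p => ((p.2.2, p.1), p.2.1)
      left_inv := fun _ => rfl
      right_inv := fun _ => rfl }
  have h4 : ∑' p, G p = ∑' p : ℤ × ℤ, ∑' k : ℤ, G (p.2, k, p.1) := by
    rw [← e.tsum_eq G]
    exact ((e.summable_iff).2 hG).tsum_prod
  rw [h1, h2]
  have h5 (q : ℤ × ℤ) : ∑' i : ℤ, F (i, q) = ((√(z.im / (2 * N * y) ^ 2) : ℝ) : ℂ)⁻¹ *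
      ∑' i : ℤ, G (i, q) := tsum_fiber_eq χ l hz ξ hy b q.1 q.2
  simp_rw [h5]
  rw [tsum_mul_left, ← h3, h4]
  congr 1
  refine tsum_congr fun p => ?_
  rw [modKernel, jacobiTheta₂, ← tsum_mul_left, ← tsum_mul_left]
  rfl

end

/-! ### Modularity in z of the dual kernel and of the generating series -/

/-- The action of a rotation on the parameters of the generating function. -/
def rotParam (ε : ℂ) (b : Fin 3 → ℂ) : Fin 3 → ℂ := ![ε * b 0, ε * b 1, ε⁻¹ * b 2]

/-- The algebra behind `modKernel_smul`, with q = cz + d, qb its conjugate, r = |q|, and J the value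
of j + sz at the new row. The last summand on the left is the elliptic factor of the theta law; it
absorbs the change from s to s' and the rotation of b₁. -/
theorem modular_exponent_eq {q qb r v ρ J Jb s s' c x y' b0 b1 b2 : ℂ} (hq : q ≠ 0)
    (hqb : qb ≠ 0) (hr : r ≠ 0) (hv : v ≠ 0) (hrr : r ^ 2 = q * qb) (hρ : ρ ^ 2 = 8 * π * v)
    (hqv : q - qb = 2 * I * c * v)
    (hJ : s' * q = s + c * J) (hs2 : s * J - s' * q * J = -c * J ^ 2) :
    -π * y' ^ 2 / (4 * (v / r ^ 2)) * (J / q * (Jb / qb))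
      - I * (ρ / r) * y' / (4 * (v / r ^ 2)) * (b0 * (Jb / qb) + b2 * (J / q))
      + b0 * b2 - b1 ^ 2 / 2 + π * I * x ^ 2 * s * (J / q) / 2 - ρ / r * b1 * x * s / 2
      + π * I * (c * (-x * J + ρ * (q / r * b1) / (2 * π * I)) ^ 2 / (2 * q)) =
    -π * y' ^ 2 / (4 * v) * (J * Jb)
      - I * ρ * y' / (4 * v) * (q / r * b0 * Jb + (q / r)⁻¹ * b2 * J)
      + q / r * b0 * ((q / r)⁻¹ * b2) - (q / r * b1) ^ 2 / 2 + π * I * x ^ 2 * s' * J / 2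
      - ρ * (q / r * b1) * x * s' / 2 := by
  have hpi : (π : ℂ) ≠ 0 := by exact_mod_cast Real.pi_ne_zero
  have hI := I_ne_zero
  have e1 : -π * y' ^ 2 / (4 * (v / r ^ 2)) * (J / q * (Jb / qb)) =
      -π * y' ^ 2 / (4 * v) * (J * Jb) := by
    rw [hrr]; field_simp
  have e2 : I * (ρ / r) * y' / (4 * (v / r ^ 2)) * (b0 * (Jb / qb) + b2 * (J / q)) =
      I * ρ * y' / (4 * v) * (q / r * b0 * Jb + (q / r)⁻¹ * b2 * J) := by
    field_simp
    linear_combination (ρ * y' * b0 * Jb * q) * hrr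
  have e3 : q / r * b0 * ((q / r)⁻¹ * b2) = b0 * b2 := by field_simp
  have e4 : π * I * (c * (-x * J + ρ * (q / r * b1) / (2 * π * I)) ^ 2 / (2 * q)) =
      π * I * x ^ 2 * c * J ^ 2 / (2 * q) - c * x * J * ρ * b1 / (2 * r) +
        c * v * q * b1 ^ 2 / (I * r ^ 2) := by
    field_simp
    ring_nf
    rw [hρ]
    ring_nf
  rw [e1, e2, e3, e4]
  have e5 : π * I * x ^ 2 * s * (J / q) / 2 + π * I * x ^ 2 * c * J ^ 2 / (2 * q) =
      π * I * x ^ 2 * s' * J / 2 := by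
    field_simp
    linear_combination x ^ 2 * hs2
  have e6 : - (ρ / r * b1 * x * s / 2) - c * x * J * ρ * b1 / (2 * r) =
      - (ρ * (q / r * b1) * x * s' / 2) := by
    field_simp
    linear_combination (ρ * b1 * x) * hJ
  have e7 : - (b1 ^ 2 / 2) + c * v * q * b1 ^ 2 / (I * r ^ 2) = - ((q / r * b1) ^ 2 / 2) := by
    field_simp
    rw [hrr]
    linear_combination (b1 ^ 2 * q * I) * hqv + 2 * b1 ^ 2 * q * c * v * I_sq
  linear_combination e5 + e6 + e7

theorem im_moebius_eq {a b c d : ℤ} (hdet : a * d - b * c = 1) (z : ℂ) :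
    (((a : ℂ) * z + b) / (c * z + d)).im = z.im / ‖(c : ℂ) * z + d‖ ^ 2 := by
  rw [div_im, ← normSq_eq_norm_sq, ← sub_div]
  congr 1
  have hdet' : (a : ℝ) * d - b * c = 1 := by exact_mod_cast hdet
  simp
  linear_combination z.im * hdet'

/-- One has j + s·γz = J/(cz + d), where J belongs to the row (s, j)γ. The modulus of cz + d is
absorbed by Im γz = Im z/|cz + d|², its phase goes into b, and the theta law supplies the
multiplier. -/
theorem modKernel_smul {a b c d : ℤ} (hdet : a * d - b * c = 1) (hc : 4 ∣ c) (ξ y : ℝ)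
    (t : Fin 3 → ℂ) (s j : ℤ) {z : ℂ} (hz : 0 < z.im) :
    modKernel ξ y t s j ((a * z + b) / (c * z + d)) = thetaMult c d z *
      modKernel ξ y (rotParam ((c * z + d) / ‖(c : ℂ) * z + d‖) t) (s * a + j * c) (s * b + j * d)
        z := by
  have hq : (c : ℂ) * z + d ≠ 0 := linear_ne_zero_of_im_pos (row_ne_zero hdet) hz
  have hr : ‖(c : ℂ) * z + d‖ ≠ 0 := norm_ne_zero_iff.2 hq
  have hrc : (‖(c : ℂ) * z + d‖ : ℂ) ≠ 0 := by exact_mod_cast hr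
  have hrp : 0 < ‖(c : ℂ) * z + d‖ := norm_pos_iff.2 hq
  have hqb : (c : ℂ) * starRingEnd ℂ z + d ≠ 0 := by
    have := (map_ne_zero (starRingEnd ℂ)).2 hq
    simpa using this
  have hdetc : (a : ℂ) * d - b * c = 1 := by exact_mod_cast hdet
  have hpi : (π : ℂ) ≠ 0 := by exact_mod_cast Real.pi_ne_zero
  have hvc : (z.im : ℂ) ≠ 0 := by exact_mod_cast hz.ne'
  have hrr : (‖(c : ℂ) * z + d‖ : ℂ) ^ 2 = (c * z + d) * (c * starRingEnd ℂ z + d) := by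
    rw [← mul_conj']
    simp
  have him := im_moebius_eq hdet z
  have hρ : √(8 * π * (z.im / ‖(c : ℂ) * z + d‖ ^ 2)) = √(8 * π * z.im) / ‖(c : ℂ) * z + d‖ := by
    rw [← mul_div_assoc, Real.sqrt_div' _ (by positivity), Real.sqrt_sq hrp.le]
  have hρ2 : ((√(8 * π * z.im) : ℝ) : ℂ) ^ 2 = 8 * π * z.im := by
    have := Real.pi_pos
    rw [← ofReal_pow, Real.sq_sqrt (by positivity)]
    push_cast
    rfl
  have hqv : ((c : ℂ) * z + d) - (c * starRingEnd ℂ z + d) = 2 * I * c * z.im := by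
    have := sub_conj z
    push_cast at this
    linear_combination c * this
  have hJ : (j : ℂ) + s * ((a * z + b) / (c * z + d)) =
      ((s * b + j * d : ℤ) + (s * a + j * c : ℤ) * z) / (c * z + d) := by
    rw [eq_div_iff hq, add_mul, mul_assoc, div_mul_cancel₀ _ hq]
    push_cast
    ring
  have hJb : (j : ℂ) + s * starRingEnd ℂ ((a * z + b) / (c * z + d)) =
      ((s * b + j * d : ℤ) + (s * a + j * c : ℤ) * starRingEnd ℂ z) /
        (c * starRingEnd ℂ z + d) := by
    have := congrArg (starRingEnd ℂ) hJ
    simpa using this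
  have hlaw := thetaLaw_of_four_dvd hdet hc z
    (modArg ξ (rotParam ((c * z + d) / ‖(c : ℂ) * z + d‖) t) (s * a + j * c) (s * b + j * d) z) hz
  have harg : modArg ξ t s j ((a * z + b) / (c * z + d)) =
      modArg ξ (rotParam ((c * z + d) / ‖(c : ℂ) * z + d‖) t) (s * a + j * c) (s * b + j * d) z /
        (c * z + d) := by
    rw [modArg, modArg, him, hρ, hJ]
    simp only [rotParam, Matrix.cons_val_one, Matrix.cons_val_zero]
    push_cast
    field_simp
  have hexp : cexp (modExp ξ y t s j ((a * z + b) / (c * z + d))) *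
      cexp (π * I * (c * modArg ξ (rotParam ((c * z + d) / ‖(c : ℂ) * z + d‖) t)
        (s * a + j * c) (s * b + j * d) z ^ 2 / (2 * (c * z + d)))) =
      cexp (modExp ξ y (rotParam ((c * z + d) / ‖(c : ℂ) * z + d‖) t) (s * a + j * c)
        (s * b + j * d) z) := by
    rw [← Complex.exp_add]
    congr 1
    rw [modExp, modExp, modArg, him, hρ, hJ, hJb]
    simp only [rotParam, Matrix.cons_val_one, Matrix.cons_val_zero, Matrix.cons_val]
    rw [ofReal_div, ofReal_div, ofReal_pow]
    refine modular_exponent_eq hq hqb hrc hvc hrr hρ2 hqv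
      (s := s) (s' := (s * a + j * c : ℤ)) ?_ ?_
    · push_cast
      linear_combination (s : ℂ) * hdetc
    · push_cast
      linear_combination (-(s : ℂ) * (s * b + j * d + (s * a + j * c) * z)) * hdetc
  rw [modKernel, modKernel, harg, hlaw, ← hexp]
  ring

section

/-- The automorphism of `ℤ × ℤ` given by an integral matrix of determinant one. -/
def rowEquiv {a b c d : ℤ} (h : a * d - b * c = 1) : ℤ × ℤ ≃ ℤ × ℤ where
  toFun p := (a * p.1 + c * p.2, b * p.1 + d * p.2)
  invFun p := (d * p.1 - c * p.2, a * p.2 - b * p.1)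
  left_inv p := by
    ext
    · simp only
      linear_combination p.1 * h
    · simp only
      linear_combination p.2 * h
  right_inv p := by
    ext
    · simp only
      linear_combination p.1 * h
    · simp only
      linear_combination p.2 * h

variable {N : ℕ} [NeZero N] (χ : DirichletCharacter ℂ (4 * N)) (l : ℤ)

/-- Modulo 4N the new entry is dj, and |χ₁(d)| = 1 makes the conjugate of χ₁(d) its inverse. -/
theorem conj_chiOne_eq {N : ℕ} (χ : DirichletCharacter ℂ (4 * N)) (l : ℤ) {d : ℤ} (hd : IsCoprime d (4 * N)) (b i j : ℤ) :
    starRingEnd ℂ (chiOne χ l (-j)) =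
      chiOne χ l d * starRingEnd ℂ (chiOne χ l (-(4 * N * b * i + d * j))) := by
  have h1 : -(4 * N * b * i + d * j) = d * -j + 4 * N * (-(b * i)) := by ring
  rw [h1, chiOne_add_mul, chiOne_mul, map_mul, ← mul_assoc, mul_conj, normSq_eq_norm_sq,
    norm_chiOne_of_isCoprime χ l hd]
  simp

theorem tsum_genTerm_moebius {a b c d : ℤ} (hdet : a * d - b * c = 1) (hc : (4 * N : ℤ) ∣ c)
    {z : ℂ} (hz : 0 < z.im) (ξ : ℝ) {y : ℝ} (hy : 0 < y) (t : Fin 3 → ℂ) :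
    ∑' n : Fin 3 → ℤ, chiCheck χ l (n 0) * genTerm N ((a * z + b) / (c * z + d)) ξ y t n =
      chiOne χ l d * thetaMult c d z * ‖(c : ℂ) * z + d‖ *
        ∑' n : Fin 3 → ℤ, chiCheck χ l (n 0) *
          genTerm N z ξ y (rotParam ((c * z + d) / ‖(c : ℂ) * z + d‖) t) n := by
  have hq : (c : ℂ) * z + d ≠ 0 := linear_ne_zero_of_im_pos (row_ne_zero hdet) hz
  have hrp : 0 < ‖(c : ℂ) * z + d‖ := norm_pos_iff.2 hq
  have him := im_moebius_eq hdet z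
  have hz' : 0 < (((a : ℂ) * z + b) / (c * z + d)).im := by
    rw [him]
    positivity
  have hs : √((((a : ℂ) * z + b) / (c * z + d)).im / (2 * N * y) ^ 2) =
      √(z.im / (2 * N * y) ^ 2) / ‖(c : ℂ) * z + d‖ := by
    rw [him, div_right_comm, Real.sqrt_div' _ (by positivity), Real.sqrt_sq hrp.le]
  have hd : IsCoprime d (4 * N) := by
    obtain ⟨k, rfl⟩ := hc
    exact ⟨a, -(b * k), by linear_combination hdet⟩
  rw [tsum_genTerm_eq χ l hz' ξ hy, tsum_genTerm_eq χ l hz ξ hy, hs]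
  obtain ⟨k, rfl⟩ := hc
  have hdet' : a * d - (4 * N * b) * k = 1 := by linear_combination hdet
  -- With c = 4Nk, the action of γ on rows (4Np₁, p₂) becomes that of the matrix with rows (a, 4Nb),
  -- (k, d) on (p₁, p₂). It is integral because 4N divides c.
  rw [← (rowEquiv hdet').tsum_eq (fun p : ℤ × ℤ => starRingEnd ℂ (chiOne χ l (-p.2)) *
    modKernel ξ y (rotParam _ t) (4 * N * p.1) p.2 z)]
  have key : ∀ p : ℤ × ℤ, starRingEnd ℂ (chiOne χ l (-p.2)) *
      modKernel ξ y t (4 * N * p.1) p.2 ((a * z + b) / ((4 * N * k : ℤ) * z + d)) =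
      chiOne χ l d * thetaMult (4 * N * k) d z *
      (starRingEnd ℂ (chiOne χ l (-(rowEquiv hdet' p).2)) *
        modKernel ξ y (rotParam (((4 * N * k : ℤ) * z + d) / ‖((4 * N * k : ℤ) : ℂ) * z + d‖) t)
          (4 * N * (rowEquiv hdet' p).1) (rowEquiv hdet' p).2 z) := by
    intro p
    rw [modKernel_smul hdet (by exact ⟨N * k, by ring⟩) ξ y t _ _ hz,
      conj_chiOne_eq χ l hd b p.1 p.2]
    have e1 : 4 * (N : ℤ) * p.1 * a + p.2 * (4 * N * k) = 4 * N * (rowEquiv hdet' p).1 := by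
      simp only [rowEquiv, Equiv.coe_fn_mk]
      ring
    have e2 : 4 * (N : ℤ) * p.1 * b + p.2 * d = (rowEquiv hdet' p).2 := by
      simp only [rowEquiv, Equiv.coe_fn_mk]
      ring
    have e3 : 4 * (N : ℤ) * b * p.1 + d * p.2 = (rowEquiv hdet' p).2 := rfl
    rw [e1, e2, e3]
    ring
  rw [tsum_congr key, tsum_mul_left]
  push_cast
  rw [inv_div]
  ring

end

section

/-! ### Extraction of the kernel functions from the generating function -/

open MeasureTheory in
/-- Lebesgue measure on one period. -/
def circleMeasure : Measure ℝ := volume.restrict (Set.Ioc 0 (2 * π))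

instance : MeasureTheory.IsFiniteMeasure circleMeasure := by
  unfold circleMeasure
  infer_instance

/-- Cauchy's formula on the unit circle for z ↦ g(εz); the n-th Taylor coefficient acquires the
factor ε^n. -/
theorem integral_circle_coeff {g : ℂ → ℂ} (hg : Differentiable ℂ g) (n : ℕ) (ε : ℂ) :
    ∫ θ, cexp (-(n * θ * I)) * g (ε * cexp (θ * I)) ∂circleMeasure =
      2 * π / n.factorial * ε ^ n * iteratedDeriv n g 0 := by
  have hg' : Differentiable ℂ fun z => g (ε * z) := hg.comp (by fun_prop)
  have h := hg'.differentiableOn.circleIntegral_one_div_sub_center_pow_smul (c := 0) one_pos n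
  rw [iteratedDeriv_comp_const_mul hg.contDiff, circleIntegral,
    intervalIntegral.integral_of_le (by positivity)] at h
  have h2 : ∀ θ : ℝ, deriv (circleMap 0 1) θ • (1 / (circleMap 0 1 θ - 0) ^ (n + 1)) •
      g (ε * circleMap 0 1 θ) = I * (cexp (-(n * θ * I)) * g (ε * cexp (θ * I))) := by
    intro θ
    have : cexp (θ * I) ≠ 0 := Complex.exp_ne_zero _
    rw [deriv_circleMap, circleMap_zero, Complex.exp_neg, mul_assoc (n : ℂ), Complex.exp_nat_mul]
    simp only [smul_eq_mul, ofReal_one, one_mul, sub_zero, pow_succ]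
    field_simp
  simp only [h2] at h
  rw [MeasureTheory.integral_const_mul] at h
  have hI := I_ne_zero
  rw [circleMeasure]
  apply mul_left_cancel₀ hI
  rw [h]
  simp
  ring

/-- Differentiating once more reproduces the recursion H_{n+1} = xH_n - H_n' at x = P - z. At z = 0
the Taylor coefficients of the generating function are the Hermite polynomials up to factorials. -/
theorem iteratedDeriv_hermite_generating (P : ℂ) (n : ℕ) :
    iteratedDeriv n (fun z : ℂ => cexp (z * P - z ^ 2 / 2)) =
      fun z => Polynomial.aeval (P - z) (Polynomial.hermite n) * cexp (z * P - z ^ 2 / 2) := by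
  induction n with
  | zero => simp
  | succ n ih =>
    rw [iteratedDeriv_succ, ih]
    funext z
    have h1 : HasDerivAt (fun z : ℂ => Polynomial.aeval (P - z) (Polynomial.hermite n))
        (Polynomial.aeval (P - z) (Polynomial.derivative (Polynomial.hermite n)) * (-1)) z :=
      (Polynomial.hasDerivAt_aeval _ _).comp z ((hasDerivAt_id z).const_sub P)
    have h2 : HasDerivAt (fun z : ℂ => cexp (z * P - z ^ 2 / 2))
        (cexp (z * P - z ^ 2 / 2) * (P - z)) z := by
      refine (((hasDerivAt_id' z).mul_const P).sub
        ((hasDerivAt_pow 2 z).div_const 2)).cexp.congr_deriv ?_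
      simp
    refine (h1.mul h2).deriv.trans ?_
    rw [Polynomial.hermite_succ]
    simp only [map_sub, map_mul, Polynomial.aeval_X]
    ring

theorem aeval_ofReal (p : Polynomial ℤ) (x : ℝ) :
    Polynomial.aeval (x : ℂ) p = ((Polynomial.aeval x p : ℝ) : ℂ) :=
  Polynomial.aeval_algebraMap_apply ℂ x p

theorem integral_circle_hermite (P : ℝ) (n : ℕ) (ε : ℂ) :
    ∫ θ, cexp (-(n * θ * I)) *
      cexp (ε * cexp (θ * I) * P - (ε * cexp (θ * I)) ^ 2 / 2) ∂circleMeasure =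
      2 * π / n.factorial * ε ^ n * (hermiteH n P : ℂ) := by
  have h := integral_circle_coeff (g := fun z : ℂ => cexp (z * P - z ^ 2 / 2)) (by fun_prop) n ε
  rw [iteratedDeriv_hermite_generating] at h
  simpa [hermiteH, aeval_ofReal] using h

theorem integral_circle_pow (P : ℂ) (n : ℕ) (ε : ℂ) :
    ∫ θ, cexp (-(n * θ * I)) * cexp (P * (ε * cexp (θ * I))) ∂circleMeasure =
      2 * π / n.factorial * ε ^ n * P ^ n := by
  have h := integral_circle_coeff (g := fun z : ℂ => cexp (P * z)) (by fun_prop) n ε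
  simpa [iteratedDeriv_comp_const_mul Complex.contDiff_exp, iteratedDeriv_eq_iterate,
    Complex.iter_deriv_exp] using h

theorem kappa_inv_apply (φ : ℝ) : (kappa φ)⁻¹ = kappa (-φ) := by
  ext i j
  rw [Matrix.SpecialLinearGroup.SL2_inv_expl]
  fin_cases i <;> fin_cases j <;> simp [kappa]

theorem toSO_inv_coe (g : SL(2, ℝ)) : ((toSO g)⁻¹ : SL(3, ℝ)).1 = symMatrix g⁻¹ := by
  rw [← map_inv, toSO_coe]

theorem kappa_inv_mulVec (φ : ℝ) (x : Fin 3 → ℝ) :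
    ((toSO (kappa φ))⁻¹ : SL(3, ℝ)).1 *ᵥ x =
      ![Real.cos φ ^ 2 * x 0 - Real.cos φ * Real.sin φ * x 1 + Real.sin φ ^ 2 * x 2,
        2 * Real.cos φ * Real.sin φ * x 0 + (Real.cos φ ^ 2 - Real.sin φ ^ 2) * x 1 -
          2 * Real.cos φ * Real.sin φ * x 2,
        Real.sin φ ^ 2 * x 0 + Real.cos φ * Real.sin φ * x 1 + Real.cos φ ^ 2 * x 2] := by
  rw [toSO_inv_coe, kappa_inv_apply]
  ext i
  fin_cases i <;> simp [symMatrix, kappa, Matrix.mulVec, dotProduct, Fin.sum_univ_succ] <;> ring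

theorem gauss_eq (N : ℕ) (x : Fin 3 → ℝ) :
    gauss N x = Real.exp (-2 * π / N * ((x 0 - x 2) ^ 2 + x 1 ^ 2 + (x 0 + x 2) ^ 2)) := by
  rw [gauss]
  congr 1
  ring

section Rotation

variable (N : ℕ) (φ : ℝ) (x : Fin 3 → ℝ)

theorem kappa_inv_sub : (((toSO (kappa φ))⁻¹ : SL(3, ℝ)).1 *ᵥ x) 0 -
    (((toSO (kappa φ))⁻¹ : SL(3, ℝ)).1 *ᵥ x) 2 =
      Real.cos (2 * φ) * (x 0 - x 2) - Real.sin (2 * φ) * x 1 := by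
  rw [kappa_inv_mulVec, Real.cos_two_mul', Real.sin_two_mul]
  simp
  ring

theorem kappa_inv_one : (((toSO (kappa φ))⁻¹ : SL(3, ℝ)).1 *ᵥ x) 1 =
      Real.sin (2 * φ) * (x 0 - x 2) + Real.cos (2 * φ) * x 1 := by
  rw [kappa_inv_mulVec, Real.cos_two_mul', Real.sin_two_mul]
  simp
  ring

theorem kappa_inv_add : (((toSO (kappa φ))⁻¹ : SL(3, ℝ)).1 *ᵥ x) 0 +
    (((toSO (kappa φ))⁻¹ : SL(3, ℝ)).1 *ᵥ x) 2 = x 0 + x 2 := by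
  rw [kappa_inv_mulVec]
  simp
  linear_combination (x 0 + x 2) * Real.sin_sq_add_cos_sq φ

theorem gauss_kappa : gauss N (((toSO (kappa φ))⁻¹ : SL(3, ℝ)).1 *ᵥ x) = gauss N x := by
  rw [gauss_eq, gauss_eq, kappa_inv_sub, kappa_inv_one, kappa_inv_add]
  congr 2
  linear_combination ((x 0 - x 2) ^ 2 + x 1 ^ 2) * Real.sin_sq_add_cos_sq (2 * φ)

/-- The action of `κ(φ)` on the parameters of the generating function. -/
def rotVec (b : Fin 3 → ℂ) : Fin 3 → ℂ :=
  ![Real.cos (2 * φ) * b 0 + Real.sin (2 * φ) * b 1,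
    -Real.sin (2 * φ) * b 0 + Real.cos (2 * φ) * b 1, b 2]

/-- κ(φ) turns the plane of (x₁ - x₃, x₂) through 2φ and fixes x₁ + x₃. Since b is paired linearly
with these coordinates, the inverse rotation moves to b, and b₀² + b₁² is unchanged. -/
theorem genFn_kappa (b : Fin 3 → ℂ) :
    genFn N b (((toSO (kappa φ))⁻¹ : SL(3, ℝ)).1 *ᵥ x) = genFn N (rotVec φ b) x := by
  rw [genFn, genFn, gauss_kappa, kappa_inv_sub, kappa_inv_one, kappa_inv_add, rotVec]
  congr 2
  have h : (Real.sin (2 * φ) : ℂ) ^ 2 + (Real.cos (2 * φ) : ℂ) ^ 2 = 1 := by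
    exact_mod_cast Real.sin_sq_add_cos_sq (2 * φ)
  simp only [Matrix.cons_val_one, Matrix.cons_val_zero, Matrix.cons_val]
  push_cast at h ⊢
  linear_combination (b 0 ^ 2 + b 1 ^ 2) / 2 * h

theorem rotParam_rotVec (ε : ℂ) (b : Fin 3 → ℂ) :
    rotParam ε (rotVec φ b) = rotVec φ (rotParam ε b) := by
  ext i
  fin_cases i <;> simp [rotParam, rotVec] <;> ring

end Rotation

end

/-! ### Kernel functions as averages of generating functions -/

section

open MeasureTheory

theorem integrable_of_continuous_of_bound {X : Type*} [MeasurableSpace X] [TopologicalSpace X]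
    [OpensMeasurableSpace X] {μ : Measure X} [IsFiniteMeasure μ] {g : X → ℂ} (hg : Continuous g)
    {C : ℝ} (hC : ∀ τ, ‖g τ‖ ≤ C) : Integrable g μ :=
  Integrable.of_bound hg.aestronglyMeasurable C (ae_of_all _ hC)

@[fun_prop]
theorem continuous_genFn {X : Type*} [TopologicalSpace X] (N : ℕ) {b : X → Fin 3 → ℂ}
    (hb : Continuous b) (x : Fin 3 → ℝ) : Continuous fun τ => genFn N (b τ) x := by
  unfold genFn
  fun_prop

@[fun_prop]
theorem continuous_rotParam (ε : ℂ) : Continuous (rotParam ε) := by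
  unfold rotParam
  refine continuous_pi fun i => ?_
  fin_cases i <;> simp <;> fun_prop

theorem rotParam_one (b : Fin 3 → ℂ) : rotParam 1 b = b := by
  ext i
  fin_cases i <;> simp [rotParam]

theorem norm_rotParam_le {ε : ℂ} (hε : ‖ε‖ = 1) {b : Fin 3 → ℂ} {R : ℝ} (hb : ∀ i, ‖b i‖ ≤ R)
    (i : Fin 3) : ‖rotParam ε b i‖ ≤ R := by
  have := hb i
  fin_cases i <;> simpa [rotParam, hε] using this

/-- The point of the torus with the given arguments. -/
def torusPoint (t : ℝ × ℝ × ℝ) : Fin 3 → ℂ :=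
  ![cexp (t.1 * I), cexp (t.2.1 * I), cexp (t.2.2 * I)]

/-- Three independent Cauchy integrals. Each positive direction contributes powers of ε and the
negative one powers of ε⁻¹, which is the source of the weight ν₁ + ν₂ - μ. -/
theorem integral_torus (N ν₁ ν₂ μ : ℕ) {ε : ℂ} (x : Fin 3 → ℝ) :
    ∫ t : ℝ × ℝ × ℝ, cexp (-(ν₁ * t.1 * I)) * cexp (-(ν₂ * t.2.1 * I)) * cexp (-(μ * t.2.2 * I)) *
      genFn N (rotParam ε (torusPoint t)) x
      ∂(circleMeasure.prod (circleMeasure.prod circleMeasure)) =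
    (2 * π) ^ 3 / (ν₁.factorial * ν₂.factorial * μ.factorial) *
      (ε ^ ν₁ * ε ^ ν₂ * ε⁻¹ ^ μ) * ((polyL N ν₁ ν₂ x : ℂ) *
        (hermiteH μ (√(8 * π / N) * (x 0 + x 2)) : ℂ) * (gauss N x : ℂ)) := by
  have h : ∀ t : ℝ × ℝ × ℝ,
      cexp (-(ν₁ * t.1 * I)) * cexp (-(ν₂ * t.2.1 * I)) * cexp (-(μ * t.2.2 * I)) *
        genFn N (rotParam ε (torusPoint t)) x =
      (cexp (-(ν₁ * t.1 * I)) * cexp (ε * cexp (t.1 * I) * (√(8 * π / N) * (x 0 - x 2) : ℝ) -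
          (ε * cexp (t.1 * I)) ^ 2 / 2)) *
      ((cexp (-(ν₂ * t.2.1 * I)) * cexp (ε * cexp (t.2.1 * I) * (√(8 * π / N) * x 1 : ℝ) -
          (ε * cexp (t.2.1 * I)) ^ 2 / 2)) *
      (cexp (-(μ * t.2.2 * I)) * cexp (ε⁻¹ * cexp (t.2.2 * I) * (√(8 * π / N) * (x 0 + x 2) : ℝ) -
          (ε⁻¹ * cexp (t.2.2 * I)) ^ 2 / 2))) * gauss N x := by
    intro t
    rw [genFn, ← mul_assoc]
    congr 1
    simp only [← Complex.exp_add]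
    congr 1
    simp only [rotParam, torusPoint, Matrix.cons_val_one, Matrix.cons_val_zero, Matrix.cons_val]
    ring
  simp only [h]
  rw [integral_mul_const, integral_prod_mul
    (f := fun t : ℝ => cexp (-(ν₁ * t * I)) *
      cexp (ε * cexp (t * I) * (√(8 * π / N) * (x 0 - x 2) : ℝ) - (ε * cexp (t * I)) ^ 2 / 2))
    (g := fun t : ℝ × ℝ =>
      (cexp (-(ν₂ * t.1 * I)) * cexp (ε * cexp (t.1 * I) * (√(8 * π / N) * x 1 : ℝ) -
          (ε * cexp (t.1 * I)) ^ 2 / 2)) *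
      (cexp (-(μ * t.2 * I)) * cexp (ε⁻¹ * cexp (t.2 * I) * (√(8 * π / N) * (x 0 + x 2) : ℝ) -
          (ε⁻¹ * cexp (t.2 * I)) ^ 2 / 2))), integral_prod_mul
    (f := fun t : ℝ => cexp (-(ν₂ * t * I)) * cexp (ε * cexp (t * I) * (√(8 * π / N) * x 1 : ℝ) -
          (ε * cexp (t * I)) ^ 2 / 2))
    (g := fun t : ℝ => cexp (-(μ * t * I)) *
      cexp (ε⁻¹ * cexp (t * I) * (√(8 * π / N) * (x 0 + x 2) : ℝ) -
          (ε⁻¹ * cexp (t * I)) ^ 2 / 2)), integral_circle_hermite, integral_circle_hermite,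
    integral_circle_hermite, polyL]
  push_cast
  ring

theorem norm_rotVec_le (φ : ℝ) {b : Fin 3 → ℂ} (hb : ∀ i, ‖b i‖ ≤ 1) (i : Fin 3) :
    ‖rotVec φ b i‖ ≤ 2 := by
  have hc : ‖(Real.cos (2 * φ) : ℂ)‖ ≤ 1 := by
    rw [norm_real]; exact Real.abs_cos_le_one _
  have hs : ‖(Real.sin (2 * φ) : ℂ)‖ ≤ 1 := by
    rw [norm_real]; exact Real.abs_sin_le_one _
  have h2 : (1 : ℝ) + 1 = 2 := by norm_num
  rw [← h2]
  fin_cases i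
  · refine (norm_add_le _ _).trans (add_le_add ?_ ?_)
    · rw [norm_mul]; exact mul_le_one₀ hc (norm_nonneg _) (hb 0)
    · rw [norm_mul]; exact mul_le_one₀ hs (norm_nonneg _) (hb 1)
  · refine (norm_add_le _ _).trans (add_le_add ?_ ?_)
    · rw [norm_mul, norm_neg]; exact mul_le_one₀ hs (norm_nonneg _) (hb 0)
    · rw [norm_mul]; exact mul_le_one₀ hc (norm_nonneg _) (hb 1)
  · exact (hb 2).trans (by norm_num)

theorem norm_torusPoint (t : ℝ × ℝ × ℝ) (i : Fin 3) : ‖torusPoint t i‖ ≤ 1 := by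
  fin_cases i <;> simp [torusPoint, norm_exp_ofReal_mul_I]

theorem continuous_torusPoint : Continuous torusPoint := by
  unfold torusPoint
  refine continuous_pi fun i => ?_
  fin_cases i <;> simp <;> fun_prop

theorem continuous_rotVec_torusPoint :
    Continuous fun τ : ℝ × ℝ × ℝ × ℝ => rotVec τ.1 (torusPoint τ.2) := by
  have h := continuous_torusPoint
  unfold rotVec
  refine continuous_pi fun i => ?_
  fin_cases i <;> simp <;> fun_prop

/-- A function all of whose rotated generating functions can be integrated to it: it is an
average of members of the family `genFn`, of degree `l` under `rotParam`. -/
def IsGenAverage (N : ℕ) (l : ℤ) (f : (Fin 3 → ℝ) → ℂ) : Prop :=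
  ∃ (X : Type) (_ : MeasurableSpace X) (_ : TopologicalSpace X) (_ : OpensMeasurableSpace X)
    (μ : Measure X) (_ : IsFiniteMeasure μ) (w : X → ℂ) (b : X → Fin 3 → ℂ) (W : ℝ),
    Continuous w ∧ Continuous b ∧ (∀ τ, ‖w τ‖ ≤ W) ∧ (∀ τ i, ‖b τ i‖ ≤ 2) ∧
    ∀ ε : ℂ, ‖ε‖ = 1 → ∀ x, ∫ τ, w τ * genFn N (rotParam ε (b τ)) x ∂μ = ε ^ l * f x

/-- Three torus angles extract the Hermite functions and a fourth angle φ performs the average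
defining `polyLm`. The last rotates the pair (b₀, b₁), which ε scales by a single factor, so the two
actions commute. -/
theorem isGenAverage_schwartzFn (N : ℕ) {l : ℤ} (m : ℤ) {ν₁ ν₂ μ : ℕ} (h : (ν₁ : ℤ) + ν₂ - μ = l) :
    IsGenAverage N l (schwartzFn N m ν₁ ν₂ μ) := by
  -- Cancels (2π)³/(ν₁!ν₂!μ!) from the Cauchy integrals and keeps the 1/2π of `polyLm`.
  let C : ℂ := 1 / (2 * π) * ((ν₁.factorial * ν₂.factorial * μ.factorial) / (2 * π) ^ 3)
  let w : ℝ × ℝ × ℝ × ℝ → ℂ := fun τ => C * cexp (2 * m * I * τ.1) *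
    (cexp (-(ν₁ * τ.2.1 * I)) * cexp (-(ν₂ * τ.2.2.1 * I)) * cexp (-(μ * τ.2.2.2 * I)))
  have hw : Continuous w := by fun_prop
  have hwn : ∀ τ, ‖w τ‖ ≤ ‖C‖ := by
    intro τ
    have e : ∀ (k : ℕ) (t : ℝ), ‖cexp (-(k * t * I))‖ = 1 := fun k t => by
      rw [show -((k : ℂ) * t * I) = (-(k * t) : ℝ) * I by push_cast; ring, norm_exp_ofReal_mul_I]
    have e' : ‖cexp (2 * m * I * τ.1)‖ = 1 := by
      rw [show 2 * (m : ℂ) * I * τ.1 = (2 * m * τ.1 : ℝ) * I by push_cast; ring,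
        norm_exp_ofReal_mul_I]
    simp [w, e, e']
  have hb : ∀ (τ : ℝ × ℝ × ℝ × ℝ) (i : Fin 3), ‖rotVec τ.1 (torusPoint τ.2) i‖ ≤ 2 := fun τ =>
    norm_rotVec_le _ (norm_torusPoint _)
  refine ⟨ℝ × ℝ × ℝ × ℝ, inferInstance, inferInstance, inferInstance,
    circleMeasure.prod (circleMeasure.prod (circleMeasure.prod circleMeasure)), inferInstance, w,
    fun τ => rotVec τ.1 (torusPoint τ.2), ‖C‖, hw, continuous_rotVec_torusPoint, hwn, hb, ?_⟩
  intro ε hε x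
  have hε0 : ε ≠ 0 := by
    rintro rfl
    simp at hε
  have hint : Integrable (fun τ : ℝ × ℝ × ℝ × ℝ =>
      w τ * genFn N (rotParam ε (rotVec τ.1 (torusPoint τ.2))) x)
      (circleMeasure.prod (circleMeasure.prod (circleMeasure.prod circleMeasure))) := by
    have hc := continuous_rotVec_torusPoint
    refine integrable_of_continuous_of_bound
      (C := ‖C‖ * (Real.exp (15 * 2 ^ 2 / 2) * Real.exp (-(π / N) * gaussForm x))) (hw.mul (continuous_genFn N ((continuous_rotParam ε).comp hc) x)) fun τ => ?_
    rw [norm_mul]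
    exact mul_le_mul (hwn τ) (norm_genFn_le N (norm_rotParam_le hε (hb τ)) x) (norm_nonneg _)
      (norm_nonneg _)
  rw [integral_prod _ hint]
  have inner : ∀ φ : ℝ, ∫ t : ℝ × ℝ × ℝ, w (φ, t) * genFn N (rotParam ε (rotVec φ (torusPoint t))) x
      ∂(circleMeasure.prod (circleMeasure.prod circleMeasure)) =
      (ε ^ l * (1 / (2 * π)) * ((hermiteH μ (√(8 * π / N) * (x 0 + x 2)) : ℂ) * (gauss N x : ℂ))) *
      (cexp (2 * m * I * φ) * (polyL N ν₁ ν₂ (((toSO (kappa φ))⁻¹ : SL(3, ℝ)).1 *ᵥ x) : ℂ)) := by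
    intro φ
    have h1 := integral_torus N ν₁ ν₂ μ (ε := ε) (((toSO (kappa φ))⁻¹ : SL(3, ℝ)).1 *ᵥ x)
    rw [kappa_inv_add, gauss_kappa] at h1
    have hfac : ((ν₁.factorial : ℂ) * ν₂.factorial * μ.factorial) ≠ 0 := by
      simp [Nat.factorial_ne_zero]
    have hpi : (2 * (π : ℂ)) ^ 3 ≠ 0 := by simp [Real.pi_ne_zero]
    have hl : ε ^ ν₁ * ε ^ ν₂ * ε⁻¹ ^ μ = ε ^ l := by
      rw [← h, zpow_sub₀ hε0, zpow_add₀ hε0]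
      simp
      rfl
    simp only [genFn_kappa] at h1
    simp only [w, mul_assoc (C * cexp (2 * m * I * φ)), rotParam_rotVec]
    rw [integral_const_mul, h1, hl]
    simp only [C]
    generalize (ν₁.factorial : ℂ) * ν₂.factorial * μ.factorial = F at hfac ⊢
    field_simp
  simp only [inner]
  rw [integral_const_mul, schwartzFn, polyLm, intervalIntegral.integral_of_le (by positivity),
    circleMeasure]
  ring

/-- The parameters (t, -it, 0) are isotropic, so the quadratic term disappears and the generating
function is exp of t times √(8π/N)(x₁ - ix₂ - x₃): its coefficients are pure powers instead of
Hermite functions. -/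
theorem isGenAverage_linear (N : ℕ) [NeZero N] (n : ℕ) :
    IsGenAverage N n (fun x => ((x 0 : ℂ) - I * x 1 - x 2) ^ n * (gauss N x : ℂ)) := by
  have hN : (0 : ℝ) < N := Nat.cast_pos.2 (NeZero.pos N)
  have hpi := Real.pi_pos
  have hpi' : (π : ℂ) ≠ 0 := by exact_mod_cast hpi.ne'
  have hK : ((√(8 * π / N) : ℝ) : ℂ) ≠ 0 := by
    exact_mod_cast (Real.sqrt_pos.2 (by positivity)).ne'
  let C : ℂ := n.factorial / (2 * π) / (√(8 * π / N) : ℝ) ^ n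
  refine ⟨ℝ, inferInstance, inferInstance, inferInstance, circleMeasure, inferInstance,
    fun θ => C * cexp (-(n * θ * I)), fun θ => ![cexp (θ * I), -I * cexp (θ * I), 0], ‖C‖,
    by fun_prop, ?_, ?_, ?_, ?_⟩
  · refine continuous_pi fun i => ?_
    fin_cases i <;> simp <;> fun_prop
  · intro θ
    dsimp only
    rw [show -((n : ℂ) * θ * I) = (-(n * θ) : ℝ) * I by push_cast; ring, norm_mul,
      norm_exp_ofReal_mul_I, mul_one]
  · intro θ i
    fin_cases i <;> simp [norm_exp_ofReal_mul_I]
  · intro ε hε x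
    have h := integral_circle_pow ((√(8 * π / N) : ℝ) * ((x 0 : ℂ) - I * x 1 - x 2)) n ε
    have e : ∀ θ : ℝ, C * cexp (-(n * θ * I)) *
        genFn N (rotParam ε ![cexp (θ * I), -I * cexp (θ * I), 0]) x =
        C * gauss N x * (cexp (-(n * θ * I)) *
          cexp ((√(8 * π / N) : ℝ) * ((x 0 : ℂ) - I * x 1 - x 2) * (ε * cexp (θ * I)))) := by
      intro θ
      have : genFn N (rotParam ε ![cexp (θ * I), -I * cexp (θ * I), 0]) x =
          cexp ((√(8 * π / N) : ℝ) * ((x 0 : ℂ) - I * x 1 - x 2) * (ε * cexp (θ * I))) *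
            gauss N x := by
        rw [genFn]
        congr 2
        simp only [rotParam, Matrix.cons_val_one, Matrix.cons_val_zero, Matrix.cons_val]
        push_cast
        linear_combination (-ε ^ 2 * cexp (θ * I) ^ 2 / 2) * I_sq
      rw [this]
      ring
    simp only [e]
    have hfac : (n.factorial : ℂ) ≠ 0 := by simp [Nat.factorial_ne_zero]
    rw [integral_const_mul, h, mul_pow, zpow_natCast]
    simp only [C]
    field_simp

theorem IsThetaKernelFn.isGenAverage {N : ℕ} [NeZero N] {l m : ℤ} {f : (Fin 3 → ℝ) → ℂ}
    (hf : IsThetaKernelFn N l m f) : IsGenAverage N l f := by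
  rcases hf with ⟨μ, ν₁, ν₂, h, -, rfl⟩ | ⟨n, rfl, -, rfl⟩
  · exact isGenAverage_schwartzFn N m h
  · exact isGenAverage_linear N n

end

/-! ### Averaging the series and its transformation law -/

section

open MeasureTheory

/-- The summand of the theta series of `f`, up to elementary factors. -/
def coreTerm {N : ℕ} (χ : DirichletCharacter ℂ (4 * N)) (l : ℤ) (f : (Fin 3 → ℝ) → ℂ) (z : ℂ)
    (ξ y : ℝ) (n : Fin 3 → ℤ) : ℂ :=
  chiCheck χ l (n 0) * (expo (z.re * (n 1 ^ 2 - n 0 * n 2)) * f (thetaPoint N z.im ξ y n))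

variable {N : ℕ} [NeZero N] (χ : DirichletCharacter ℂ (4 * N)) (l : ℤ)

/-- Interchange of sum and integral, justified by the Gaussian bound uniform in b, bounded weights
and finite measure. -/
theorem hasSum_integral_genTerm {X : Type} [MeasurableSpace X] [TopologicalSpace X]
    [OpensMeasurableSpace X] {μ : Measure X} [IsFiniteMeasure μ] {w : X → ℂ} {b : X → Fin 3 → ℂ}
    {W : ℝ} (hw : Continuous w) (hb : Continuous b) (hW : ∀ τ, ‖w τ‖ ≤ W)
    {R : ℝ} (hR : ∀ τ i, ‖b τ i‖ ≤ R) {z : ℂ} (hz : 0 < z.im) (ξ : ℝ) {y : ℝ} (hy : 0 < y) :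
    HasSum (fun n : Fin 3 → ℤ =>
      chiCheck χ l (n 0) * (expo (z.re * (n 1 ^ 2 - n 0 * n 2)) *
        ∫ τ, w τ * genFn N (b τ) (thetaPoint N z.im ξ y n) ∂μ))
      (∫ τ, w τ * ∑' n : Fin 3 → ℤ, chiCheck χ l (n 0) * genTerm N z ξ y (b τ) n ∂μ) := by
  obtain ⟨C, ε, hε, h⟩ := norm_genTerm_le N hz ξ hy R
  have hbound : ∀ n : Fin 3 → ℤ, ∀ τ,
      ‖w τ * (chiCheck χ l (n 0) * genTerm N z ξ y (b τ) n)‖ ≤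
        W * (4 * N * (C * Real.exp (-ε * ‖n‖ ^ 2))) := by
    intro n τ
    rw [norm_mul, norm_mul]
    have h1 := h (b τ) (hR τ) n
    have h2 := norm_chiCheck_le χ l (n 0)
    have h3 := hW τ
    have h4 : 0 ≤ W := (norm_nonneg _).trans h3
    gcongr
  have hcont : ∀ n : Fin 3 → ℤ, Continuous fun τ =>
      w τ * (chiCheck χ l (n 0) * genTerm N z ξ y (b τ) n) := by
    intro n
    unfold genTerm
    fun_prop
  have hint : ∀ n : Fin 3 → ℤ, Integrable (fun τ =>
      w τ * (chiCheck χ l (n 0) * genTerm N z ξ y (b τ) n)) μ := fun n =>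
    integrable_of_continuous_of_bound (hcont n) (hbound n)
  have hsum : Summable fun n : Fin 3 → ℤ => ∫ τ,
      ‖w τ * (chiCheck χ l (n 0) * genTerm N z ξ y (b τ) n)‖ ∂μ := by
    refine Summable.of_nonneg_of_le (fun n => integral_nonneg fun τ => norm_nonneg _)
      (fun n => ?_) (((summable_gaussian 0 hε 0).mul_left (W * (4 * N * C))).mul_left
        (μ.real Set.univ))
    refine (integral_mono (hint n).norm (integrable_const _) (hbound n)).trans (le_of_eq ?_)
    rw [integral_const, smul_eq_mul, pow_zero, one_mul, zero_mul, add_zero]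
    ring
  convert! hasSum_integral_of_summable_integral_norm hint hsum using 1
  · funext n
    rw [← integral_const_mul, ← integral_const_mul]
    refine integral_congr_ae (ae_of_all _ fun τ => ?_)
    simp only [genTerm]
    ring
  · refine integral_congr_ae (ae_of_all _ fun τ => ?_)
    simp only
    rw [tsum_mul_left]

variable {χ l} in
theorem IsGenAverage.summable_coreTerm {f : (Fin 3 → ℝ) → ℂ} (hf : IsGenAverage N l f) {z : ℂ}
    (hz : 0 < z.im) (ξ : ℝ) {y : ℝ} (hy : 0 < y) : Summable (coreTerm χ l f z ξ y) := by
  obtain ⟨X, _, _, _, μ, _, w, b, W, hw, hb, hW, hR, key⟩ := hf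
  have h := (hasSum_integral_genTerm χ l hw hb hW hR hz ξ hy (μ := μ)).summable
  have key1 := key 1 (by simp)
  simp only [rotParam_one, one_zpow, one_mul] at key1
  simp only [key1] at h
  exact h

/-- Apply the law of the generating series under the integral. The parameters come out rotated by ε
= (cz + d)/|cz + d|, and the rotated average is ε^l f. -/
theorem IsGenAverage.tsum_coreTerm_moebius {f : (Fin 3 → ℝ) → ℂ} (hf : IsGenAverage N l f)
    {a b c d : ℤ} (hdet : a * d - b * c = 1) (hc : (4 * N : ℤ) ∣ c)
    {z : ℂ} (hz : 0 < z.im) (ξ : ℝ) {y : ℝ} (hy : 0 < y) :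
    ∑' n, coreTerm χ l f ((a * z + b) / (c * z + d)) ξ y n =
      chiOne χ l d * thetaMult c d z * ‖(c : ℂ) * z + d‖ *
        ((c * z + d) / ‖(c : ℂ) * z + d‖) ^ l * ∑' n, coreTerm χ l f z ξ y n := by
  obtain ⟨X, _, _, _, μ, _, w, t, W, hw, ht, hW, hR, key⟩ := hf
  have hq : (c : ℂ) * z + d ≠ 0 := linear_ne_zero_of_im_pos (row_ne_zero hdet) hz
  have hrp : 0 < ‖(c : ℂ) * z + d‖ := norm_pos_iff.2 hq
  have hz' : 0 < (((a : ℂ) * z + b) / (c * z + d)).im := by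
    rw [im_moebius_eq hdet z]
    positivity
  have hε : ‖((c : ℂ) * z + d) / ‖(c : ℂ) * z + d‖‖ = 1 := by
    rw [norm_div, norm_real, norm_norm, div_self hrp.ne']
  have key1 := key 1 (by simp)
  have key2 := key _ hε
  simp only [rotParam_one, one_zpow, one_mul] at key1
  have h1 := (hasSum_integral_genTerm χ l hw ht hW hR hz' ξ hy (μ := μ)).tsum_eq
  have h2 := (hasSum_integral_genTerm χ l hw ((continuous_rotParam _).comp ht) hW
    (fun τ => norm_rotParam_le hε (hR τ)) hz ξ hy (μ := μ)).tsum_eq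
  simp only [Function.comp_apply, key1, key2] at h1 h2
  simp only [tsum_genTerm_moebius χ l hdet hc hz ξ hy] at h1
  simp only [coreTerm]
  rw [h1]
  simp only [mul_left_comm (w _)]
  rw [integral_const_mul, ← h2, mul_assoc _ ((_ / _) ^ l), ← tsum_mul_left (a := (_ / _) ^ l)]
  congr 1
  refine tsum_congr fun n => ?_
  ring

end

section

/-! ### The theta series in coordinates -/

theorem dilate_im (n : ℕ) [NeZero n] (z : ℍ) : (dilate n z).im = n * z.im :=
  UpperHalfPlane.pos_real_im _ _

theorem dilate_re (n : ℕ) [NeZero n] (z : ℍ) : (dilate n z).re = n * z.re :=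
  UpperHalfPlane.pos_real_re _ _

theorem innerQ_formQ (N : ℕ) (x : Fin 3 → ℝ) :
    innerQ (formQ N) x x = 2 / N * (x 1 ^ 2 - 4 * x 0 * x 2) := by
  simp [innerQ, formQ, Matrix.mulVec, dotProduct, Fin.sum_univ_succ]
  ring

theorem sigma_inv_mulVec (w : ℍ) (x : Fin 3 → ℝ) :
    ((toSO (sigma w))⁻¹ : SL(3, ℝ)).1 *ᵥ x =
      ![(x 0 - w.re * x 1 + w.re ^ 2 * x 2) / w.im, x 1 - 2 * w.re * x 2, w.im * x 2] := by
  have hw := w.im_pos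
  have hs : √w.im ≠ 0 := (Real.sqrt_pos.2 hw).ne'
  have hs2 : √w.im ^ 2 = w.im := Real.sq_sqrt hw.le
  rw [toSO_inv_coe]
  ext i
  rw [Matrix.SpecialLinearGroup.SL2_inv_expl]
  have hw' := hw.ne'
  fin_cases i <;> simp [symMatrix, sigma, Matrix.mulVec, dotProduct, Fin.sum_univ_succ, div_pow,
    hs2, hs] <;> (field_simp; ring_nf) <;> simp only [hs2] <;> ring

theorem thetaPoint_eq (N : ℕ) [NeZero N] (v : ℝ) (w : ℍ) (n : Fin 3 → ℤ) :
    ((toSO (sigma (dilate (2 * N) w)))⁻¹ : SL(3, ℝ)).1 *ᵥ (√(4 * N * v) • dualPoint n) =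
      thetaPoint N v w.re w.im n := by
  rw [sigma_inv_mulVec, dilate_im, dilate_re]
  ext i
  fin_cases i <;> simp [dualPoint, thetaPoint] <;> ring

variable {N : ℕ} [NeZero N] (χ : DirichletCharacter ℂ (4 * N)) (l : ℤ)

/-- σ is upper triangular, so only the explicit branch of the Weil representation occurs; |a|^{3/2}
with a = √(4Nv) gives the power 3/4. -/
theorem thetaTerm_eq (f : (Fin 3 → ℝ) → ℂ) (z w : ℍ) (n : Fin 3 → ℤ) :
    thetaTerm χ l f z w (dualPoint n) =
      (((4 * N * z.im) ^ (3 / 4 : ℝ) : ℝ) : ℂ) * coreTerm χ l f z w.re w.im n := by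
  have hN : (0 : ℝ) < N := Nat.cast_pos.2 (NeZero.pos N)
  have hv := z.im_pos
  have hs : (0 : ℝ) < 4 * N * z.im := by positivity
  have hs' : √(4 * N * z.im) ≠ 0 := (Real.sqrt_pos.2 hs).ne'
  have e0 : 4 * dualPoint n 0 = n 0 := by simp [dualPoint]; ring
  have e1 : (|√(4 * N * z.im)| ^ (((3 : ℕ) : ℝ) / 2) : ℝ) = (4 * N * z.im) ^ (3 / 4 : ℝ) := by
    rw [abs_of_nonneg (Real.sqrt_nonneg _), Real.sqrt_eq_rpow, ← Real.rpow_mul hs.le]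
    norm_num
  have e2 : √(4 * N * z.im) * (4 * N * z.re / √(4 * N * z.im)) / 2 *
      innerQ (formQ N) (dualPoint n) (dualPoint n) = z.re * (n 1 ^ 2 - n 0 * n 2) := by
    rw [innerQ_formQ]
    simp [dualPoint]
    field_simp
    ring
  have e3 := thetaPoint_eq N z.im w n
  have e4 : ((4 * N : ℕ) : ℝ) = 4 * N := by push_cast; ring
  rw [thetaTerm, weil, if_pos (by simp [sigma]), orthAct, coreTerm, e0]
  simp only [sigma, Matrix.of_apply, Matrix.cons_val_zero, Matrix.cons_val_one,
    Matrix.cons_val', Matrix.cons_val_fin_one, dilate_im (4 * N) z, dilate_re (4 * N) z, e4]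
  rw [sigma] at e3
  rw [e1, e2, e3]
  simp only [UpperHalfPlane.coe_re, UpperHalfPlane.coe_im]
  ring

theorem theta_eq (m : ℤ) (f : (Fin 3 → ℝ) → ℂ) (z w : ℍ) :
    theta χ l m f z w = ((32 * (N : ℝ) ^ 3) ^ (-(1 / 2) : ℝ) : ℝ) * I ^ l *
      (((4 * N) ^ (3 / 4 : ℝ) : ℝ) : ℂ) *
      ((z.im ^ ((1 - l : ℝ) / 2) : ℝ) : ℂ) * (((4 * w.im) ^ (-m) : ℝ) : ℂ) *
      ∑' n : Fin 3 → ℤ, coreTerm χ l f z w.re w.im n := by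
  have hN : (0 : ℝ) < N := Nat.cast_pos.2 (NeZero.pos N)
  have hv := z.im_pos
  -- The exponents of v combine as -(2l + 1)/4 + 3/4 = (1 - l)/2.
  have e : z.im ^ (-((2 * l + 1 : ℤ) : ℝ) / 4) * (4 * N * z.im) ^ (3 / 4 : ℝ) =
      (4 * N) ^ (3 / 4 : ℝ) * z.im ^ ((1 - l : ℝ) / 2) := by
    rw [Real.mul_rpow (by positivity) hv.le, mul_left_comm, ← Real.rpow_add hv]
    congr 2
    push_cast
    ring
  rw [theta]
  simp only [thetaTerm_eq]
  rw [tsum_mul_left]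
  have e' := congrArg (ofReal) e
  rw [ofReal_mul, ofReal_mul] at e'
  linear_combination ((((32 * (N : ℝ) ^ 3) ^ (-(1 / 2) : ℝ) : ℝ) : ℂ) * I ^ l *
    (((4 * w.im) ^ (-m) : ℝ) : ℂ) * ∑' n : Fin 3 → ℤ, coreTerm χ l f z w.re w.im n) * e'

end

section

/-! ### Transformation in the first variable -/

theorem coe_smul_eq (γ : SL(2, ℤ)) (z : ℍ) :
    ((γ • z : ℍ) : ℂ) = ((γ 0 0 : ℂ) * z + (γ 0 1 : ℂ)) / ((γ 1 0 : ℂ) * z + (γ 1 1 : ℂ)) := by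
  rw [UpperHalfPlane.specialLinearGroup_apply]
  simp

theorem det_entries (γ : SL(2, ℤ)) : γ 0 0 * γ 1 1 - γ 0 1 * γ 1 0 = 1 := by
  have := γ.det_coe
  rwa [Matrix.det_fin_two] at this

theorem dvd_of_mem_Gamma0 {M : ℕ} {γ : SL(2, ℤ)} (h : γ ∈ CongruenceSubgroup.Gamma0 M) :
    (M : ℤ) ∣ γ 1 0 := by
  rw [CongruenceSubgroup.Gamma0_mem] at h
  exact (ZMod.intCast_zmod_eq_zero_iff_dvd _ _).1 h

variable {N : ℕ} [NeZero N] (χ : DirichletCharacter ℂ (4 * N)) {l : ℤ}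

theorem IsGenAverage.slashHalf_theta {f : (Fin 3 → ℝ) → ℂ} (hf : IsGenAverage N l f) (m : ℤ)
    {γ : SL(2, ℤ)} (hγ : γ ∈ CongruenceSubgroup.Gamma0 (4 * N)) (z w : ℍ) :
    slashHalf (2 * l + 1) γ (fun z => theta χ l m f z w) z =
      χ (γ 1 1 : ZMod (4 * N)) * theta χ l m f z w := by
  have hdet := det_entries γ
  have hc : (4 * N : ℤ) ∣ γ 1 0 := by simpa using dvd_of_mem_Gamma0 hγ
  have hc4 : (4 : ℤ) ∣ γ 1 0 := (Dvd.intro _ rfl).trans hc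
  have hv := z.im_pos
  have hz : 0 < (z : ℂ).im := hv
  have hq : (γ 1 0 : ℂ) * z + (γ 1 1 : ℂ) ≠ 0 := linear_ne_zero_of_im_pos (row_ne_zero hdet) hz
  have hJ := thetaMult_sq hdet hc4 hz
  have hodd : Odd (γ 1 1) := by
    rw [← Int.not_even_iff_odd]
    rintro ⟨k, hk⟩
    obtain ⟨t, ht⟩ := hc4
    rw [hk, ht] at hdet
    have : (2 : ℤ) ∣ 1 := ⟨γ 0 0 * k - γ 0 1 * 2 * t, by linear_combination -hdet⟩
    omega
  have hχ4 := chiFour_sq_of_odd hodd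
  have hmult : thetaMultiplier γ z = thetaMult (γ 1 0) (γ 1 1) z := rfl
  have him : (γ • z : ℍ).im = z.im / ‖(γ 1 0 : ℂ) * z + (γ 1 1 : ℂ)‖ ^ 2 := by
    have := im_moebius_eq hdet z
    rw [← coe_smul_eq] at this
    exact this
  have hcore := hf.tsum_coreTerm_moebius χ l hdet hc hz w.re w.im_pos
  rw [← coe_smul_eq] at hcore
  rw [slashHalf, theta_eq, theta_eq, hcore, hmult, him, chiOne]
  have hrp : 0 < ‖(γ 1 0 : ℂ) * z + (γ 1 1 : ℂ)‖ := norm_pos_iff.2 hq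
  have hpow : (z.im / ‖(γ 1 0 : ℂ) * z + (γ 1 1 : ℂ)‖ ^ 2) ^ ((1 - l : ℝ) / 2) =
      z.im ^ ((1 - l : ℝ) / 2) * ‖(γ 1 0 : ℂ) * z + (γ 1 1 : ℂ)‖ ^ (l - 1) := by
    rw [Real.div_rpow hv.le (by positivity), ← Real.rpow_natCast, ← Real.rpow_mul hrp.le,
      div_eq_mul_inv, ← Real.rpow_neg hrp.le, ← Real.rpow_intCast]
    congr 2
    push_cast
    ring
  rw [hpow]
  generalize ∑' n, coreTerm χ l f z w.re w.im n = S
  have hrc : (‖(γ 1 0 : ℂ) * z + (γ 1 1 : ℂ)‖ : ℂ) ≠ 0 := by exact_mod_cast hrp.ne'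
  generalize (‖(γ 1 0 : ℂ) * z + (γ 1 1 : ℂ)‖) = r at *
  generalize (γ 1 0 : ℂ) * z + (γ 1 1 : ℂ) = q at *
  have hχne : ((ZMod.χ₄ (γ 1 1 : ZMod 4) : ℤ) : ℂ) ≠ 0 := by
    intro h
    rw [h] at hχ4
    norm_num at hχ4
  generalize ((ZMod.χ₄ (γ 1 1 : ZMod 4) : ℤ) : ℂ) = s at *
  generalize thetaMult (γ 1 0) (γ 1 1) z = J at *
  have hJ0 : J ≠ 0 := by
    rintro rfl
    have : s * q = 0 := by rw [← hJ]; simp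
    exact mul_ne_zero hχne hq this
  -- All automorphy factors cancel: J² = sq with s = (-1/d) reduces J^{-(2l+1)}·J to (sq)^{-l}, and
  -- the powers of r = |q| are (l - 1) + 1 - l = 0.
  have hkey : J ^ (-(2 * l + 1)) * ((r ^ (l - 1) : ℝ) : ℂ) * (s ^ l * J * r * (q / r) ^ l) = 1 := by
    have h1 : J ^ (-(2 * l + 1)) = (J ^ 2) ^ (-l) * J⁻¹ := by
      rw [← zpow_natCast, ← zpow_mul, ← zpow_neg_one, ← zpow_add₀ hJ0]
      congr 1
      push_cast
      ring
    have h2 : ((r ^ (l - 1) : ℝ) : ℂ) * r = (r : ℂ) ^ l := by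
      push_cast
      rw [zpow_sub_one₀ hrc, mul_assoc, inv_mul_cancel₀ hrc, mul_one]
    rw [h1, hJ, div_zpow, zpow_neg, mul_zpow]
    have hs := zpow_ne_zero l hχne
    have hq' := zpow_ne_zero l hq
    have hr' := zpow_ne_zero l hrc
    have : (s ^ l * q ^ l)⁻¹ * J⁻¹ * ((r ^ (l - 1) : ℝ) : ℂ) *
        (s ^ l * J * r * (q ^ l / (r : ℂ) ^ l)) =
        (s ^ l * q ^ l)⁻¹ * (s ^ l * q ^ l) * (J⁻¹ * J) *
          ((((r ^ (l - 1) : ℝ) : ℂ) * r) / (r : ℂ) ^ l) := by ring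
    rw [this, h2, inv_mul_cancel₀ (mul_ne_zero hs hq'), inv_mul_cancel₀ hJ0, div_self hr']
    simp
  generalize (4 * w.im) ^ (-m) = Y
  push_cast at hkey ⊢
  linear_combination ((((32 * (N : ℝ) ^ 3) ^ (-(1 / 2) : ℝ) : ℝ) : ℂ) * I ^ l *
      (((4 * N) ^ (3 / 4 : ℝ) : ℝ) : ℂ) *
      ((z.im ^ ((1 - l : ℝ) / 2) : ℝ) : ℂ) * (Y : ℂ) *
      χ (γ 1 1 : ZMod (4 * N)) * S) * hkey

end

/-! ### Rotation of the kernel functions -/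

theorem polyL_kappa (N ν₁ ν₂ : ℕ) (φ : ℝ) (x : Fin 3 → ℝ) :
    polyL N ν₁ ν₂ (((toSO (kappa φ))⁻¹ : SL(3, ℝ)).1 *ᵥ x) =
      hermiteH ν₁ (√(8 * π / N) * (Real.cos (2 * φ) * (x 0 - x 2) - Real.sin (2 * φ) * x 1)) *
        hermiteH ν₂ (√(8 * π / N) * (Real.sin (2 * φ) * (x 0 - x 2) + Real.cos (2 * φ) * x 1)) := by
  rw [polyL, kappa_inv_sub, kappa_inv_one]

/-- Composing rotations shifts the averaging variable φ by θ; over a full period this leaves the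
integral unchanged and brings out the character. -/
theorem polyLm_kappa (N : ℕ) (m : ℤ) (ν₁ ν₂ : ℕ) (θ : ℝ) (x : Fin 3 → ℝ) :
    polyLm N m ν₁ ν₂ (((toSO (kappa θ))⁻¹ : SL(3, ℝ)).1 *ᵥ x) =
      cexp (-(2 * m * θ * I)) * polyLm N m ν₁ ν₂ x := by
  let g : ℝ → ℂ := fun φ => cexp (2 * m * I * φ) *
    (polyL N ν₁ ν₂ (((toSO (kappa φ))⁻¹ : SL(3, ℝ)).1 *ᵥ x) : ℂ)
  have hper : Function.Periodic g (2 * π) := by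
    intro φ
    simp only [g, polyL_kappa]
    rw [show 2 * (φ + 2 * π) = 2 * φ + 2 * π + 2 * π by ring, Real.cos_add_two_pi,
      Real.cos_add_two_pi, Real.sin_add_two_pi, Real.sin_add_two_pi]
    congr 1
    rw [Complex.exp_eq_exp_iff_exists_int]
    refine ⟨2 * m, ?_⟩
    push_cast
    ring
  have hshift : ∀ φ : ℝ, cexp (2 * m * I * φ) * (polyL N ν₁ ν₂ (((toSO (kappa φ))⁻¹ :
      SL(3, ℝ)).1 *ᵥ (((toSO (kappa θ))⁻¹ : SL(3, ℝ)).1 *ᵥ x)) : ℂ) =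
      cexp (-(2 * m * θ * I)) * g (φ + θ) := by
    intro φ
    simp only [g]
    rw [← mul_assoc, ← Complex.exp_add, polyL_kappa, polyL_kappa, kappa_inv_sub, kappa_inv_one,
      mul_add 2 φ θ, Real.cos_add, Real.sin_add]
    congr 2
    · push_cast
      ring
    · congr 3 <;> ring
  rw [polyLm, polyLm]
  simp only [hshift]
  rw [intervalIntegral.integral_const_mul, intervalIntegral.integral_comp_add_right g θ]
  have h := hper.intervalIntegral_add_eq (0 + θ) 0
  rw [show (0 : ℝ) + θ + 2 * π = 2 * π + θ by ring, zero_add (2 * π)] at h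
  rw [h]
  ring

/-- For the special kernel, x₁ - x₃ - ix₂ is an eigenvector of the plane rotation through 2θ, with
eigenvalue e^{-2iθ}; the Gaussian is rotation invariant. -/
theorem IsThetaKernelFn.kappa_apply {N : ℕ} {l m : ℤ} {f : (Fin 3 → ℝ) → ℂ}
    (hf : IsThetaKernelFn N l m f) (θ : ℝ) (x : Fin 3 → ℝ) :
    f (((toSO (kappa θ))⁻¹ : SL(3, ℝ)).1 *ᵥ x) = cexp (-(2 * m * θ * I)) * f x := by
  rcases hf with ⟨μ, ν₁, ν₂, -, -, rfl⟩ | ⟨n, rfl, rfl, rfl⟩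
  · rw [schwartzFn, schwartzFn, polyLm_kappa, kappa_inv_add, gauss_kappa]
    ring
  · have h : ((((toSO (kappa θ))⁻¹ : SL(3, ℝ)).1 *ᵥ x) 0 : ℂ) -
        I * (((toSO (kappa θ))⁻¹ : SL(3, ℝ)).1 *ᵥ x) 1 -
        (((toSO (kappa θ))⁻¹ : SL(3, ℝ)).1 *ᵥ x) 2 =
        cexp (-(2 * θ * I)) * ((x 0 : ℂ) - I * x 1 - x 2) := by
      have h1 := congrArg ofReal (kappa_inv_sub θ x)
      have h2 := congrArg ofReal (kappa_inv_one θ x)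
      push_cast at h1 h2
      rw [show -(2 * (θ : ℂ) * I) = (-(2 * θ)) * I by ring, Complex.exp_mul_I, Complex.cos_neg,
        Complex.sin_neg]
      linear_combination h1 - I * h2 - (Complex.sin (2 * θ) * x 1) * I_sq
    simp only []
    rw [gauss_kappa, h, mul_pow, ← Complex.exp_nat_mul]
    push_cast
    ring_nf

/-! ### Transformation in the second variable -/

theorem coe_smul_real (G : SL(2, ℝ)) (w : ℍ) :
    ((G • w : ℍ) : ℂ) = ((G 0 0 : ℂ) * w + (G 0 1 : ℂ)) / ((G 1 0 : ℂ) * w + (G 1 1 : ℂ)) := by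
  rw [UpperHalfPlane.coe_specialLinearGroup_apply]
  simp

/-- Gσ_w and σ_{Gw} both send i to Gw, hence differ by a rotation. Its angle is determined by the
bottom row and equals -arg(cw + d). -/
theorem sigma_smul (G : SL(2, ℝ)) (w : ℍ) :
    sigma (G • w) * kappa (-arg ((G 1 0 : ℂ) * w + (G 1 1 : ℂ))) = G * sigma w := by
  have hdet : G 0 0 * G 1 1 - G 0 1 * G 1 0 = 1 := by
    have := G.det_coe
    rwa [Matrix.det_fin_two] at this
  have hw := w.im_pos
  obtain ⟨q, hq⟩ : ∃ q : ℂ, q = (G 1 0 : ℂ) * w + (G 1 1 : ℂ) := ⟨_, rfl⟩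
  have hqre : q.re = G 1 0 * w.re + G 1 1 := by rw [hq]; simp
  have hqim : q.im = G 1 0 * w.im := by rw [hq]; simp
  have hq0 : q ≠ 0 := by
    intro h0
    rw [h0] at hqre hqim
    simp only [zero_re, zero_im] at hqre hqim
    have h1 : G 1 0 = 0 := by
      rcases mul_eq_zero.1 hqim.symm with h | h
      · exact h
      · exact absurd h hw.ne'
    rw [h1] at hqre hdet
    have h2 : G 1 1 = 0 := by linarith
    rw [h2] at hdet
    norm_num at hdet
  have hr : 0 < ‖q‖ := norm_pos_iff.2 hq0
  have hr2 : ‖q‖ ^ 2 = (G 1 0 * w.re + G 1 1) ^ 2 + (G 1 0 * w.im) ^ 2 := by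
    rw [← normSq_eq_norm_sq, normSq_apply, hqre, hqim]
    ring
  have him : (G • w : ℍ).im = w.im / ‖q‖ ^ 2 := by
    rw [← UpperHalfPlane.coe_im, coe_smul_real, ← hq, div_im, ← normSq_eq_norm_sq, ← sub_div, hqre,
      hqim]
    congr 1
    simp
    linear_combination w.im * hdet
  have hre : (G • w : ℍ).re = ((G 0 0 * w.re + G 0 1) * (G 1 0 * w.re + G 1 1) +
      G 0 0 * G 1 0 * w.im ^ 2) / ‖q‖ ^ 2 := by
    rw [← UpperHalfPlane.coe_re, coe_smul_real, ← hq, div_re, ← normSq_eq_norm_sq, ← add_div, hqre,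
      hqim]
    congr 1
    simp
    ring
  have hs : √(w.im / ‖q‖ ^ 2) = √w.im / ‖q‖ := by
    rw [Real.sqrt_div' _ (by positivity), Real.sqrt_sq hr.le]
  have ht : √w.im ≠ 0 := (Real.sqrt_pos.2 hw).ne'
  have ht2 : √w.im ^ 2 = w.im := Real.sq_sqrt hw.le
  rw [← hq]
  ext i j
  rw [Matrix.SpecialLinearGroup.coe_mul, Matrix.SpecialLinearGroup.coe_mul, Matrix.mul_apply,
    Matrix.mul_apply, Fin.sum_univ_two, Fin.sum_univ_two]
  simp only [sigma, kappa, him, hre, hs, Real.cos_neg, Real.sin_neg, Complex.cos_arg hq0,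
    Complex.sin_arg, hqre, hqim]
  generalize ‖q‖ = r at *
  generalize √w.im = t at *
  rw [← ht2] at hr2 ⊢
  have hrne := hr.ne'
  fin_cases i <;> fin_cases j <;> simp <;> field_simp
  · rw [hr2]
    linear_combination (-(G 1 0 * w.re + G 1 1)) * hdet
  · rw [hr2]
    linear_combination t ^ 4 * G 1 0 * hdet

/-! ### The dual lattice and the action of Γ₀(2N) -/

section

theorem sum_Icc_mul_periodic {M : ℕ} [NeZero M] (g : ℤ → ℂ) (hg : Function.Periodic g M) {a : ℤ}
    (ha : IsUnit (a : ZMod M)) :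
    ∑ h ∈ Finset.Icc 1 M, g (a * (h : ℕ)) = ∑ h ∈ Finset.Icc 1 M, g (h : ℕ) := by
  have hzmod : ∀ g : ℤ → ℂ, Function.Periodic g M →
      ∑ h ∈ Finset.Icc 1 M, g (h : ℕ) = ∑ x : ZMod M, g x.val := by
    intro g hg
    rw [sum_Icc_periodic g hg]
    obtain ⟨k, rfl⟩ : ∃ k, M = k + 1 := Nat.exists_eq_succ_of_ne_zero (NeZero.ne M)
    rfl
  have hga : Function.Periodic (fun n => g (a * n)) M := by
    intro n
    have := hg.int_mul a (a * n)
    simp only [Int.cast_id] at this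
    rw [← mul_add] at this
    exact this
  rw [hzmod (fun n => g (a * n)) hga, hzmod g hg]
  obtain ⟨u, hu⟩ := ha
  refine Fintype.sum_equiv u.mulLeft _ _ fun x => ?_
  have h1 : ((u : ZMod M) * x) = ((a * x.val : ℤ) : ZMod M) := by
    push_cast
    rw [hu, ZMod.natCast_zmod_val]
  have h2 := ZMod.val_intCast (n := M) (a * x.val : ℤ)
  change _ = g ((u : ZMod M) * x).val
  rw [h1, h2]
  have h3 := Int.emod_add_mul_ediv (a * x.val : ℤ) M
  have h4 := hg.int_mul ((a * x.val : ℤ) / M) ((a * x.val : ℤ) % M)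
  simp only [Int.cast_id] at h4
  rw [← h4]
  congr 1
  linear_combination -h3

section Character

variable {N : ℕ} [NeZero N] (χ : DirichletCharacter ℂ (4 * N)) (l : ℤ)

theorem expo_add (x y : ℝ) : expo (x + y) = expo x * expo y := by
  rw [expo, expo, expo, ← Complex.exp_add]
  congr 1
  push_cast
  ring

theorem expo_intCast (n : ℤ) : expo n = 1 := by
  rw [expo, Complex.exp_eq_one_iff]
  exact ⟨n, by push_cast; ring⟩

theorem chiCheck_add_mul (t k : ℤ) :
    chiCheck χ l ((t + 4 * N * k : ℤ) : ℝ) = chiCheck χ l (t : ℝ) := by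
  have hN : (N : ℝ) ≠ 0 := by exact_mod_cast NeZero.ne N
  rw [chiCheck, chiCheck]
  refine Finset.sum_congr rfl fun h _ => ?_
  rw [show (h : ℝ) * ((t + 4 * N * k : ℤ) : ℝ) / (4 * N) = h * t / (4 * N) + ((h * k : ℤ) : ℝ) by
    push_cast
    field_simp, expo_add, expo_intCast, mul_one]

/-- The usual Gauss sum substitution h ↦ ah, a permutation of the residues modulo 4N; the inverse of
the conjugate of χ₁(a) is χ₁(a). -/
theorem chiCheck_mul {a : ℤ} (ha : IsCoprime a (4 * N)) (t : ℤ) :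
    chiCheck χ l ((a * t : ℤ) : ℝ) = chiOne χ l a * chiCheck χ l (t : ℝ) := by
  have hN : (N : ℝ) ≠ 0 := by exact_mod_cast NeZero.ne N
  let g : ℤ → ℂ := fun h => starRingEnd ℂ (chiOne χ l h) * expo (h * t / (4 * N))
  have hg : Function.Periodic g (4 * N : ℕ) := by
    intro h
    have h1 := chiOne_add_mul χ l h 1
    simp only [g]
    push_cast
    rw [mul_one] at h1
    rw [h1, show ((h : ℝ) + 4 * N) * t / (4 * N) = h * t / (4 * N) + t by field_simp, expo_add,
      expo_intCast, mul_one]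
  have h1 := sum_Icc_mul_periodic g hg (a := a) (isUnit_of_isCoprime ha)
  have h2 : chiCheck χ l (t : ℝ) = ∑ h ∈ Finset.Icc 1 (4 * N), g (h : ℕ) := by
    rw [chiCheck]
    simp [g]
  rw [h2, ← h1, chiCheck, Finset.mul_sum]
  refine Finset.sum_congr rfl fun h _ => ?_
  simp only [g]
  rw [chiOne_mul, map_mul, ← mul_assoc, ← mul_assoc, mul_conj, normSq_eq_norm_sq,
    norm_chiOne_of_isCoprime χ l ha]
  push_cast
  simp only [one_pow, one_mul]
  congr 2
  ring

end Character

/-- The action of an integral matrix of determinant one on the dual lattice. -/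
def dualMap (a b c d : ℤ) (n : Fin 3 → ℤ) : Fin 3 → ℤ :=
  ![a ^ 2 * n 0 + 2 * a * b * n 1 + b ^ 2 * n 2, a * c * n 0 + (a * d + b * c) * n 1 + b * d * n 2,
    c ^ 2 * n 0 + 2 * c * d * n 1 + d ^ 2 * n 2]

/-- `dualMap` as an equivalence. -/
def dualEquiv {a b c d : ℤ} (h : a * d - b * c = 1) : (Fin 3 → ℤ) ≃ (Fin 3 → ℤ) where
  toFun := dualMap a b c d
  invFun := dualMap d (-b) (-c) a
  left_inv n := by
    ext i
    fin_cases i <;> simp [dualMap]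
    · linear_combination n 0 * (a * d - b * c + 1) * h
    · linear_combination n 1 * (a * d - b * c + 1) * h
    · linear_combination n 2 * (a * d - b * c + 1) * h
  right_inv n := by
    ext i
    fin_cases i <;> simp [dualMap]
    · linear_combination n 0 * (a * d - b * c + 1) * h
    · linear_combination n 1 * (a * d - b * c + 1) * h
    · linear_combination n 2 * (a * d - b * c + 1) * h

theorem dualMap_disc {a b c d : ℤ} (h : a * d - b * c = 1) (n : Fin 3 → ℤ) :
    dualMap a b c d n 1 ^ 2 - dualMap a b c d n 0 * dualMap a b c d n 2 =
      n 1 ^ 2 - n 0 * n 2 := by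
  simp [dualMap]
  linear_combination (n 1 ^ 2 - n 0 * n 2) * (a * d - b * c + 1) * h

theorem dualPoint_dualMap (G : SL(2, ℝ)) {a b c d : ℤ} (ha : G 0 0 = a) (hb : G 0 1 = b)
    (hc : G 1 0 = c) (hd : G 1 1 = d) (n : Fin 3 → ℤ) :
    dualPoint (dualMap a b c d n) = (toSO G).1 *ᵥ dualPoint n := by
  rw [toSO_coe]
  ext i
  fin_cases i <;> simp [dualPoint, dualMap, symMatrix, ha, hb, hc, hd, Matrix.mulVec, dotProduct,
    Fin.sum_univ_succ] <;> ring

variable {N : ℕ} [NeZero N]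

/-- Conjugation of a matrix in `Γ₀(2N)` by `diag (2N, 1)`. -/
def conjMatrix (N : ℕ) {a b c d : ℤ} (h : a * d - (2 * N * b) * c = 1) : SL(2, ℝ) :=
  ⟨!![(a : ℝ), ((2 * N * b : ℤ) : ℝ); (c : ℝ), (d : ℝ)], by
    rw [Matrix.det_fin_two_of]
    exact_mod_cast h⟩

theorem dilate_smul {γ : SL(2, ℤ)} {c : ℤ} (hc : γ 1 0 = 2 * N * c)
    (h : γ 0 0 * γ 1 1 - (2 * N * γ 0 1) * c = 1) (w : ℍ) :
    dilate (2 * N) (γ • w) = conjMatrix N h • dilate (2 * N) w := by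
  have e : ∀ w : ℍ, ((dilate (2 * N) w : ℍ) : ℂ) = 2 * N * w := by
    intro w
    rw [dilate, UpperHalfPlane.coe_pos_real_smul]
    simp
  apply UpperHalfPlane.ext
  rw [e, coe_smul_eq, coe_smul_real, e, hc]
  simp [conjMatrix]
  ring

variable (χ : DirichletCharacter ℂ (4 * N)) {l m : ℤ}

/-- Scaling w by 2N conjugates γ to an integral matrix acting on the dual lattice. `sigma_smul` then
leaves only a rotation, whose angle arg(cw + d) is not affected by the scaling. -/
theorem thetaPoint_smul {γ : SL(2, ℤ)} {c : ℤ} (hc : γ 1 0 = 2 * N * c)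
    (h : γ 0 0 * γ 1 1 - (2 * N * γ 0 1) * c = 1) (v : ℝ) (w : ℍ) (n : Fin 3 → ℤ) :
    thetaPoint N v (γ • w).re (γ • w).im (dualMap (γ 0 0) (2 * N * γ 0 1) c (γ 1 1) n) =
      ((toSO (kappa (arg ((γ 1 0 : ℂ) * w + (γ 1 1 : ℂ)))))⁻¹ : SL(3, ℝ)).1 *ᵥ
        thetaPoint N v w.re w.im n := by
  have h1 := sigma_smul (conjMatrix N h) (dilate (2 * N) w)
  have harg : ((conjMatrix N h 1 0 : ℝ) : ℂ) * ((dilate (2 * N) w : ℍ) : ℂ) +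
      ((conjMatrix N h 1 1 : ℝ) : ℂ) = (γ 1 0 : ℂ) * w + (γ 1 1 : ℂ) := by
    rw [dilate, UpperHalfPlane.coe_pos_real_smul, hc]
    simp [conjMatrix]
    ring
  rw [harg, ← dilate_smul hc h] at h1
  have h2 : ((toSO (sigma (dilate (2 * N) (γ • w))))⁻¹ : SL(3, ℝ)) * toSO (conjMatrix N h) =
      (toSO (kappa (arg ((γ 1 0 : ℂ) * w + (γ 1 1 : ℂ)))))⁻¹ *
        (toSO (sigma (dilate (2 * N) w)))⁻¹ := by
    rw [← map_inv, ← map_inv, ← map_inv, ← map_mul, ← map_mul, kappa_inv_apply]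
    congr 1
    rw [inv_mul_eq_iff_eq_mul, ← mul_assoc, h1, mul_inv_cancel_right]
  rw [← thetaPoint_eq, ← thetaPoint_eq, dualPoint_dualMap (conjMatrix N h) rfl rfl rfl rfl,
    ← Matrix.mulVec_smul, Matrix.mulVec_mulVec, Matrix.mulVec_mulVec]
  have h3 := congrArg Subtype.val h2
  rw [Matrix.SpecialLinearGroup.coe_mul, Matrix.SpecialLinearGroup.coe_mul] at h3
  rw [h3]

theorem isCoprime_four_mul {N : ℕ} {a b c d : ℤ} (h : a * d - (2 * N * b) * c = 1) :
    IsCoprime a (4 * N : ℤ) := by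
  have h1 : IsCoprime a (2 : ℤ) := ⟨d, -(N * b * c), by linear_combination h⟩
  have h2 : IsCoprime a (N : ℤ) := ⟨d, -(2 * b * c), by linear_combination h⟩
  have := (h1.mul_right h1).mul_right h2
  norm_num at this
  exact this

theorem IsThetaKernelFn.coreTerm_smul {f : (Fin 3 → ℝ) → ℂ} (hf : IsThetaKernelFn N l m f)
    {γ : SL(2, ℤ)} {c : ℤ} (hc : γ 1 0 = 2 * N * c)
    (h : γ 0 0 * γ 1 1 - (2 * N * γ 0 1) * c = 1) (z : ℂ) (w : ℍ) (n : Fin 3 → ℤ) :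
    coreTerm χ l f z (γ • w).re (γ • w).im (dualMap (γ 0 0) (2 * N * γ 0 1) c (γ 1 1) n) =
      chiOne χ l (γ 0 0) ^ 2 * cexp (-(2 * m * arg ((γ 1 0 : ℂ) * w + (γ 1 1 : ℂ)) * I)) *
        coreTerm χ l f z w.re w.im n := by
  have hodd := isCoprime_four_mul h
  have hdisc : ((dualMap (γ 0 0) (2 * N * γ 0 1) c (γ 1 1) n 1 : ℝ) ^ 2 -
      dualMap (γ 0 0) (2 * N * γ 0 1) c (γ 1 1) n 0 *
        dualMap (γ 0 0) (2 * N * γ 0 1) c (γ 1 1) n 2) = (n 1 : ℝ) ^ 2 - n 0 * n 2 := by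
    exact_mod_cast dualMap_disc h n
  have hchi : chiCheck χ l (dualMap (γ 0 0) (2 * N * γ 0 1) c (γ 1 1) n 0 : ℤ) =
      chiOne χ l (γ 0 0) ^ 2 * chiCheck χ l (n 0 : ℤ) := by
    -- The upper right entry of the conjugated matrix is 2Nb, and both 2a·2Nb and (2Nb)² are
    -- divisible by 4N. Hence n₀ is multiplied by a² modulo 4N, although the level is only 2N.
    have e : dualMap (γ 0 0) (2 * N * γ 0 1) c (γ 1 1) n 0 = γ 0 0 * (γ 0 0 * n 0) +
        4 * N * (γ 0 0 * γ 0 1 * n 1 + N * γ 0 1 ^ 2 * n 2) := by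
      simp [dualMap]
      ring
    rw [e, chiCheck_add_mul, chiCheck_mul χ l hodd, chiCheck_mul χ l hodd]
    ring
  rw [coreTerm, coreTerm, hdisc, hchi, thetaPoint_smul hc h, hf.kappa_apply]
  ring

/-- The conjugated rotation character is e^{2im·arg q}, exactly the phase removed by q^{-2m}; the
modulus is cancelled by the power of the imaginary part. This is why the conjugate of θ is the
automorphic function. -/
theorem im_zpow_mul_conj_arg {v : ℝ} (hv : 0 < v) {q : ℂ} (hq : q ≠ 0) (m : ℤ) :
    (((v / ‖q‖ ^ 2) ^ (-m) : ℝ) : ℂ) * starRingEnd ℂ (cexp (-(2 * m * arg q * I))) *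
      q ^ (-(2 * m)) = ((v ^ (-m) : ℝ) : ℂ) := by
  have hr : (‖q‖ : ℂ) ≠ 0 := by exact_mod_cast norm_ne_zero_iff.2 hq
  have hv' : (v : ℂ) ≠ 0 := by exact_mod_cast hv.ne'
  have h1 : starRingEnd ℂ (cexp (-(2 * m * arg q * I))) = cexp (arg q * I) ^ (2 * m) := by
    rw [← Complex.exp_conj, ← Complex.exp_int_mul]
    congr 1
    simp only [map_neg, map_mul, conj_ofReal, conj_I, map_ofNat, map_intCast]
    push_cast
    ring
  have h2 : cexp (arg q * I) ≠ 0 := Complex.exp_ne_zero _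
  have h3 : q ^ (-(2 * m)) = (‖q‖ : ℂ) ^ (-(2 * m)) * cexp (arg q * I) ^ (-(2 * m)) := by
    rw [← mul_zpow, norm_mul_exp_arg_mul_I]
  rw [h1, h3]
  push_cast
  rw [div_zpow, zpow_neg (cexp _), zpow_neg (_ ^ 2), ← zpow_natCast (‖q‖ : ℂ), ← zpow_mul,
    zpow_neg (‖q‖ : ℂ)]
  have h4 := zpow_ne_zero (2 * m) h2
  have h5 := zpow_ne_zero (2 * m) hr
  push_cast
  field_simp

/-- Squaring kills (-1/·), and ad ≡ 1 mod 2N gives (ad)² ≡ 1 mod 4N, so the conjugate of χ(a)² is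
χ(d)². -/
theorem conj_chiOne_sq {N : ℕ} (χ : DirichletCharacter ℂ (4 * N)) (l : ℤ) {a b c d : ℤ} (h : a * d - (2 * N * b) * c = 1) :
    starRingEnd ℂ (chiOne χ l a ^ 2) = (χ ^ 2) (d : ZMod (4 * N)) := by
  have ha := isCoprime_four_mul h
  have hodd := odd_of_isCoprime ha
  have had : ((a : ZMod (4 * N)) * d) ^ 2 = 1 := by
    have h0 : ((4 * N : ℕ) : ZMod (4 * N)) = 0 := ZMod.natCast_self _
    have h1 := congrArg (Int.cast : ℤ → ZMod (4 * N)) h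
    push_cast at h0 h1
    linear_combination ((a : ZMod (4 * N)) * d + 1 + 2 * N * b * c) * h1 +
      (b * c + N * b ^ 2 * c ^ 2) * h0
  have h1 : χ a ^ 2 * χ d ^ 2 = 1 := by
    rw [← mul_pow, ← map_mul, ← map_pow, had, map_one]
  have h2 : chiOne χ l a ^ 2 = χ a ^ 2 := by
    rw [chiOne, mul_pow, ← zpow_natCast (_ ^ l), ← zpow_mul, mul_comm l, zpow_mul, zpow_natCast,
      chiFour_sq_of_odd hodd, one_zpow, mul_one]
  have h3 : ‖χ a ^ 2‖ = 1 := by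
    rw [← h2, norm_pow, norm_chiOne_of_isCoprime χ l ha, one_pow]
  have h4 : starRingEnd ℂ (χ a ^ 2) * χ a ^ 2 = 1 := by
    rw [mul_comm, mul_conj, normSq_eq_norm_sq, h3]
    simp
  rw [h2, MulChar.pow_apply' _ two_ne_zero]
  linear_combination χ d ^ 2 * h4 - starRingEnd ℂ (χ a ^ 2) * h1

theorem IsThetaKernelFn.slash_theta {f : (Fin 3 → ℝ) → ℂ} (hf : IsThetaKernelFn N l m f)
    {γ : SL(2, ℤ)} (hγ : γ ∈ CongruenceSubgroup.Gamma0 (2 * N)) (z w : ℍ) :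
    ((fun w : ℍ => starRingEnd ℂ (theta χ l m f z w)) ∣[2 * m] γ) w =
      (χ ^ 2) (γ 1 1 : ZMod (4 * N)) * starRingEnd ℂ (theta χ l m f z w) := by
  have hdet := det_entries γ
  obtain ⟨c, hc⟩ : (2 * N : ℤ) ∣ γ 1 0 := by simpa using dvd_of_mem_Gamma0 hγ
  have h : γ 0 0 * γ 1 1 - (2 * N * γ 0 1) * c = 1 := by
    rw [hc] at hdet
    linear_combination hdet
  have hq : (γ 1 0 : ℂ) * w + (γ 1 1 : ℂ) ≠ 0 :=
    linear_ne_zero_of_im_pos (row_ne_zero hdet) w.im_pos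
  have him : (γ • w : ℍ).im = w.im / ‖(γ 1 0 : ℂ) * w + (γ 1 1 : ℂ)‖ ^ 2 := by
    have := im_moebius_eq hdet w
    rw [← coe_smul_eq] at this
    exact this
  have hsum : ∑' n, coreTerm χ l f z (γ • w).re (γ • w).im n = chiOne χ l (γ 0 0) ^ 2 *
      cexp (-(2 * m * arg ((γ 1 0 : ℂ) * w + (γ 1 1 : ℂ)) * I)) *
        ∑' n, coreTerm χ l f z w.re w.im n := by
    -- Reindex the lattice sum at γw by the automorphism that γ induces on the dual lattice.
    rw [← (dualEquiv h).tsum_eq, ← tsum_mul_left]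
    exact tsum_congr fun n => hf.coreTerm_smul χ hc h z w n
  have hchar : starRingEnd ℂ (chiOne χ l (γ 0 0) ^ 2) = (χ ^ 2) (γ 1 1 : ZMod (4 * N)) :=
    conj_chiOne_sq χ l h
  have hpow : (((4 * (γ • w : ℍ).im) ^ (-m) : ℝ) : ℂ) *
      starRingEnd ℂ (cexp (-(2 * m * arg ((γ 1 0 : ℂ) * w + (γ 1 1 : ℂ)) * I))) *
      ((γ 1 0 : ℂ) * w + (γ 1 1 : ℂ)) ^ (-(2 * m)) = (((4 * w.im) ^ (-m) : ℝ) : ℂ) := by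
    rw [him, ← mul_div_assoc]
    exact im_zpow_mul_conj_arg (by have := w.im_pos; positivity) hq m
  rw [ModularForm.SL_slash_apply, theta_eq, theta_eq, hsum]
  have hden : UpperHalfPlane.denom γ w = (γ 1 0 : ℂ) * w + (γ 1 1 : ℂ) := rfl
  rw [hden, ← hchar]
  simp only [map_mul, conj_ofReal]
  rw [← hpow]
  ring

end

/-! ### The kernel functions are polynomials times a Gaussian -/

/-- Evaluation of a polynomial at a real point. -/
def polyEval (x : Fin 3 → ℝ) (P : MvPolynomial (Fin 3) ℂ) : ℂ :=
  MvPolynomial.eval (fun i => (x i : ℂ)) P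

/-- Polynomial functions on `ℝ³`. -/
def IsPolyFn (F : (Fin 3 → ℝ) → ℂ) : Prop := ∃ P, ∀ x, F x = polyEval x P

theorem IsPolyFn.const (a : ℂ) : IsPolyFn fun _ => a :=
  ⟨MvPolynomial.C a, fun x => by simp [polyEval]⟩

theorem IsPolyFn.coord (i : Fin 3) : IsPolyFn fun x => (x i : ℂ) :=
  ⟨MvPolynomial.X i, fun x => by simp [polyEval]⟩

theorem IsPolyFn.add {F G : (Fin 3 → ℝ) → ℂ} (hF : IsPolyFn F) (hG : IsPolyFn G) :
    IsPolyFn fun x => F x + G x := by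
  obtain ⟨P, hP⟩ := hF
  obtain ⟨Q, hQ⟩ := hG
  exact ⟨P + Q, fun x => by dsimp only; rw [hP, hQ]; simp [polyEval]⟩

theorem IsPolyFn.mul {F G : (Fin 3 → ℝ) → ℂ} (hF : IsPolyFn F) (hG : IsPolyFn G) :
    IsPolyFn fun x => F x * G x := by
  obtain ⟨P, hP⟩ := hF
  obtain ⟨Q, hQ⟩ := hG
  exact ⟨P * Q, fun x => by dsimp only; rw [hP, hQ]; simp [polyEval]⟩

theorem IsPolyFn.sub {F G : (Fin 3 → ℝ) → ℂ} (hF : IsPolyFn F) (hG : IsPolyFn G) :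
    IsPolyFn fun x => F x - G x := by
  obtain ⟨P, hP⟩ := hF
  obtain ⟨Q, hQ⟩ := hG
  exact ⟨P - Q, fun x => by dsimp only; rw [hP, hQ]; simp [polyEval]⟩

theorem IsPolyFn.pow {F : (Fin 3 → ℝ) → ℂ} (hF : IsPolyFn F) (n : ℕ) :
    IsPolyFn fun x => F x ^ n := by
  obtain ⟨P, hP⟩ := hF
  exact ⟨P ^ n, fun x => by dsimp only; rw [hP]; simp [polyEval]⟩

theorem IsPolyFn.hermiteH {F : (Fin 3 → ℝ) → ℝ} (hF : IsPolyFn fun x => (F x : ℂ)) (n : ℕ) :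
    IsPolyFn fun x => (hermiteH n (F x) : ℂ) := by
  obtain ⟨P, hP⟩ := hF
  refine ⟨Polynomial.aeval P (Polynomial.hermite n), fun x => ?_⟩
  dsimp only [IndefTheta.hermiteH] at hP ⊢
  rw [← aeval_ofReal, hP, polyEval, polyEval, Polynomial.aeval_def,
    Polynomial.aeval_def, Polynomial.hom_eval₂]
  congr 1
  exact RingHom.ext_int _ _

/-- Multiplying P by a variable multiplies the weight h by entries of B and leaves the coordinates
x_j outside the integral. Hence the induction on P must let h vary. -/
theorem isPolyFn_integral {r s : ℝ} {B : ℝ → Fin 3 → Fin 3 → ℝ} (hB : ∀ i j, Continuous fun φ => B φ i j)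
    (P : MvPolynomial (Fin 3) ℂ) : ∀ {h : ℝ → ℂ}, Continuous h →
    IsPolyFn fun x => ∫ φ in r..s, h φ * polyEval (fun i => ∑ j, B φ i j * x j) P := by
  have hcont : ∀ (x : Fin 3 → ℝ) (P : MvPolynomial (Fin 3) ℂ),
      Continuous fun φ => polyEval (fun i => ∑ j, B φ i j * x j) P := by
    intro x P
    unfold polyEval
    refine (MvPolynomial.continuous_eval P).comp (continuous_pi fun i => ?_)
    fun_prop
  induction P using MvPolynomial.induction_on with
  | C a =>
    intro h hh
    simp only [polyEval, MvPolynomial.eval_C]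
    exact IsPolyFn.const _
  | add P Q hP hQ =>
    intro h hh
    obtain ⟨R, hR⟩ := (hP hh).add (hQ hh)
    refine ⟨R, fun x => ?_⟩
    have hcP := hcont x P
    have hcQ := hcont x Q
    rw [← hR x]
    dsimp only
    rw [← intervalIntegral.integral_add]
    · congr 1
      funext φ
      simp only [polyEval, map_add]
      ring
    all_goals
      apply Continuous.intervalIntegrable
      fun_prop
  | mul_X P i hP =>
    intro h hh
    have hj : ∀ j, IsPolyFn fun x => (x j : ℂ) * ∫ φ in r..s, (h φ * (B φ i j : ℂ)) *
        polyEval (fun i => ∑ j, B φ i j * x j) P := fun j => by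
      have := hB i j
      exact (IsPolyFn.coord j).mul (hP (by fun_prop))
    obtain ⟨R, hR⟩ := ((hj 0).add (hj 1)).add (hj 2)
    refine ⟨R, fun x => ?_⟩
    rw [← hR x]
    dsimp only
    rw [← intervalIntegral.integral_const_mul, ← intervalIntegral.integral_const_mul,
      ← intervalIntegral.integral_const_mul]
    have hc := hcont x P
    have hB' := hB i
    rw [← intervalIntegral.integral_add, ← intervalIntegral.integral_add]
    · congr 1
      funext φ
      simp only [polyEval, map_mul, MvPolynomial.eval_X, Fin.sum_univ_three]
      push_cast
      ring
    all_goals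
      apply Continuous.intervalIntegrable
      fun_prop

theorem isPolyFn_polyL (N ν₁ ν₂ : ℕ) : IsPolyFn fun x => (polyL N ν₁ ν₂ x : ℂ) := by
  have h1 : IsPolyFn fun x : Fin 3 → ℝ => ((√(8 * π / N) * (x 0 - x 2) : ℝ) : ℂ) := by
    push_cast
    exact (IsPolyFn.const _).mul ((IsPolyFn.coord 0).sub (IsPolyFn.coord 2))
  have h2 : IsPolyFn fun x : Fin 3 → ℝ => ((√(8 * π / N) * x 1 : ℝ) : ℂ) := by
    push_cast
    exact (IsPolyFn.const _).mul (IsPolyFn.coord 1)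
  simp only [polyL, ofReal_mul (hermiteH _ _)]
  exact (h1.hermiteH ν₁).mul (h2.hermiteH ν₂)

theorem isPolyFn_polyLm (N : ℕ) (m : ℤ) (ν₁ ν₂ : ℕ) : IsPolyFn (polyLm N m ν₁ ν₂) := by
  obtain ⟨P, hP⟩ := isPolyFn_polyL N ν₁ ν₂
  have h := isPolyFn_integral (r := 0) (s := 2 * π)
    (B := fun φ => ((toSO (kappa φ))⁻¹ : SL(3, ℝ)).1) ?_ P
    (h := fun φ => cexp (2 * m * I * φ)) (by fun_prop)
  · convert (IsPolyFn.const (1 / (2 * (π : ℂ)))).mul h using 2 with x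
    rw [polyLm]
    simp only [hP]
    rfl
  · intro i j
    simp only [toSO_inv_coe, kappa_inv_apply]
    fin_cases i <;> fin_cases j <;> simp [symMatrix, kappa] <;> fun_prop

theorem IsThetaKernelFn.exists_poly {N : ℕ} {l m : ℤ} {f : (Fin 3 → ℝ) → ℂ}
    (hf : IsThetaKernelFn N l m f) :
    ∃ P : MvPolynomial (Fin 3) ℂ, ∀ x, f x = polyEval x P * gauss N x := by
  rcases hf with ⟨μ, ν₁, ν₂, -, -, rfl⟩ | ⟨n, -, -, rfl⟩
  · have h1 : IsPolyFn fun x : Fin 3 → ℝ => ((√(8 * π / N) * (x 0 + x 2) : ℝ) : ℂ) := by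
      push_cast
      exact (IsPolyFn.const _).mul ((IsPolyFn.coord 0).add (IsPolyFn.coord 2))
    obtain ⟨P, hP⟩ := (isPolyFn_polyLm N m ν₁ ν₂).mul (h1.hermiteH μ)
    exact ⟨P, fun x => by rw [← hP, schwartzFn]⟩
  · obtain ⟨P, hP⟩ := (((IsPolyFn.coord 0).sub ((IsPolyFn.const I).mul (IsPolyFn.coord 1))).sub
      (IsPolyFn.coord 2)).pow n
    exact ⟨P, fun x => by rw [← hP]⟩

/-! ### Smoothness -/

/-- Multiplying P by a variable replaces the coefficients c(n) by c(n)n_j, weighted by the smooth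
functions M i j. Induction on P reduces everything to `contDiffOn_gaussSum` composed with A. -/
theorem contDiffOn_polyGaussSum {E : Type*} [NormedAddCommGroup E] [NormedSpace ℝ E] {U : Set E}
    {A : E → Fin 3 → Fin 3 → ℂ} (hA : ContDiffOn ℝ ∞ A U) (hneg : ∀ τ ∈ U, A τ ∈ negForms)
    {M : E → Fin 3 → Fin 3 → ℝ} (hM : ∀ i j, ContDiffOn ℝ ∞ (fun τ => M τ i j) U)
    (P : MvPolynomial (Fin 3) ℂ) : ∀ {c : (Fin 3 → ℤ) → ℂ}, PolyGrowth c →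
    (∀ τ ∈ U, Summable fun n : Fin 3 → ℤ =>
      c n * polyEval (fun i => ∑ j, M τ i j * n j) P * cexp (quadVal (A τ) n)) ∧
    ContDiffOn ℝ ∞ (fun τ => ∑' n : Fin 3 → ℤ,
      c n * polyEval (fun i => ∑ j, M τ i j * n j) P * cexp (quadVal (A τ) n)) U := by
  induction P using MvPolynomial.induction_on with
  | C a =>
    intro c hc
    have hc' : PolyGrowth fun n => a * c n := hc.mul_bounded (B := ‖a‖) fun _ => le_rfl
    have e : ∀ τ (n : Fin 3 → ℤ), c n * polyEval (fun i => ∑ j, M τ i j * n j)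
        (MvPolynomial.C a) * cexp (quadVal (A τ) n) = a * c n * cexp (quadVal (A τ) n) := by
      intro τ n
      simp only [polyEval, MvPolynomial.eval_C]
      ring
    simp only [e]
    exact ⟨fun τ hτ => summable_gaussSum hc' (hneg τ hτ),
      (contDiffOn_gaussSum hc').comp hA hneg⟩
  | add P Q hP hQ =>
    intro c hc
    obtain ⟨hP1, hP2⟩ := hP hc
    obtain ⟨hQ1, hQ2⟩ := hQ hc
    have e : ∀ τ (n : Fin 3 → ℤ), c n * polyEval (fun i => ∑ j, M τ i j * n j) (P + Q) *
        cexp (quadVal (A τ) n) =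
        c n * polyEval (fun i => ∑ j, M τ i j * n j) P * cexp (quadVal (A τ) n) +
        c n * polyEval (fun i => ∑ j, M τ i j * n j) Q * cexp (quadVal (A τ) n) := by
      intro τ n
      simp only [polyEval, map_add]
      ring
    simp only [e]
    exact ⟨fun τ hτ => (hP1 τ hτ).add (hQ1 τ hτ),
      (hP2.add hQ2).congr fun τ hτ => (hP1 τ hτ).tsum_add (hQ1 τ hτ)⟩
  | mul_X P i hP =>
    intro c hc
    have h0 := hP (hc.mul_coord 0)
    have h1 := hP (hc.mul_coord 1)
    have h2 := hP (hc.mul_coord 2)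
    have e : ∀ τ (n : Fin 3 → ℤ), c n * polyEval (fun i => ∑ j, M τ i j * n j)
        (P * MvPolynomial.X i) * cexp (quadVal (A τ) n) =
        (M τ i 0 : ℂ) * (c n * n 0 * polyEval (fun i => ∑ j, M τ i j * n j) P *
          cexp (quadVal (A τ) n)) +
        (M τ i 1 : ℂ) * (c n * n 1 * polyEval (fun i => ∑ j, M τ i j * n j) P *
          cexp (quadVal (A τ) n)) +
        (M τ i 2 : ℂ) * (c n * n 2 * polyEval (fun i => ∑ j, M τ i j * n j) P *
          cexp (quadVal (A τ) n)) := by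
      intro τ n
      simp only [polyEval, map_mul, MvPolynomial.eval_X, Fin.sum_univ_three]
      push_cast
      ring
    simp only [e]
    have hMc : ∀ j, ContDiffOn ℝ ∞ (fun τ => (M τ i j : ℂ)) U := fun j =>
      ofRealCLM.contDiff.comp_contDiffOn (hM i j)
    refine ⟨fun τ hτ => (((h0.1 τ hτ).mul_left _).add ((h1.1 τ hτ).mul_left _)).add
      ((h2.1 τ hτ).mul_left _), ?_⟩
    refine ((((hMc 0).mul h0.2).add ((hMc 1).mul h1.2)).add ((hMc 2).mul h2.2)).congr
      fun τ hτ => ?_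
    rw [Summable.tsum_add (((h0.1 τ hτ).mul_left _).add ((h1.1 τ hτ).mul_left _))
      ((h2.1 τ hτ).mul_left _), Summable.tsum_add ((h0.1 τ hτ).mul_left _)
      ((h1.1 τ hτ).mul_left _), tsum_mul_left, tsum_mul_left, tsum_mul_left]

section

/-- The matrix of `thetaPoint`. -/
def pointMatrix (N : ℕ) (p : ℂ × ℂ) : Fin 3 → Fin 3 → ℝ :=
  ![![√(4 * N * p.1.im) * (1 / (8 * N * p.2.im)), √(4 * N * p.1.im) * (-p.2.re / (2 * p.2.im)),
      √(4 * N * p.1.im) * (N * p.2.re ^ 2 / (2 * p.2.im))],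
    ![0, √(4 * N * p.1.im) * (1 / 2), √(4 * N * p.1.im) * (-N * p.2.re)],
    ![0, 0, √(4 * N * p.1.im) * (N * p.2.im / 2)]]

/-- The matrix of the exponent of the theta series. -/
def expMatrix (N : ℕ) (p : ℂ × ℂ) : Fin 3 → Fin 3 → ℂ := fun i j =>
  2 * π * I * p.1.re * (!![0, 0, -1; 0, 1, 0; 0, 0, 0] : Matrix (Fin 3) (Fin 3) ℂ) i j -
    2 * π / N * (2 * pointMatrix N p 0 i * pointMatrix N p 0 j +
      pointMatrix N p 1 i * pointMatrix N p 1 j + 2 * pointMatrix N p 2 i * pointMatrix N p 2 j : ℝ)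

/-- Pairs of points with positive imaginary parts. -/
def posPairs : Set (ℂ × ℂ) := {p | 0 < p.1.im ∧ 0 < p.2.im}

theorem pointMatrix_apply {N : ℕ} [NeZero N] {p : ℂ × ℂ} (hp : p ∈ posPairs) (n : Fin 3 → ℤ) :
    (fun i => ∑ j, pointMatrix N p i j * (n j : ℝ)) = thetaPoint N p.1.im p.2.re p.2.im n := by
  have hN : (N : ℝ) ≠ 0 := by exact_mod_cast NeZero.ne N
  have hy := hp.2.ne'
  ext i
  fin_cases i <;> simp [pointMatrix, thetaPoint, Fin.sum_univ_three] <;> field_simp <;> ring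

theorem quadVal_expMatrix {N : ℕ} [NeZero N] {p : ℂ × ℂ} (hp : p ∈ posPairs) (n : Fin 3 → ℤ) :
    quadVal (expMatrix N p) n = 2 * π * I * (p.1.re * (n 1 ^ 2 - n 0 * n 2) : ℝ) +
      (-2 * π / N * gaussForm (thetaPoint N p.1.im p.2.re p.2.im n) : ℝ) := by
  rw [← pointMatrix_apply hp, gaussForm, quadVal]
  simp only [expMatrix, Fin.sum_univ_three]
  push_cast
  simp
  ring

theorem expMatrix_mem {N : ℕ} [NeZero N] {p : ℂ × ℂ} (hp : p ∈ posPairs) :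
    expMatrix N p ∈ negForms := by
  have hN : (0 : ℝ) < N := Nat.cast_pos.2 (NeZero.pos N)
  obtain ⟨ε, hε, h⟩ := exists_gaussForm_bound N hp.1 p.2.re hp.2
  have hpi := Real.pi_pos
  refine ⟨2 * π / N * ε, by positivity, fun n => ?_⟩
  rw [quadVal_expMatrix hp, add_re, ofReal_re]
  have h1 : (2 * (π : ℂ) * I * (p.1.re * (n 1 ^ 2 - n 0 * n 2) : ℝ)).re = 0 := by
    rw [show 2 * (π : ℂ) * I * (p.1.re * (n 1 ^ 2 - n 0 * n 2) : ℝ) =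
      (2 * π * (p.1.re * (n 1 ^ 2 - n 0 * n 2)) : ℝ) * I by push_cast; ring, re_ofReal_mul, I_re,
      mul_zero]
  rw [h1]
  have h2 := mul_le_mul_of_nonneg_left (h n) (show 0 ≤ 2 * π / N by positivity)
  have h3 : -2 * π / N = -(2 * π / N) := by ring
  rw [h3]
  linarith

theorem contDiffOn_pointMatrix (N : ℕ) [NeZero N] (i j : Fin 3) :
    ContDiffOn ℝ ∞ (fun p => pointMatrix N p i j) posPairs := by
  have hN : (0 : ℝ) < N := Nat.cast_pos.2 (NeZero.pos N)
  have him : ContDiff ℝ ∞ Complex.im := imCLM.contDiff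
  have hre : ContDiff ℝ ∞ Complex.re := reCLM.contDiff
  have h1 : ContDiffOn ℝ ∞ (fun p : ℂ × ℂ => √(4 * N * p.1.im)) posPairs := by
    refine ContDiffOn.sqrt ?_ fun p hp => ?_
    · exact (contDiff_const.mul (him.comp contDiff_fst)).contDiffOn
    · have := hp.1
      positivity
  have hy : ContDiffOn ℝ ∞ (fun p : ℂ × ℂ => p.2.im) posPairs :=
    (him.comp contDiff_snd).contDiffOn
  have hx : ContDiffOn ℝ ∞ (fun p : ℂ × ℂ => p.2.re) posPairs :=
    (hre.comp contDiff_snd).contDiffOn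
  have hne2 : ∀ p ∈ posPairs, 2 * p.2.im ≠ 0 := fun p hp => mul_ne_zero two_ne_zero hp.2.ne'
  have hne8 : ∀ p ∈ posPairs, 8 * (N : ℝ) * p.2.im ≠ 0 := fun p hp =>
    mul_ne_zero (by positivity) hp.2.ne'
  have e0 : ContDiffOn ℝ ∞ (fun _ : ℂ × ℂ => (0 : ℝ)) posPairs := contDiffOn_const
  have e1 : ContDiffOn ℝ ∞ (fun p : ℂ × ℂ => √(4 * N * p.1.im) * (1 / (8 * N * p.2.im)))
      posPairs := h1.mul (contDiffOn_const.div (contDiffOn_const.mul hy) hne8)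
  have e2 : ContDiffOn ℝ ∞ (fun p : ℂ × ℂ => √(4 * N * p.1.im) * (-p.2.re / (2 * p.2.im)))
      posPairs := h1.mul (hx.neg.div (contDiffOn_const.mul hy) hne2)
  have e3 : ContDiffOn ℝ ∞ (fun p : ℂ × ℂ => √(4 * N * p.1.im) * (N * p.2.re ^ 2 / (2 * p.2.im)))
      posPairs := h1.mul ((contDiffOn_const.mul (hx.pow 2)).div (contDiffOn_const.mul hy) hne2)
  have e4 : ContDiffOn ℝ ∞ (fun p : ℂ × ℂ => √(4 * N * p.1.im) * (1 / 2)) posPairs :=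
    h1.mul contDiffOn_const
  have e5 : ContDiffOn ℝ ∞ (fun p : ℂ × ℂ => √(4 * N * p.1.im) * (-N * p.2.re)) posPairs :=
    h1.mul (contDiffOn_const.mul hx)
  have e6 : ContDiffOn ℝ ∞ (fun p : ℂ × ℂ => √(4 * N * p.1.im) * (N * p.2.im / 2)) posPairs :=
    h1.mul ((contDiffOn_const.mul hy).div_const 2)
  fin_cases i <;> fin_cases j
  exacts [e1, e2, e3, e0, e4, e5, e0, e0, e6]

theorem contDiffOn_expMatrix (N : ℕ) [NeZero N] :
    ContDiffOn ℝ ∞ (expMatrix N) posPairs := by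
  have hre : ContDiff ℝ ∞ Complex.re := reCLM.contDiff
  have h1 : ContDiffOn ℝ ∞ (fun p : ℂ × ℂ => (p.1.re : ℂ)) posPairs :=
    (ofRealCLM.contDiff.comp (hre.comp contDiff_fst)).contDiffOn
  have hM := contDiffOn_pointMatrix N
  rw [contDiffOn_pi]
  intro i
  rw [contDiffOn_pi]
  intro j
  unfold expMatrix
  refine ((contDiffOn_const.mul h1).mul contDiffOn_const).sub (contDiffOn_const.mul
    (ofRealCLM.contDiff.comp_contDiffOn ?_))
  exact (((contDiffOn_const.mul (hM 0 i)).mul (hM 0 j)).add ((hM 1 i).mul (hM 1 j))).add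
    ((contDiffOn_const.mul (hM 2 i)).mul (hM 2 j))

variable {N : ℕ} [NeZero N] (χ : DirichletCharacter ℂ (4 * N)) {l m : ℤ}

theorem IsThetaKernelFn.contDiffOn_tsum_coreTerm {f : (Fin 3 → ℝ) → ℂ}
    (hf : IsThetaKernelFn N l m f) :
    ContDiffOn ℝ ∞ (fun p : ℂ × ℂ => ∑' n, coreTerm χ l f p.1 p.2.re p.2.im n) posPairs := by
  obtain ⟨P, hP⟩ := hf.exists_poly
  have hc : PolyGrowth fun n => chiCheck χ l (n 0) :=
    ⟨4 * N, 0, fun n => by simpa using norm_chiCheck_le χ l (n 0)⟩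
  refine (contDiffOn_polyGaussSum (contDiffOn_expMatrix N) (fun _ => expMatrix_mem)
    (contDiffOn_pointMatrix N) P hc).2.congr fun p hp => tsum_congr fun n => ?_
  rw [pointMatrix_apply hp, quadVal_expMatrix hp, Complex.exp_add, coreTerm, hP, expo, gauss,
    gaussForm, ofReal_exp]
  ring

/-- Joint smoothness in (z, w); freezing either variable gives the smoothness required in the two
parts of the theorem. -/
theorem IsThetaKernelFn.contDiffOn_theta {f : (Fin 3 → ℝ) → ℂ} (hf : IsThetaKernelFn N l m f) :
    ContDiffOn ℝ ∞ (fun p : ℂ × ℂ => theta χ l m f (UpperHalfPlane.ofComplex p.1)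
      (UpperHalfPlane.ofComplex p.2)) posPairs := by
  have him : ContDiff ℝ ∞ Complex.im := imCLM.contDiff
  have h1 : ContDiffOn ℝ ∞ (fun p : ℂ × ℂ => ((p.1.im ^ ((1 - l : ℝ) / 2) : ℝ) : ℂ)) posPairs :=
    ofRealCLM.contDiff.comp_contDiffOn ((him.comp contDiff_fst).contDiffOn.rpow_const_of_ne
      fun p hp => hp.1.ne')
  have h2 : ContDiffOn ℝ ∞ (fun p : ℂ × ℂ => (((4 * p.2.im) ^ ((-m : ℤ) : ℝ) : ℝ) : ℂ)) posPairs :=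
    ofRealCLM.contDiff.comp_contDiffOn
      ((contDiff_const.mul (him.comp contDiff_snd)).contDiffOn.rpow_const_of_ne
        fun p hp => mul_ne_zero four_ne_zero hp.2.ne')
  refine (((contDiffOn_const (c := ((32 * (N : ℝ) ^ 3) ^ (-(1 / 2) : ℝ) : ℝ) * I ^ l *
      (((4 * N) ^ (3 / 4 : ℝ) : ℝ) : ℂ))).mul h1).mul h2).mul (hf.contDiffOn_tsum_coreTerm χ)
    |>.congr fun p hp => ?_
  have e1 := UpperHalfPlane.ofComplex_apply_of_im_pos hp.1
  have e2 := UpperHalfPlane.ofComplex_apply_of_im_pos hp.2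
  rw [theta_eq, e1, e2, Real.rpow_intCast]
  rfl

end

end IndefTheta

theorem theorem3p6 (N : ℕ) [NeZero N] (χ : DirichletCharacter ℂ (4 * N)) (l m : ℤ)
    (f : (Fin 3 → ℝ) → ℂ) (hf : IndefTheta.IsThetaKernelFn N l m f) :
    (∀ z w : ℍ, Summable fun n : Fin 3 → ℤ =>
      IndefTheta.thetaTerm χ l f z w (IndefTheta.dualPoint n)) ∧
    (∀ w : ℍ, (fun z : ℍ => IndefTheta.theta χ l m f z w) ∈
      IndefTheta.nonholFormsHalf (2 * l + 1) (CongruenceSubgroup.Gamma0 (4 * N))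
        (fun d : ℤ => χ (d : ZMod (4 * N)))) ∧
    (∀ z : ℍ, (fun w : ℍ => starRingEnd ℂ (IndefTheta.theta χ l m f z w)) ∈
      IndefTheta.nonholForms (2 * m) (CongruenceSubgroup.Gamma0 (2 * N))
        (fun d : ℤ => (χ ^ 2) (d : ZMod (4 * N)))) := by
  refine ⟨fun z w => ?_, fun w => ⟨?_, fun γ hγ z => ?_⟩, fun z => ⟨?_, fun γ hγ w => ?_⟩⟩
  · simp only [IndefTheta.thetaTerm_eq]
    exact (hf.isGenAverage.summable_coreTerm z.im_pos w.re w.im_pos).mul_left _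
  · have h := (hf.contDiffOn_theta χ).comp (s := {z : ℂ | 0 < z.im})
      (f := fun z : ℂ => (z, (w : ℂ))) (contDiff_id.prodMk contDiff_const).contDiffOn
      fun z hz => ⟨hz, w.im_pos⟩
    refine h.congr fun z hz => ?_
    simp
  · exact hf.isGenAverage.slashHalf_theta χ m hγ z w
  · have h := (hf.contDiffOn_theta χ).comp (s := {w : ℂ | 0 < w.im})
      (f := fun w : ℂ => ((z : ℂ), w)) (contDiff_const.prodMk contDiff_id).contDiffOn
      fun w hw => ⟨z.im_pos, hw⟩
    refine (Complex.conjCLE.contDiff.comp_contDiffOn h).congr fun w hw => ?_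
    simp
  · exact hf.slash_theta χ hγ z w

end
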